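/- **Theorem 5.1 (forcing term bound).** Let $d\ge 3$ and $N>1$ be integers, let $\langle r\rangle=(1+r^2)^{1/2}$, and let $\mu:\mathbb R^d\to\mathbb R$ be smooth with $|\nabla_v^m\mu(v)|\le C_{m,M}\langle v\rangle^{-M}$ for all $m\in\mathbb N$ and $M>0$. Let $A>0$. There exist $\bar\varepsilon>0$ and $C>0$, depending only on $d,N,\mu,A$, such that the following holds for every $0\le\varepsilon\le\bar\varepsilon$. Let $E(t,x)\in\mathbb R^d$, $t\ge0$, $x\in\mathbb R^d$, be a vector field of class $C^N$ in $x$ whose derivatives $\nabla_x^kE$, $0\le k\le N$, are continuous in $(t,x)$. For $s,t\ge 0$ let $(X_{s,t}(x,v),V_{s,t}(x,v))$ solve $$\frac{d}{ds}X_{s,t}=V_{s,t},\qquad \frac{d}{ds}V_{s,t}=E(s,X_{s,t}),\qquad X_{t,t}(x,v)=x,\quad V_{t,t}(x,v)=v,$$ and define $Y_{s,t},W_{s,t}$ by $X_{s,t}(x,v)=x-(t-s)v+Y_{s,t}(x-tv,v)$ and $V_{s,t}(x,v)=v+W_{s,t}(x-tv,v)$. Assume that for all $0\le k\le N$ and all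 $t\ge0$ $$\langle t\rangle^{d+k}\|\nabla_x^kE(t)\|_{L^\infty}\le A\varepsilon\log(2+t),\qquad \langle t\rangle^{k}\|\nabla_x^kE(t)\|_{L^1}\le A\varepsilon\log(2+t),$$ and that $Y_{s,t},W_{s,t}$ are of class $C^N$ in $v$ with, for all $0\le k\le N$ and $0\le s\le t$, $$\|\nabla_v^kY_{s,t}\|_{L^\infty}\le A\varepsilon\frac{\log(2+s)}{(1+s)^{d-2}},\qquad \|\nabla_v^kW_{s,t}\|_{L^\infty}\le A\varepsilon\frac{\log(2+s)}{(1+s)^{d-1}}.$$ Write the forcing term as $S=\mathcal I+\mathcal R$, where $$\mathcal I(t,x)=\int_{\mathbb R^d}f_0(X_{0,t}(x,v),V_{0,t}(x,v))\,dv,$$ $$\mathcal R(t,x)=\int_0^t\!\!\int_{\mathbb R^d}E(s,x-(t-s)v)\cdot\nabla_v\mu(v)\,dv\,ds-\int_0^t\!\!\int_{\mathbb R^d}E(s,X_{s,t}(x,v))\cdot\nabla_v\mu(V_{s,t}(x,v))\,dv\,ds .$$ (i) Let $\varepsilon_0\ge0$ and let $f_0:\mathbb R^d_x\times\mathbb R^d_v\to\mathbb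 R$ have weak derivatives up to order $N$ with $$\max_{0\le k\le N}\left(\|\nabla_{x,v}^kf_0\|_{L^1_{x,v}}+\|\nabla_{x,v}^kf_0\|_{L^1_xL^\infty_v}\right)\le\varepsilon_0 .$$ Then for every $t\ge0$ the integral defining $\mathcal I(t,x)$ converges absolutely for almost every $x$, $\mathcal I(t,\cdot)$ has weak derivatives up to order $N$, and $$\max_{0\le k\le N}\left(\langle t\rangle^k\|\nabla_x^k\mathcal I(t)\|_{L^1}+t^{d+k}\|\nabla_x^k\mathcal I(t)\|_{L^\infty}\right)\le C\varepsilon_0$$ (with the second summand read as $0$ at $t=0$; for $t\ge1$ its weight $t^{d+k}$ is comparable to $\langle t\rangle^{d+k}$). (ii) For every $t\ge0$ the two double integrals defining $\mathcal R(t,x)$ converge absolutely for every $x$, $\mathcal R(t,\cdot)$ is of class $C^N$, and $$\max_{0\le k\le N}\left(\langle t\rangle^k\|\nabla_x^k\mathcal R(t)\|_{L^1}+\langle t\rangle^{d+k}\|\nabla_x^k\mathcal R(t)\|_{L^\infty}\right)\le C\varepsilon^2 .$$ -/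

import Mathlib

open MeasureTheory Set
open scoped ContDiff ENNReal

noncomputable section

namespace VlasovForcing

/-- The Euclidean space `ℝ^d` (positions or velocities). -/
abbrev Sp (d : ℕ) := EuclideanSpace ℝ (Fin d)

/-- The Japanese bracket `⟨r⟩ = (1 + r^2)^{1/2}`. -/
def jb (r : ℝ) : ℝ := Real.sqrt (1 + r ^ 2)

/-- `g` is the weak (distributional) derivative of order `k` of the scalar function `u`: both are
locally integrable and `∫ u ∂^k φ(m₁,…,m_k) = (-1)^k ∫ g(m₁,…,m_k) φ` for all test functions `φ`
and all directions `m₁,…,m_k`. -/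
def IsWeakDeriv {F : Type*} [NormedAddCommGroup F] [NormedSpace ℝ F] [MeasureSpace F]
    (k : ℕ) (u : F → ℝ) (g : F → ContinuousMultilinearMap ℝ (fun _ : Fin k => F) ℝ) : Prop :=
  LocallyIntegrable u volume ∧ LocallyIntegrable g volume ∧
    ∀ φ : F → ℝ, ContDiff ℝ ∞ φ → HasCompactSupport φ → ∀ m : Fin k → F,
      ∫ z, u z * iteratedFDeriv ℝ k φ z m = (-1) ^ k * ∫ z, g z m * φ z

/-- The mixed norm `‖g‖_{L^1_x L^∞_v} = ∫ ‖g(x,·)‖_{L^∞} dx`. -/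
def normL1Linf {d : ℕ} {G : Type*} [NormedAddCommGroup G] (g : Sp d × Sp d → G) : ℝ≥0∞ :=
  ∫⁻ x, eLpNorm (fun v => g (x, v)) ∞ volume

/-- The equilibrium `μ` is smooth, and each of its derivatives decays faster than any power. -/
def RapidDecay {d : ℕ} (μ : Sp d → ℝ) : Prop :=
  ContDiff ℝ ∞ μ ∧
    ∀ (m : ℕ) (M : ℝ), 0 < M → ∃ C : ℝ, 0 < C ∧
      ∀ v, ‖iteratedFDeriv ℝ m μ v‖ ≤ C * jb ‖v‖ ^ (-M)

/-- `E(t,x)`, `t ≥ 0`, is a field of class `C^N` in `x` whose `x`-derivatives of order `≤ N`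
are continuous in `(t,x)`. -/
def FieldRegular {d : ℕ} (N : ℕ) (E : ℝ → Sp d → Sp d) : Prop :=
  (∀ t, 0 ≤ t → ContDiff ℝ N (E t)) ∧
    ∀ k, k ≤ N → ContinuousOn
      (fun p : ℝ × Sp d => iteratedFDeriv ℝ k (E p.1) p.2) (Ici 0 ×ˢ univ)

/-- `⟨t⟩^{d+k} ‖∇_x^k E(t)‖_{L^∞} ≤ B log(2+t)` and `⟨t⟩^k ‖∇_x^k E(t)‖_{L^1} ≤ B log(2+t)`
for `0 ≤ k ≤ N`. -/
def FieldDecay {d : ℕ} (N : ℕ) (B : ℝ) (E : ℝ → Sp d → Sp d) : Prop :=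
  ∀ t, 0 ≤ t → ∀ k, k ≤ N →
    (∀ x, jb t ^ (d + k) * ‖iteratedFDeriv ℝ k (E t) x‖ ≤ B * Real.log (2 + t)) ∧
    ENNReal.ofReal (jb t ^ k) * eLpNorm (iteratedFDeriv ℝ k (E t)) 1 volume
      ≤ ENNReal.ofReal (B * Real.log (2 + t))

/-- `s ↦ (X s t x v, V s t x v)` is, on `[0,∞)`, the solution of the characteristic system
`X' = V`, `V' = E(s, X)` with value `(x, v)` at `s = t`. -/
def IsCharacteristics {d : ℕ} (E : ℝ → Sp d → Sp d)
    (X V : ℝ → ℝ → Sp d → Sp d → Sp d) : Prop :=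
  ∀ t, 0 ≤ t → ∀ x v, X t t x v = x ∧ V t t x v = v ∧
    ∀ s, 0 ≤ s →
      HasDerivWithinAt (fun r => X r t x v) (V s t x v) (Ici 0) s ∧
      HasDerivWithinAt (fun r => V r t x v) (E s (X s t x v)) (Ici 0) s

/-- The deviation `Y` from free transport:
`X_{s,t}(x,v) = x - (t-s)v + Y_{s,t}(x-tv, v)`. -/
def devY {d : ℕ} (X : ℝ → ℝ → Sp d → Sp d → Sp d) (s t : ℝ) (x v : Sp d) : Sp d :=
  X s t (x + t • v) v - ((x + t • v) - (t - s) • v)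

/-- The deviation `W` from free transport: `V_{s,t}(x,v) = v + W_{s,t}(x-tv, v)`. -/
def devW {d : ℕ} (V : ℝ → ℝ → Sp d → Sp d → Sp d) (s t : ℝ) (x v : Sp d) : Sp d :=
  V s t (x + t • v) v - v

/-- `Z_{s,t}(x,v)` is of class `C^N` in `v`, and
`‖∇_v^k Z_{s,t}‖_{L^∞} ≤ B log(2+s) / (1+s)^p` for `0 ≤ k ≤ N` and `0 ≤ s ≤ t`. -/
def DeviationDecay {d : ℕ} (N : ℕ) (B : ℝ) (p : ℕ)
    (Z : ℝ → ℝ → Sp d → Sp d → Sp d) : Prop :=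
  ∀ s t, 0 ≤ s → s ≤ t → ∀ x, ContDiff ℝ N (Z s t x) ∧
    ∀ k, k ≤ N → ∀ v,
      ‖iteratedFDeriv ℝ k (Z s t x) v‖ ≤ B * (Real.log (2 + s) / (1 + s) ^ p)

/-- The initial datum `f₀(x,v)` has weak derivatives `∇_{x,v}^k f₀`, `0 ≤ k ≤ N`, with
`‖∇_{x,v}^k f₀‖_{L^1_{x,v}} + ‖∇_{x,v}^k f₀‖_{L^1_x L^∞_v} ≤ ε₀`. -/
def SmallDatum {d : ℕ} (N : ℕ) (ε₀ : ℝ) (f₀ : Sp d × Sp d → ℝ) : Prop :=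
  ∀ k, k ≤ N → ∃ g, IsWeakDeriv k f₀ g ∧
    eLpNorm g 1 volume + normL1Linf g ≤ ENNReal.ofReal ε₀

/-- The initial data term `I(t,x) = ∫ f₀(X_{0,t}(x,v), V_{0,t}(x,v)) dv`. -/
def termI {d : ℕ} (f₀ : Sp d × Sp d → ℝ) (X V : ℝ → ℝ → Sp d → Sp d → Sp d)
    (t : ℝ) (x : Sp d) : ℝ :=
  ∫ v, f₀ (X 0 t x v, V 0 t x v)

/-- The integrand `E(s, x-(t-s)v) · ∇μ(v)` of the linear reaction term. -/
def integrandRL {d : ℕ} (E : ℝ → Sp d → Sp d) (μ : Sp d → ℝ)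
    (t : ℝ) (x : Sp d) (s : ℝ) (v : Sp d) : ℝ :=
  fderiv ℝ μ v (E s (x - (t - s) • v))

/-- The integrand `E(s, X_{s,t}(x,v)) · ∇μ(V_{s,t}(x,v))` of the nonlinear reaction term. -/
def integrandRNL {d : ℕ} (E : ℝ → Sp d → Sp d) (μ : Sp d → ℝ)
    (X V : ℝ → ℝ → Sp d → Sp d → Sp d) (t : ℝ) (x : Sp d) (s : ℝ) (v : Sp d) : ℝ :=
  fderiv ℝ μ (V s t x v) (E s (X s t x v))

/-- The reaction term `R = R_L - R_NL`. -/
def termR {d : ℕ} (E : ℝ → Sp d → Sp d) (μ : Sp d → ℝ)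
    (X V : ℝ → ℝ → Sp d → Sp d → Sp d) (t : ℝ) (x : Sp d) : ℝ :=
  (∫ s in (0 : ℝ)..t, ∫ v, integrandRL E μ t x s v) -
    ∫ s in (0 : ℝ)..t, ∫ v, integrandRNL E μ X V t x s v

end VlasovForcing

end

/-! Since `d ≥ 3` and the logarithm costs at most a quarter power, `(1+s)^k |∇^k E(s)|` is of size
`ε (1+s)^(-11/4)`, a weight that survives two integrations in time. The characteristics ending at
time `t` therefore solve a fixed-point equation "path = free path + twice integrated force" in
`C([0,t], ℝ^d)` whose contraction constant is `O(ε)` uniformly in `t`. The inverse function theorem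
in that Banach space gives a `C^N` flow (`exists_contDiff_flow`), and a bootstrap on the order
bounds its derivatives.

The gain `⟨t⟩^(-k)` comes from a moving frame. A velocity integral is invariant under translation in
`v`, so one may put `x = ⟨t⟩ζ` and shift `v` by `(t/⟨t⟩)ζ`. In this frame the free position at time
`s` has coefficient `(1+ts)/⟨t⟩ ≤ 1+s` in `ζ`: a `ζ`-derivative of `E(s, ·)` costs `1+s`, which the
decay of the derivatives of `E` repays, while each `x`-derivative is `⟨t⟩⁻¹` times a `ζ`-derivative
(`norm_freePath_frame_le`, `norm_iteratedFDeriv_force_le`).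

For the reaction term, the change of variables from `v` to the average velocity `u = (x -
X_{s,t}(x,v))/(t-s)`, made in the linear integral only, brings both integrands to the same position.
What remains is the Jacobian minus one, the difference between `u` and `V_{s,t}`, and the difference
of the jets of the two trajectories, all `O(ε (1+s)^(-7/4))` (`norm_jac_smul_sub_le`). The extra
derivative of the mean value theorem falls on `∇μ`, never on `E`. Multiplied by the remaining factor
of `E`, whose rescaled norms are `O(ε (1+s)^(1/4))`, this is integrable in `s` and gives `ε²`. The
factor `⟨t⟩^d` in the sup bound uses the pointwise decay of `E` when `t-s ≤ 1+s` and its `L^1` bound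
otherwise (`lintegral_wt_mul_env_le`).

For the initial data term, the flow to time `0`, composed with a volume-preserving shear, is a
near-identity map with Jacobian at least `1/2`, so composition with it is bounded on `L^1`. Smooth
approximations of `f₀`, the Faà di Bruno formula and integration by parts in `x` identify the weak
derivatives as velocity integrals of pulled-back jets (`integral_slantFlow`, `isWeakDeriv_termI`).
Their sup norm is controlled by a majorant depending on position only, integrated after passing to
the average velocity at `s = 0`, which yields `t^(-d)`. -/

noncomputable section

namespace VlasovForcing

/-! ### Superposition operators on spaces of continuous paths -/

section Nemytskii

variable {K : Type} [TopologicalSpace K] [CompactSpace K]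
  {E G : Type} [NormedAddCommGroup E] [NormedSpace ℝ E] [NormedAddCommGroup G] [NormedSpace ℝ G]

/-- The superposition (Nemytskii) operator `γ ↦ (τ ↦ F (τ, γ τ))`. -/
def nem (F : C(K × E, G)) (γ : C(K, E)) : C(K, G) :=
  F.comp ((ContinuousMap.id K).prodMk γ)

@[simp] lemma nem_apply (F : C(K × E, G)) (γ : C(K, E)) (τ : K) : nem F γ τ = F (τ, γ τ) := rfl

lemma continuous_nem (F : C(K × E, G)) : Continuous (nem F) := by
  refine ContinuousMap.continuous_of_continuous_uncurry _ ?_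
  change Continuous fun p : C(K, E) × K => F (p.2, p.1 p.2)
  fun_prop

/-- Pointwise application of a continuous family of operators, as a bounded bilinear map. -/
def applyFamily : C(K, E →L[ℝ] G) →L[ℝ] C(K, E) →L[ℝ] C(K, G) :=
  LinearMap.mkContinuous₂
    (LinearMap.mk₂ ℝ
      (fun (A : C(K, E →L[ℝ] G)) (h : C(K, E)) => (⟨fun τ => A τ (h τ), by fun_prop⟩ : C(K, G)))
      (fun A A' h => by ext; simp) (fun c A h => by ext; simp) (fun A h h' => by ext; simp)
      (fun c A h => by ext; simp)) 1
    (fun A h => by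
      rw [ContinuousMap.norm_le _ (by positivity)]
      intro τ
      simpa using (A τ).le_of_opNorm_le_of_le (A.norm_coe_le_norm τ) (h.norm_coe_le_norm τ))

@[simp] lemma applyFamily_apply (A : C(K, E →L[ℝ] G)) (h : C(K, E)) (τ : K) :
    applyFamily A h τ = A τ (h τ) := rfl

/-- Compactness of `K` makes the pointwise derivative uniform: the tube lemma gives one radius on
which `F'` stays within `c` of its value along the graph of `γ`, and the mean value inequality on
that ball bounds the remainder simultaneously for all `τ`. -/
lemma hasFDerivAt_nem (F : C(K × E, G)) (F' : C(K × E, E →L[ℝ] G))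
    (h : ∀ τ x, HasFDerivAt (fun y => F (τ, y)) (F' (τ, x)) x) (γ : C(K, E)) :
    HasFDerivAt (nem F) (applyFamily (nem F' γ)) γ := by
  rw [hasFDerivAt_iff_isLittleO_nhds_zero, Asymptotics.isLittleO_iff]
  intro c hc
  have hopen : IsOpen {p : K × E | ‖F' (p.1, γ p.1 + p.2) - F' (p.1, γ p.1)‖ < c} :=
    isOpen_lt (by fun_prop) continuous_const
  obtain ⟨u, v, -, hv, hu, h0, huv⟩ := generalized_tube_lemma (s := (univ : Set K)) isCompact_univ
    (t := {(0 : E)}) isCompact_singleton hopen (by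
      rintro ⟨τ, y⟩ ⟨-, hy⟩
      simp only [mem_singleton_iff] at hy
      simpa [hy] using hc)
  obtain ⟨δ, hδ, hball⟩ := Metric.isOpen_iff.1 hv 0 (h0 rfl)
  filter_upwards [Metric.ball_mem_nhds (0 : C(K, E)) hδ] with k hk
  rw [ContinuousMap.norm_le _ (by positivity)]
  intro τ
  have hkτ : ‖k τ‖ < δ := (k.norm_coe_le_norm τ).trans_lt (by simpa using hk)
  have hconv := (convex_ball (γ τ) δ).norm_image_sub_le_of_norm_hasFDerivWithin_le'
    (f := fun y => F (τ, y)) (f' := fun y => F' (τ, y)) (φ := F' (τ, γ τ)) (C := c)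
    (fun y _ => (h τ y).hasFDerivWithinAt)
    (fun y hy => by
      have : (τ, y - γ τ) ∈ u ×ˢ v := ⟨hu (mem_univ _), hball (by simpa [dist_eq_norm] using hy)⟩
      have := huv this
      simp only [mem_ofPred_eq, add_sub_cancel] at this
      exact this.le)
    (Metric.mem_ball_self hδ) (y := γ τ + k τ) (by simpa using hkτ)
  simp only [add_sub_cancel_left] at hconv
  refine le_trans (by simpa using hconv) ?_
  gcongr
  exact k.norm_coe_le_norm τ

lemma continuous_fderiv_of_iteratedFDeriv {Z : Type*} [TopologicalSpace Z] {F : Z → E → G}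
    (n : ℕ) (h : ∀ k, k ≤ n + 1 → Continuous fun p : Z × E => iteratedFDeriv ℝ k (F p.1) p.2) :
    ∀ k, k ≤ n → Continuous fun p : Z × E => iteratedFDeriv ℝ k (fderiv ℝ (F p.1)) p.2 := by
  intro k hk
  have := h (k + 1) (by omega)
  simp only [iteratedFDeriv_succ_eq_comp_right, Function.comp_apply] at this
  refine ((continuousMultilinearCurryRightEquiv' ℝ k E G).continuous.comp this).congr fun p => ?_
  exact (continuousMultilinearCurryRightEquiv' ℝ k E G).apply_symm_apply _

/-- The derivative of a superposition operator is again one, built from the fibre derivative of `F`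
and followed by the bounded map `applyFamily`. Induction on the order, with the target space
generalized, concludes. -/
theorem contDiff_nem (n : ℕ) (F : C(K × E, G)) (hF : ∀ τ, ContDiff ℝ n fun x => F (τ, x))
    (hF' : ∀ k, k ≤ n → Continuous fun p : K × E => iteratedFDeriv ℝ k (fun x => F (p.1, x)) p.2) :
    ContDiff ℝ n (nem F) := by
  induction n generalizing G with
  | zero => simpa [contDiff_zero] using continuous_nem F
  | succ n ih =>
    have hc : Continuous fun p : K × E => fderiv ℝ (fun x => F (p.1, x)) p.2 := by
      have := continuous_fderiv_of_iteratedFDeriv (F := fun (τ : K) x => F (τ, x)) n hF' 0 (by omega)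
      have h2 := (continuousMultilinearCurryFin0 ℝ E (E →L[ℝ] G)).continuous.comp this
      refine h2.congr fun p => ?_
      simp
    let F' : C(K × E, E →L[ℝ] G) := ⟨_, hc⟩
    have hd : ∀ τ x, HasFDerivAt (fun y => F (τ, y)) (F' (τ, x)) x := fun τ x =>
      (((hF τ).differentiable (by simp)) x).hasFDerivAt
    have hn : ContDiff ℝ n (nem F') := by
      refine ih F' (fun τ => ?_) ?_
      · exact (hF τ).fderiv_right (m := n) (by norm_cast)
      · exact continuous_fderiv_of_iteratedFDeriv (F := fun (τ : K) x => F (τ, x)) n hF'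
    have hL : ContDiff ℝ n (applyFamily ∘ nem F') :=
      (applyFamily (K := K) (E := E) (G := G)).contDiff.comp hn
    rw [show ((n + 1 : ℕ) : WithTop ℕ∞) = (n : WithTop ℕ∞) + 1 by push_cast; rfl,
      contDiff_succ_iff_hasFDerivAt]
    exact ⟨fun γ => applyFamily (nem F' γ),
      hL,
      fun γ => hasFDerivAt_nem F F' hd γ⟩

end Nemytskii

/-! ### Backward integration in time and decay weights -/

section Integration

variable {G : Type} [NormedAddCommGroup G] [NormedSpace ℝ G]

/-- Backward integration `f ↦ (s ↦ ∫_s^t f)` on `C([0,t], G)`. -/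
def backInt (t : ℝ) (ht : 0 ≤ t) : C(Icc (0 : ℝ) t, G) →L[ℝ] C(Icc (0 : ℝ) t, G) :=
  LinearMap.mkContinuous
    -- Composition with `projIcc` extends `f` continuously to the whole line; only its values on
    -- `[s,t]` enter the integral.
    { toFun := fun f => ⟨fun s => ∫ τ in (s : ℝ)..t, f (projIcc 0 t ht τ), by
        have hc : Continuous fun τ => f (projIcc 0 t ht τ) := by fun_prop
        have := intervalIntegral.continuous_primitive (μ := volume)
          (fun a b => hc.intervalIntegrable a b) t
        have h2 : ∀ s : Icc (0 : ℝ) t, ∫ τ in (s : ℝ)..t, f (projIcc 0 t ht τ)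
            = -∫ τ in t..(s : ℝ), f (projIcc 0 t ht τ) := fun s =>
          intervalIntegral.integral_symm _ _
        simp only [h2]
        exact (this.comp continuous_subtype_val).neg⟩
      map_add' := fun f g => by
        ext s
        have hf : Continuous fun τ => f (projIcc 0 t ht τ) := by fun_prop
        have hg : Continuous fun τ => g (projIcc 0 t ht τ) := by fun_prop
        simpa using intervalIntegral.integral_add (hf.intervalIntegrable _ _)
          (hg.intervalIntegrable _ _)
      map_smul' := fun c f => by ext s; simp } t
    (fun f => by
      rw [ContinuousMap.norm_le _ (by positivity)]
      intro s
      refine (intervalIntegral.norm_integral_le_of_norm_le_const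
        (C := ‖f‖) fun τ _ => f.norm_coe_le_norm _).trans ?_
      rw [mul_comm]
      gcongr
      rw [abs_of_nonneg (by linarith [s.2.2])]
      linarith [s.2.1])

lemma backInt_apply (t : ℝ) (ht : 0 ≤ t) (f : C(Icc (0 : ℝ) t, G)) (s : Icc (0 : ℝ) t) :
    backInt t ht f s = ∫ τ in (s : ℝ)..t, f (projIcc 0 t ht τ) := rfl

lemma integral_rpow_tail {s t r : ℝ} (hs : 0 ≤ s) (hst : s ≤ t) (hr : 1 < r) :
    ∫ τ in s..t, (1 + τ) ^ (-r) ≤ (1 / (r - 1)) * (1 + s) ^ (-(r - 1)) := by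
  rw [intervalIntegral.integral_comp_add_left (fun x : ℝ => x ^ (-r)) 1,
    integral_rpow (Or.inr ⟨by linarith, by
      rw [uIcc_of_le (by linarith)]; rintro ⟨h, -⟩; linarith⟩)]
  have h1 : 0 ≤ (1 + t) ^ (-r + 1) := Real.rpow_nonneg (by linarith) _
  have h2 : -r + 1 = -(r - 1) := by ring
  rw [h2] at h1 ⊢
  rw [div_neg, ← neg_div, neg_sub, div_eq_mul_inv, mul_comm, one_div]
  have : 0 < (r - 1)⁻¹ := inv_pos.2 (by linarith)
  gcongr
  linarith

lemma continuousOn_rpow_weight {s t r : ℝ} (hs : 0 ≤ s) :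
    ContinuousOn (fun τ : ℝ => (1 + τ) ^ (-r)) (Icc s t) := by
  refine ContinuousOn.rpow_const (by fun_prop) fun x hx => Or.inl ?_
  have := hx.1
  linarith

/-- Backward integration gains one power of decay. -/
lemma norm_integral_le_of_weight {s t r c : ℝ} (hs : 0 ≤ s) (hst : s ≤ t) (hr : 1 < r)
    (hc : 0 ≤ c) {f : ℝ → G} (hf : ∀ τ ∈ Icc s t, ‖f τ‖ ≤ c * (1 + τ) ^ (-r)) :
    ‖∫ τ in s..t, f τ‖ ≤ c / (r - 1) * (1 + s) ^ (-(r - 1)) := by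
  have hi : IntervalIntegrable (fun τ : ℝ => c * (1 + τ) ^ (-r)) volume s t := by
    apply ContinuousOn.intervalIntegrable
    rw [uIcc_of_le hst]
    exact (continuousOn_rpow_weight hs).const_mul c
  refine (intervalIntegral.norm_integral_le_of_norm_le hst
    (ae_of_all _ fun τ hτ => hf τ ⟨hτ.1.le, hτ.2⟩) hi).trans ?_
  rw [intervalIntegral.integral_const_mul]
  refine (mul_le_mul_of_nonneg_left (integral_rpow_tail hs hst hr) hc).trans_eq ?_
  ring

lemma norm_backInt_le {t : ℝ} (ht : 0 ≤ t) {f : C(Icc (0 : ℝ) t, G)} {r c : ℝ} (hr : 1 < r)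
    (hc : 0 ≤ c) (s : Icc (0 : ℝ) t)
    (hf : ∀ τ : Icc (0 : ℝ) t, s ≤ τ → ‖f τ‖ ≤ c * (1 + (τ : ℝ)) ^ (-r)) :
    ‖backInt t ht f s‖ ≤ c / (r - 1) * (1 + (s : ℝ)) ^ (-(r - 1)) := by
  rw [backInt_apply]
  refine norm_integral_le_of_weight s.2.1 s.2.2 hr hc fun τ hτ => ?_
  have hτ' : τ ∈ Icc 0 t := ⟨s.2.1.trans hτ.1, hτ.2⟩
  rw [projIcc_of_mem ht hτ']
  exact hf ⟨τ, hτ'⟩ hτ.1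

/-- Evaluation at a time, as a bounded operator. -/
def evalL {t : ℝ} (s : Icc (0 : ℝ) t) : C(Icc (0 : ℝ) t, G) →L[ℝ] G := ContinuousMap.evalCLM ℝ s

@[simp] lemma evalL_apply {t : ℝ} (s : Icc (0 : ℝ) t) (f : C(Icc (0 : ℝ) t, G)) :
    evalL s f = f s := rfl

variable {P : Type} [NormedAddCommGroup P] [NormedSpace ℝ P]

/-- Evaluation at a time is bounded and linear, so it commutes with differentiation in the
parameter. This converts between smoothness in path space and estimates at fixed times. -/
lemma iteratedFDeriv_eval {t : ℝ} {N : ℕ} {g : P → C(Icc (0 : ℝ) t, G)} (hg : ContDiff ℝ N g)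
    {k : ℕ} (hk : k ≤ N) (s : Icc (0 : ℝ) t) (p : P) (m : Fin k → P) :
    iteratedFDeriv ℝ k (fun q => g q s) p m = iteratedFDeriv ℝ k g p m s := by
  have := (evalL s).iteratedFDeriv_comp_left (hg.contDiffAt (x := p)) (i := k) (by exact_mod_cast hk)
  have h2 := congrArg (fun M => M m) this
  exact h2

lemma contDiff_eval {t : ℝ} {n : WithTop ℕ∞} {g : P → C(Icc (0 : ℝ) t, G)} (hg : ContDiff ℝ n g)
    (s : Icc (0 : ℝ) t) : ContDiff ℝ n fun q => g q s :=
  (evalL (G := G) s).contDiff.comp hg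

/-- Derivatives with respect to a parameter gain one power of decay by backward integration. -/
lemma norm_iteratedFDeriv_backInt_le {t : ℝ} (ht : 0 ≤ t) {N : ℕ} {g : P → C(Icc (0 : ℝ) t, G)}
    (hg : ContDiff ℝ N g) {k : ℕ} (hk : k ≤ N) {r c : ℝ} (hr : 1 < r) (hc : 0 ≤ c)
    (s : Icc (0 : ℝ) t) (p : P)
    (hf : ∀ τ : Icc (0 : ℝ) t, s ≤ τ →
      ‖iteratedFDeriv ℝ k (fun q => g q τ) p‖ ≤ c * (1 + (τ : ℝ)) ^ (-r)) :
    ‖iteratedFDeriv ℝ k (fun q => backInt t ht (g q) s) p‖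
      ≤ c / (r - 1) * (1 + (s : ℝ)) ^ (-(r - 1)) := by
  have hs : (0 : ℝ) < 1 + s := by linarith [s.2.1]
  have hr' : 0 < r - 1 := by linarith
  refine ContinuousMultilinearMap.opNorm_le_bound (by positivity) fun m => ?_
  have hb : ContDiff ℝ N fun q => backInt t ht (g q) := (backInt (G := G) t ht).contDiff.comp hg
  rw [iteratedFDeriv_eval hb hk]
  have h1 := (backInt t ht).iteratedFDeriv_comp_left (hg.contDiffAt (x := p)) (i := k)
    (by exact_mod_cast hk)
  have h2 : iteratedFDeriv ℝ k (fun q => backInt t ht (g q)) p m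
      = backInt t ht (iteratedFDeriv ℝ k g p m) := congrArg (fun M => M m) h1
  rw [h2]
  -- Tested on a fixed `m`, the derivative is an ordinary continuous path, so the undifferentiated
  -- estimate applies with the product of the norms absorbed in the constant.
  refine (norm_backInt_le ht hr (c := c * ∏ i, ‖m i‖) (by positivity) s fun τ hτ => ?_).trans_eq
    (by ring)
  rw [← iteratedFDeriv_eval hg hk]
  refine ((ContinuousMultilinearMap.le_opNorm _ m).trans
    (mul_le_mul_of_nonneg_right (hf τ hτ) (by positivity))).trans_eq (by ring)

end Integration

end VlasovForcing

namespace VlasovForcing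

/-- A regular field whose derivatives of order `k ≤ N` decay like `(1+τ)^{-11/4-k}`, with size `e`. -/
structure FieldBound {d : ℕ} (N : ℕ) (e : ℝ) (E : ℝ → Sp d → Sp d) : Prop where
  regular : FieldRegular N E
  bound : ∀ τ, 0 ≤ τ → ∀ k, k ≤ N → ∀ x,
    (1 + τ) ^ k * ‖iteratedFDeriv ℝ k (E τ) x‖ ≤ e * (1 + τ) ^ (-(11 / 4) : ℝ)

/-! ### Characteristics as a fixed point in path space -/

section Flow

variable {d N : ℕ} {E : ℝ → Sp d → Sp d} {e t : ℝ}

lemma FieldRegular.continuousOn (hE : FieldRegular N E) :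
    ContinuousOn (fun p : ℝ × Sp d => E p.1 p.2) (Ici 0 ×ˢ univ) := by
  have h := hE.2 0 (Nat.zero_le _)
  have h2 := (continuousMultilinearCurryFin0 ℝ (Sp d) (Sp d)).continuous.comp_continuousOn h
  refine h2.congr fun p _ => ?_
  simp

/-- The restriction of the field to the times `[0,t]`. -/
def fieldOn (t : ℝ) (hE : FieldRegular N E) : C(Icc (0 : ℝ) t × Sp d, Sp d) :=
  ⟨fun p => E p.1 p.2, by
    refine hE.continuousOn.comp_continuous (f := fun p : Icc (0 : ℝ) t × Sp d => ((p.1 : ℝ), p.2))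
      (by fun_prop) fun p => ⟨p.1.2.1, mem_univ _⟩⟩

@[simp] lemma fieldOn_apply (hE : FieldRegular N E) (p : Icc (0 : ℝ) t × Sp d) :
    fieldOn t hE p = E p.1 p.2 := rfl

lemma contDiff_nem_fieldOn (hE : FieldRegular N E) : ContDiff ℝ N (nem (fieldOn t hE)) := by
  refine contDiff_nem N _ (fun τ => hE.1 τ τ.2.1) fun k hk => ?_
  exact (hE.2 k hk).comp_continuous (f := fun p : Icc (0 : ℝ) t × Sp d => ((p.1 : ℝ), p.2))
      (by fun_prop) fun p => ⟨p.1.2.1, mem_univ _⟩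

lemma FieldBound.bound' (h : FieldBound N e E) {τ : ℝ} (hτ : 0 ≤ τ) {k : ℕ} (hk : k ≤ N)
    (x : Sp d) : ‖iteratedFDeriv ℝ k (E τ) x‖ ≤ e * (1 + τ) ^ (-(11 / 4) : ℝ) := by
  refine le_trans ?_ (h.bound τ hτ k hk x)
  exact le_mul_of_one_le_left (norm_nonneg _) (one_le_pow₀ (by linarith))

lemma FieldBound.nonneg (h : FieldBound N e E) : 0 ≤ e := by
  have := (norm_nonneg _).trans (h.bound' le_rfl (Nat.zero_le N) 0)
  simpa using this

lemma FieldBound.norm_le (h : FieldBound N e E) {τ : ℝ} (hτ : 0 ≤ τ) (x : Sp d) :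
    ‖E τ x‖ ≤ e * (1 + τ) ^ (-(11 / 4) : ℝ) := by
  simpa using h.bound' hτ (Nat.zero_le N) x

lemma FieldBound.norm_fderiv_le (h : FieldBound N e E) (hN : 1 ≤ N) {τ : ℝ} (hτ : 0 ≤ τ)
    (x : Sp d) : ‖fderiv ℝ (E τ) x‖ ≤ e * (1 + τ) ^ (-(11 / 4) : ℝ) := by
  simpa using h.bound' hτ hN x

lemma FieldBound.dist_le (h : FieldBound N e E) (hN : 1 ≤ N) {τ : ℝ} (hτ : 0 ≤ τ) (x y : Sp d) :
    ‖E τ x - E τ y‖ ≤ e * (1 + τ) ^ (-(11 / 4) : ℝ) * ‖x - y‖ :=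
  (convex_univ (𝕜 := ℝ)).norm_image_sub_le_of_norm_fderiv_le
    (fun z _ => ((h.regular.1 τ hτ).differentiable (by
      simpa using (Nat.one_le_iff_ne_zero.1 hN))) z)
    (fun z _ => h.norm_fderiv_le hN hτ z) (mem_univ _) (mem_univ _)

/-- The twice integrated force along a path. -/
def kick (ht : 0 ≤ t) (hE : FieldRegular N E) (γ : C(Icc (0 : ℝ) t, Sp d)) :
    C(Icc (0 : ℝ) t, Sp d) :=
  backInt t ht (backInt t ht (nem (fieldOn t hE) γ))

lemma contDiff_kick (ht : 0 ≤ t) (hE : FieldRegular N E) : ContDiff ℝ N (kick ht hE) :=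
  (backInt (G := Sp d) t ht).contDiff.comp
    ((backInt (G := Sp d) t ht).contDiff.comp (contDiff_nem_fieldOn hE))

/-- Each integration raises the exponent by one, from `-11/4` to `-7/4` to `-3/4`. The resulting
factor `(4/7)(4/3) = 16/21` is below one and is dropped. -/
lemma norm_backInt_backInt_le {G : Type} [NormedAddCommGroup G] [NormedSpace ℝ G] (ht : 0 ≤ t)
    {f : C(Icc (0 : ℝ) t, G)} {c : ℝ} (hc : 0 ≤ c) (s : Icc (0 : ℝ) t)
    (hf : ∀ τ : Icc (0 : ℝ) t, s ≤ τ → ‖f τ‖ ≤ c * (1 + (τ : ℝ)) ^ (-(11 / 4) : ℝ)) :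
    ‖backInt t ht (backInt t ht f) s‖ ≤ c * (1 + (s : ℝ)) ^ (-(3 / 4) : ℝ) := by
  have hs : (0 : ℝ) < 1 + s := by linarith [s.2.1]
  have h1 : ∀ τ : Icc (0 : ℝ) t, s ≤ τ → ‖backInt t ht f τ‖
      ≤ c / (7 / 4) * (1 + (τ : ℝ)) ^ (-(7 / 4) : ℝ) := fun τ hτ => by
    have := norm_backInt_le ht (by norm_num) hc τ (r := 11 / 4) fun σ hσ => hf σ (hτ.trans hσ)
    norm_num at this ⊢
    exact this
  have h2 := norm_backInt_le ht (by norm_num) (by positivity) s (r := 7 / 4) h1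
  refine h2.trans ?_
  norm_num
  gcongr
  linarith

/-- The Lipschitz constant is independent of `t` because the weight `(1+τ)^(-11/4)` is twice
integrable up to infinity. This is what makes the contraction uniform in time. -/
lemma norm_kick_sub_le (ht : 0 ≤ t) (h : FieldBound N e E) (hN : 1 ≤ N)
    (γ γ' : C(Icc (0 : ℝ) t, Sp d)) :
    ‖kick ht h.regular γ - kick ht h.regular γ'‖ ≤ e * ‖γ - γ'‖ := by
  have he := h.nonneg
  rw [ContinuousMap.norm_le _ (by positivity)]
  intro s
  simp only [kick, ← map_sub]
  refine (norm_backInt_backInt_le ht (c := e * ‖γ - γ'‖) (by positivity) s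
    fun τ _ => ?_).trans ?_
  · refine (h.dist_le hN τ.2.1 _ _).trans ?_
    have hτ : (0 : ℝ) ≤ 1 + τ := by linarith [τ.2.1]
    have : ‖γ τ - γ' τ‖ ≤ ‖γ - γ'‖ := (γ - γ').norm_coe_le_norm τ
    calc _ ≤ e * (1 + (τ : ℝ)) ^ (-(11 / 4) : ℝ) * ‖γ - γ'‖ := by gcongr; exact this
      _ = _ := by ring
  · refine mul_le_of_le_one_right (by positivity) ?_
    exact Real.rpow_le_one_of_one_le_of_nonpos (by linarith [s.2.1]) (by norm_num)

/-- Free transport: `(x,v) ↦ (s ↦ x - (t-s) v)`. -/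
def freePath (d : ℕ) (t : ℝ) : Sp d × Sp d →L[ℝ] C(Icc (0 : ℝ) t, Sp d) :=
  LinearMap.mkContinuous
    { toFun := fun p => ⟨fun s => p.1 - (t - s) • p.2, by fun_prop⟩
      map_add' := fun p q => by
        ext1 s
        simp only [Prod.fst_add, Prod.snd_add, smul_add, ContinuousMap.coe_mk,
          ContinuousMap.add_apply]
        abel
      map_smul' := fun c p => by
        ext1 s
        simp [smul_sub, smul_comm c] } (1 + |t|)
    (fun p => by
      rw [ContinuousMap.norm_le _ (by positivity)]
      intro s
      have h0 : |t - s| ≤ |t| := by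
        rw [abs_of_nonneg (by linarith [s.2.2])]
        linarith [s.2.1, le_abs_self t]
      calc _ ≤ ‖p.1‖ + |t - s| * ‖p.2‖ := by
            simpa [norm_smul] using norm_sub_le p.1 ((t - s) • p.2)
        _ ≤ ‖p‖ + |t| * ‖p‖ := by
            gcongr
            exacts [norm_fst_le p, norm_snd_le p]
        _ = _ := by ring)

@[simp] lemma freePath_apply (p : Sp d × Sp d) (s : Icc (0 : ℝ) t) :
    freePath d t p s = p.1 - (t - s) • p.2 := rfl

/-- Smooth solution operator of the integrated characteristic system, with uniqueness. -/
theorem exists_contDiff_path (ht : 0 ≤ t) (h : FieldBound N e E) (hN : 1 ≤ N) (he : e ≤ 1 / 2) :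
    ∃ γ : Sp d × Sp d → C(Icc (0 : ℝ) t, Sp d), ContDiff ℝ N γ ∧
      (∀ p, γ p = freePath d t p + kick ht h.regular (γ p)) ∧
      ∀ p γ', γ' = freePath d t p + kick ht h.regular γ' → γ' = γ p := by
  have he0 := h.nonneg
  -- The fixed points over `p` are the solutions of `Θ γ = freePath d t p`. As a Lipschitz
  -- perturbation of the identity with constant `1/2`, `Θ` is a homeomorphism, which gives existence
  -- and uniqueness together.
  let Θ : C(Icc (0 : ℝ) t, Sp d) → C(Icc (0 : ℝ) t, Sp d) := fun γ => γ - kick ht h.regular γ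
  have hΘ : ContDiff ℝ N Θ := contDiff_id.sub (contDiff_kick ht h.regular)
  have happ : ApproximatesLinearOn Θ
      ((ContinuousLinearEquiv.refl ℝ C(Icc (0 : ℝ) t, Sp d) :
        C(Icc (0 : ℝ) t, Sp d) ≃L[ℝ] C(Icc (0 : ℝ) t, Sp d)) :
        C(Icc (0 : ℝ) t, Sp d) →L[ℝ] C(Icc (0 : ℝ) t, Sp d)) univ (1 / 2) := by
    intro γ _ γ' _
    have := norm_kick_sub_le ht h hN γ' γ
    calc ‖Θ γ - Θ γ' - (γ - γ')‖ = ‖kick ht h.regular γ' - kick ht h.regular γ‖ := by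
          congr 1; simp only [Θ]; abel
      _ ≤ e * ‖γ' - γ‖ := this
      _ ≤ 1 / 2 * ‖γ - γ'‖ := by rw [norm_sub_rev]; gcongr
  have hc : Subsingleton C(Icc (0 : ℝ) t, Sp d) ∨ (1 / 2 : NNReal) <
      ‖((ContinuousLinearEquiv.refl ℝ C(Icc (0 : ℝ) t, Sp d)).symm :
        C(Icc (0 : ℝ) t, Sp d) →L[ℝ] C(Icc (0 : ℝ) t, Sp d))‖₊⁻¹ := by
    rcases subsingleton_or_nontrivial C(Icc (0 : ℝ) t, Sp d) with hs | hs
    · exact Or.inl hs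
    · right
      have : ‖((ContinuousLinearEquiv.refl ℝ C(Icc (0 : ℝ) t, Sp d)).symm :
        C(Icc (0 : ℝ) t, Sp d) →L[ℝ] C(Icc (0 : ℝ) t, Sp d))‖₊ = 1 := by
        ext
        exact ContinuousLinearMap.norm_id
      rw [this, inv_one]
      exact NNReal.half_lt_self one_ne_zero
  let H := happ.toHomeomorph Θ hc
  have hH : ∀ γ, H γ = Θ γ := fun γ => rfl
  have hN0 : (N : WithTop ℕ∞) ≠ 0 := by simpa using (Nat.one_le_iff_ne_zero.1 hN)
  have hder : ∀ γ, ∃ L : C(Icc (0 : ℝ) t, Sp d) ≃L[ℝ] C(Icc (0 : ℝ) t, Sp d),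
      HasFDerivAt H (L : C(Icc (0 : ℝ) t, Sp d) →L[ℝ] C(Icc (0 : ℝ) t, Sp d)) γ := by
    intro γ
    have hk := ((contDiff_kick ht h.regular).differentiable hN0 γ).hasFDerivAt
    have hle : ‖fderiv ℝ (kick ht h.regular) γ‖ ≤ 1 / 2 :=
      hk.le_of_lip' (by norm_num) (Filter.Eventually.of_forall fun γ' =>
        (norm_kick_sub_le ht h hN γ' γ).trans (by gcongr))
    -- Neumann series: the Lipschitz bound forces the derivative of `kick` to have norm at most
    -- `1/2`, so the derivative of `Θ` is invertible everywhere and the inverse of `Θ` is as smooth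
    -- as `Θ`.
    let u := Units.oneSub (fderiv ℝ (kick ht h.regular) γ) (hle.trans_lt (by norm_num))
    refine ⟨ContinuousLinearEquiv.unitsEquiv ℝ _ u, ?_⟩
    exact (hasFDerivAt_id γ).sub hk
  choose L hL using hder
  have hsymm : ContDiff ℝ N H.symm := H.contDiff_symm hL hΘ
  have hsol : ∀ p γ', γ' = freePath d t p + kick ht h.regular γ' ↔ H γ' = freePath d t p := by
    intro p γ'
    rw [hH, sub_eq_iff_eq_add]
  refine ⟨fun p => H.symm (freePath d t p), hsymm.comp (freePath d t).contDiff, fun p => ?_,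
    fun p γ' hγ' => ?_⟩
  · rw [hsol, H.apply_symm_apply]
  · rw [hsol] at hγ'
    change γ' = H.symm (freePath d t p)
    rw [← hγ', H.symm_apply_apply]

lemma sub_eq_integral_of_hasDerivWithinAt {f f' : ℝ → Sp d} (hf : ∀ s, 0 ≤ s →
    HasDerivWithinAt f (f' s) (Ici 0) s) (hf' : ContinuousOn f' (Ici 0)) {s : ℝ} (hs : 0 ≤ s)
    (hst : s ≤ t) : ∫ τ in s..t, f' τ = f t - f s := by
  refine intervalIntegral.integral_eq_sub_of_hasDeriv_right ?_ (fun x hx => ?_) ?_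
  · rw [uIcc_of_le hst]
    exact fun x hx => ((hf x (hs.trans hx.1)).continuousWithinAt).mono
      fun y hy => hs.trans hy.1
  · rw [min_eq_left hst, max_eq_right hst] at hx
    exact (hf x (hs.trans hx.1.le)).mono fun y hy => (hs.trans hx.1.le).trans (mem_Ioi.1 hy).le
  · apply ContinuousOn.intervalIntegrable
    rw [uIcc_of_le hst]
    exact hf'.mono fun y hy => hs.trans hy.1

/-- The characteristics are a `C^N` function of the data, with values in continuous paths. -/
theorem exists_contDiff_flow (ht : 0 ≤ t) (h : FieldBound N e E) (hN : 1 ≤ N) (he : e ≤ 1 / 2)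
    {X V : ℝ → ℝ → Sp d → Sp d → Sp d} (hXV : IsCharacteristics E X V) :
    ∃ γ : Sp d × Sp d → C(Icc (0 : ℝ) t, Sp d), ContDiff ℝ N γ ∧
      (∀ p, γ p = freePath d t p + kick ht h.regular (γ p)) ∧
      (∀ (s : Icc (0 : ℝ) t) x v, X s t x v = γ (x, v) s) ∧
      ∀ (s : Icc (0 : ℝ) t) x v,
        V s t x v = v - backInt t ht (nem (fieldOn t h.regular) (γ (x, v))) s := by
  obtain ⟨γ, hγ, hsol, huniq⟩ := exists_contDiff_path ht h hN he
  -- Integrating the differential system backward from `t`, once for the velocity and twice for the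
  -- position, shows that the given characteristic solves the fixed-point equation; uniqueness then
  -- identifies it with `γ (x, v)`.
  have key : ∀ x v, ∃ ξ : C(Icc (0 : ℝ) t, Sp d), (∀ s : Icc (0 : ℝ) t, X s t x v = ξ s) ∧
      (∀ s : Icc (0 : ℝ) t, V s t x v = v - backInt t ht (nem (fieldOn t h.regular) ξ) s) ∧
      ξ = freePath d t (x, v) + kick ht h.regular ξ := by
    intro x v
    obtain ⟨hx, hv, hd⟩ := hXV t ht x v
    have hXc : ContinuousOn (fun s => X s t x v) (Ici 0) :=
      fun s hs => (hd s hs).1.continuousWithinAt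
    have hVc : ContinuousOn (fun s => V s t x v) (Ici 0) :=
      fun s hs => (hd s hs).2.continuousWithinAt
    have hEc : ContinuousOn (fun s => E s (X s t x v)) (Ici 0) :=
      h.regular.continuousOn.comp (continuousOn_id.prodMk hXc) fun s hs => ⟨hs, mem_univ _⟩
    let ξ : C(Icc (0 : ℝ) t, Sp d) := ⟨fun s => X s t x v,
      hXc.comp_continuous continuous_subtype_val fun s => s.2.1⟩
    have hproj : ∀ s : Icc (0 : ℝ) t, ∀ τ ∈ uIcc (s : ℝ) t, (projIcc 0 t ht τ : ℝ) = τ := by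
      intro s τ hτ
      rw [uIcc_of_le s.2.2] at hτ
      rw [projIcc_of_mem ht ⟨s.2.1.trans hτ.1, hτ.2⟩]
    have hV : ∀ s : Icc (0 : ℝ) t,
        V s t x v = v - backInt t ht (nem (fieldOn t h.regular) ξ) s := by
      intro s
      have h1 := sub_eq_integral_of_hasDerivWithinAt (fun s hs => (hd s hs).2) hEc s.2.1 s.2.2
      rw [hv] at h1
      rw [backInt_apply, eq_sub_iff_add_eq, ← eq_sub_iff_add_eq', ← h1]
      refine intervalIntegral.integral_congr fun τ hτ => ?_
      simp only [nem_apply, fieldOn_apply, hproj s τ hτ, ξ, ContinuousMap.coe_mk]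
    refine ⟨ξ, fun s => rfl, hV, ?_⟩
    ext1 s
    have h1 := sub_eq_integral_of_hasDerivWithinAt (fun s hs => (hd s hs).1) hVc s.2.1 s.2.2
    rw [hx] at h1
    have h2 : ∫ τ in (s : ℝ)..t, V τ t x v
        = ∫ τ in (s : ℝ)..t, (v - backInt t ht (nem (fieldOn t h.regular) ξ)
          (projIcc 0 t ht τ)) := by
      refine intervalIntegral.integral_congr fun τ hτ => ?_
      rw [← hV, hproj s τ hτ]
    rw [intervalIntegral.integral_sub (by simp)
      (Continuous.intervalIntegrable (by fun_prop) _ _), h1, intervalIntegral.integral_const] at h2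
    simp only [kick, ContinuousMap.add_apply, freePath_apply]
    rw [backInt_apply t ht (backInt t ht _) s]
    change X s t x v = _
    rw [← sub_eq_zero] at h2 ⊢
    rw [← neg_eq_zero, ← h2]
    abel
  have hξ : ∀ x v, ∀ ξ : C(Icc (0 : ℝ) t, Sp d),
      ξ = freePath d t (x, v) + kick ht h.regular ξ → ξ = γ (x, v) :=
    fun x v ξ hξ => huniq _ _ hξ
  refine ⟨γ, hγ, hsol, fun s x v => ?_, fun s x v => ?_⟩
  · obtain ⟨ξ, h1, -, h3⟩ := key x v
    rw [h1, hξ x v ξ h3]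
  · obtain ⟨ξ, -, h2, h3⟩ := key x v
    rw [h2, hξ x v ξ h3]

end Flow

end VlasovForcing

namespace VlasovForcing

/-! ### Derivatives under affine substitutions -/

section Calculus

variable {P Q G : Type*} [NormedAddCommGroup P] [NormedSpace ℝ P]
  [NormedAddCommGroup Q] [NormedSpace ℝ Q] [NormedAddCommGroup G] [NormedSpace ℝ G]

lemma norm_iteratedFDeriv_affine_le (a : G) (A : P →L[ℝ] G) {i : ℕ} (hi : 1 ≤ i) (p : P) :
    ‖iteratedFDeriv ℝ i (fun q => a + A q) p‖ ≤ ‖A‖ := by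
  obtain ⟨j, rfl⟩ : ∃ j, i = j + 1 := ⟨i - 1, by omega⟩
  have h1 : fderiv ℝ (fun q => a + A q) = fun _ => A := by
    ext1 q
    exact (A.hasFDerivAt.const_add a).fderiv
  rw [← norm_iteratedFDeriv_fderiv, h1]
  rcases Nat.eq_zero_or_pos j with rfl | hj
  · simp
  · rw [iteratedFDeriv_const_of_ne hj.ne']
    simp

lemma norm_iteratedFDeriv_comp_affine_le {n : ℕ} {f : P → G} (hf : ContDiff ℝ n f) (a : P)
    (A : Q →L[ℝ] P) {i : ℕ} (hi : i ≤ n) (q : Q) :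
    ‖iteratedFDeriv ℝ i (fun q => f (a + A q)) q‖ ≤ ‖iteratedFDeriv ℝ i f (a + A q)‖ * ‖A‖ ^ i := by
  have h1 : ContDiff ℝ n fun x => f (a + x) := hf.comp (contDiff_const.add contDiff_id)
  have h2 := A.iteratedFDeriv_comp_right h1 q (i := i) (by exact_mod_cast hi)
  have h3 : (fun q => f (a + A q)) = (fun x => f (a + x)) ∘ A := rfl
  rw [h3, h2, iteratedFDeriv_comp_add_left]
  exact (ContinuousMultilinearMap.norm_compContinuousLinearMap_le _ _).trans (by simp)

lemma norm_iteratedFDeriv_comp_smul_le {n : ℕ} {f : P → G} (hf : ContDiff ℝ n f) {c : ℝ}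
    (hc : 0 ≤ c) {i : ℕ} (hi : i ≤ n) (q : P) :
    ‖iteratedFDeriv ℝ i (fun q => f (c • q)) q‖ ≤ c ^ i * ‖iteratedFDeriv ℝ i f (c • q)‖ := by
  have := norm_iteratedFDeriv_comp_affine_le hf 0 (c • ContinuousLinearMap.id ℝ P) hi q
  simp only [zero_add, FunLike.coe_smul, ContinuousLinearMap.coe_id',
    Pi.smul_apply, id_eq] at this
  refine this.trans ?_
  rw [mul_comm]
  gcongr
  calc _ ≤ ‖c‖ * ‖ContinuousLinearMap.id ℝ P‖ := norm_smul_le _ _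
    _ ≤ c * 1 := by
      rw [Real.norm_of_nonneg hc]
      gcongr
      exact ContinuousLinearMap.norm_id_le
    _ = c := mul_one c

end Calculus

/-! ### Derivative bounds for the flow along affine families of final data -/

section FrameBounds

variable {d N : ℕ} {E : ℝ → Sp d → Sp d} {e t : ℝ}
  {P : Type} [NormedAddCommGroup P] [NormedSpace ℝ P]

lemma norm_iteratedFDeriv_backInt_backInt_le {G : Type} [NormedAddCommGroup G] [NormedSpace ℝ G]
    (ht : 0 ≤ t) {g : P → C(Icc (0 : ℝ) t, G)}
    (hg : ContDiff ℝ N g) {k : ℕ} (hk : k ≤ N) {c : ℝ} (hc : 0 ≤ c) (s : Icc (0 : ℝ) t) (p : P)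
    (hf : ∀ τ : Icc (0 : ℝ) t, s ≤ τ →
      ‖iteratedFDeriv ℝ k (fun q => g q τ) p‖ ≤ c * (1 + (τ : ℝ)) ^ (-(11 / 4) : ℝ)) :
    ‖iteratedFDeriv ℝ k (fun q => backInt t ht (g q) s) p‖ ≤ c * (1 + (s : ℝ)) ^ (-(7 / 4) : ℝ) ∧
    ‖iteratedFDeriv ℝ k (fun q => backInt t ht (backInt t ht (g q)) s) p‖
      ≤ c * (1 + (s : ℝ)) ^ (-(3 / 4) : ℝ) := by
  have hs : (0 : ℝ) < 1 + s := by linarith [s.2.1]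
  have h1 : ∀ τ : Icc (0 : ℝ) t, s ≤ τ → ‖iteratedFDeriv ℝ k (fun q => backInt t ht (g q) τ) p‖
      ≤ c / (7 / 4) * (1 + (τ : ℝ)) ^ (-(7 / 4) : ℝ) := fun τ hτ => by
    have := norm_iteratedFDeriv_backInt_le ht hg hk (by norm_num) hc τ p (r := 11 / 4)
      fun σ hσ => hf σ (hτ.trans hσ)
    norm_num at this ⊢
    exact this
  have hb : ContDiff ℝ N fun q => backInt t ht (g q) := (backInt (G := G) t ht).contDiff.comp hg
  refine ⟨(h1 s le_rfl).trans ?_, ?_⟩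
  · gcongr
    linarith
  · have h2 := norm_iteratedFDeriv_backInt_le ht hb hk (by norm_num) (by positivity) s p
      (r := 7 / 4) h1
    refine h2.trans ?_
    norm_num
    gcongr
    linarith

/-- The constant in the bounds for the derivatives of the flow. -/
def flowConst (N : ℕ) : ℝ := 2 * (N.factorial * 2 ^ N)

lemma two_le_flowConst (N : ℕ) : 2 ≤ flowConst N := by
  have h1 : (1 : ℝ) ≤ N.factorial := by exact_mod_cast N.factorial_pos
  have h2 : (1 : ℝ) ≤ 2 ^ N := one_le_pow₀ (by norm_num)
  have := one_le_mul_of_one_le_of_one_le h1 h2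
  unfold flowConst
  linarith

lemma rpow_weight_le_one {s r : ℝ} (hs : 0 ≤ s) (hr : 0 ≤ r) : (1 + s) ^ (-r) ≤ 1 :=
  Real.rpow_le_one_of_one_le_of_nonpos (by linarith) (by linarith)

/-- One step of the bootstrap: derivatives of the force along a path with bounded derivatives. -/
lemma norm_iteratedFDeriv_field_comp_le (h : FieldBound N e E) {τ : ℝ} (hτ : 0 ≤ τ) {f : P → Sp d}
    (hf : ContDiff ℝ N f) {k : ℕ} (hk : k ≤ N) (p : P) {D : ℝ}
    (hD : ∀ i, 1 ≤ i → i ≤ k → ‖iteratedFDeriv ℝ i f p‖ ≤ (1 + τ) * D ^ i) :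
    ‖iteratedFDeriv ℝ k (fun q => E τ (f q)) p‖
      ≤ k.factorial * (e * (1 + τ) ^ (-(11 / 4) : ℝ)) * D ^ k := by
  have hτ' : (0 : ℝ) < 1 + τ := by linarith
  have hEτ := h.regular.1 τ hτ
  -- Rescaling positions by `1+τ` balances the two factors: the outer map then has all derivatives
  -- bounded by the weight, and the inner one has derivatives bounded by `D^i`, as the Faà di Bruno
  -- estimate requires.
  have heq : (fun q => E τ (f q)) = (fun y => E τ ((1 + τ) • y)) ∘ fun q => (1 + τ)⁻¹ • f q := by
    ext1 q
    simp [smul_smul, hτ'.ne']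
  rw [heq]
  refine norm_iteratedFDeriv_comp_le (hEτ.comp (contDiff_const_smul _)) (hf.const_smul _)
    (by exact_mod_cast hk) p (fun i hi => ?_) fun i h1 hi => ?_
  · exact (norm_iteratedFDeriv_comp_smul_le hEτ hτ'.le (hi.trans hk) _).trans
      (h.bound τ hτ i (hi.trans hk) _)
  · have : iteratedFDeriv ℝ i (fun q => (1 + τ)⁻¹ • f q) p = (1 + τ)⁻¹ • iteratedFDeriv ℝ i f p :=
      iteratedFDeriv_const_smul_apply'
        ((hf.of_le (by exact_mod_cast hi.trans hk)).contDiffAt)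
    rw [this, norm_smul, Real.norm_of_nonneg (by positivity), inv_mul_le_iff₀ hτ']
    exact hD i h1 hi

/-- Bounds for the derivatives of the force along the flow in a frame `p ↦ c + L p` of initial
data whose free evolution is at most `1 + s`. -/
theorem norm_iteratedFDeriv_force_le (ht : 0 ≤ t) (h : FieldBound N e E)
    (hsmall : e * flowConst N ≤ 1) {γ : Sp d × Sp d → C(Icc (0 : ℝ) t, Sp d)}
    (hγ : ContDiff ℝ N γ) (hsol : ∀ p, γ p = freePath d t p + kick ht h.regular (γ p))
    (c : Sp d × Sp d) (L : P →L[ℝ] Sp d × Sp d)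
    (hL : ∀ (s : Icc (0 : ℝ) t) q, ‖freePath d t (L q) s‖ ≤ (1 + s) * ‖q‖)
    {k : ℕ} (hk : k ≤ N) (τ : Icc (0 : ℝ) t) (p : P) :
    ‖iteratedFDeriv ℝ k (fun q => E τ (γ (c + L q) τ)) p‖
      ≤ e * flowConst N * (1 + (τ : ℝ)) ^ (-(11 / 4) : ℝ) := by
  have he := h.nonneg
  have : Nonempty (Icc (0 : ℝ) t) := ⟨⟨0, le_rfl, ht⟩⟩
  set ξ : P → C(Icc (0 : ℝ) t, Sp d) := fun q => γ (c + L q) with hξdef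
  have hξ : ContDiff ℝ N ξ := hγ.comp (contDiff_const.add L.contDiff)
  have hnem : ContDiff ℝ N fun q => nem (fieldOn t h.regular) (ξ q) :=
    (contDiff_nem_fieldOn h.regular).comp hξ
  have hkick : ContDiff ℝ N fun q => kick ht h.regular (ξ q) :=
    (contDiff_kick ht h.regular).comp hξ
  have hnn : ∀ τ : Icc (0 : ℝ) t, (0 : ℝ) ≤ (1 + (τ : ℝ)) ^ (-(11 / 4) : ℝ) := fun τ =>
    Real.rpow_nonneg (by linarith [τ.2.1]) _
  -- derivatives of the path in terms of those of the deviation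
  have hpath : ∀ i, 1 ≤ i → i ≤ N → ∀ τ : Icc (0 : ℝ) t, ‖iteratedFDeriv ℝ i (fun q => ξ q τ) p‖
      ≤ (1 + τ) + ‖iteratedFDeriv ℝ i (fun q => kick ht h.regular (ξ q) τ) p‖ := by
    intro i h1 hi τ
    have hτ : (0 : ℝ) ≤ 1 + τ := by linarith [τ.2.1]
    let A : P →L[ℝ] Sp d := (evalL τ).comp ((freePath d t).comp L)
    have heq : (fun q => ξ q τ) = (fun q => freePath d t c τ + A q)
        + fun q => kick ht h.regular (ξ q) τ := by
      ext1 q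
      have := congrArg (fun f => f τ) (hsol (c + L q))
      simp only [ContinuousMap.add_apply, map_add] at this
      simpa [A, ξ] using this
    rw [heq, iteratedFDeriv_add_apply
      ((contDiff_const.add A.contDiff).contDiffAt)
      (((contDiff_eval hkick τ).of_le (by exact_mod_cast hi)).contDiffAt)]
    refine (norm_add_le _ _).trans ?_
    gcongr
    refine (norm_iteratedFDeriv_affine_le _ A h1 p).trans ?_
    exact A.opNorm_le_bound hτ fun q => hL τ q
  have hstep : ∀ k, k ≤ N → ∀ M, 0 ≤ M →
      (∀ i, 1 ≤ i → i < k → ∀ τ : Icc (0 : ℝ) t,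
        ‖iteratedFDeriv ℝ i (fun q => kick ht h.regular (ξ q) τ) p‖ ≤ 1) →
      (1 ≤ k → ∀ τ : Icc (0 : ℝ) t,
        ‖iteratedFDeriv ℝ k (fun q => kick ht h.regular (ξ q) τ) p‖ ≤ M) →
      ∀ τ : Icc (0 : ℝ) t, ‖iteratedFDeriv ℝ k (fun q => E τ (ξ q τ)) p‖
        ≤ (e * (flowConst N / 2) * (1 + M)) * (1 + (τ : ℝ)) ^ (-(11 / 4) : ℝ) := by
    intro k hk M hM hlow htop τ
    have hτ : (0 : ℝ) ≤ τ := τ.2.1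
    have hM1 : 1 ≤ 1 + M := by linarith
    -- The root is taken so that `D^i` dominates `2` at the lower orders and `1+M` at the top order,
    -- while `D^k ≤ 2^k (1+M)` remains linear in the still unknown top-order bound `M`.
    set D : ℝ := 2 * (1 + M) ^ ((1 : ℝ) / k) with hDdef
    have hroot : 1 ≤ (1 + M) ^ ((1 : ℝ) / k) := Real.one_le_rpow hM1 (by positivity)
    have hD2 : 2 ≤ D := by linarith
    have hDk : D ^ k ≤ 2 ^ k * (1 + M) := by
      rcases Nat.eq_zero_or_pos k with rfl | hk0
      · simpa using hM
      · rw [hDdef, mul_pow, one_div, Real.rpow_inv_natCast_pow (by linarith) hk0.ne']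
    have hmain := norm_iteratedFDeriv_field_comp_le h hτ (contDiff_eval hξ τ) hk p (D := D)
      fun i h1 hi => by
        have hb := hpath i h1 (hi.trans hk) τ
        have h2i : 2 ≤ D ^ i := hD2.trans (le_self_pow₀ (by linarith) (by omega))
        rcases hi.lt_or_eq with hlt | rfl
        · have := hlow i h1 hlt τ
          nlinarith
        · have h3 := htop h1 τ
          have h4 : 1 + M ≤ D ^ i := by
            rw [hDdef, mul_pow, one_div, Real.rpow_inv_natCast_pow (by linarith) (by omega)]
            have : (1 : ℝ) ≤ 2 ^ i := one_le_pow₀ (by norm_num)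
            nlinarith
          nlinarith
    refine hmain.trans ?_
    have hfac : (k.factorial : ℝ) * 2 ^ k ≤ flowConst N / 2 := by
      have h1 : (k.factorial : ℝ) ≤ N.factorial := by exact_mod_cast Nat.factorial_le hk
      have h2 : (2 : ℝ) ^ k ≤ 2 ^ N := pow_le_pow_right₀ (by norm_num) hk
      unfold flowConst
      calc _ ≤ (N.factorial : ℝ) * 2 ^ N := by gcongr
        _ = _ := by ring
    have := hnn τ
    calc (k.factorial : ℝ) * (e * (1 + (τ : ℝ)) ^ (-(11 / 4) : ℝ)) * D ^ k
        ≤ k.factorial * (e * (1 + (τ : ℝ)) ^ (-(11 / 4) : ℝ)) * (2 ^ k * (1 + M)) := by gcongr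
      _ = (k.factorial * 2 ^ k) * (e * (1 + M) * (1 + (τ : ℝ)) ^ (-(11 / 4) : ℝ)) := by ring
      _ ≤ (flowConst N / 2) * (e * (1 + M) * (1 + (τ : ℝ)) ^ (-(11 / 4) : ℝ)) := by gcongr
      _ = _ := by ring
  have hdev : ∀ k, k ≤ N → ∀ i, 1 ≤ i → i ≤ k → ∀ τ : Icc (0 : ℝ) t,
      ‖iteratedFDeriv ℝ i (fun q => kick ht h.regular (ξ q) τ) p‖ ≤ 1 := by
    intro k
    induction k with
    | zero => intro _ i h1 h2; omega
    | succ k ih =>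
      intro hk i h1 hi
      rcases hi.lt_or_eq with hlt | rfl
      · exact ih (by omega) i h1 (by omega)
      let φ : Icc (0 : ℝ) t → ℝ := fun τ =>
        ‖iteratedFDeriv ℝ (k + 1) (fun q => kick ht h.regular (ξ q) τ) p‖
      have hbdd : BddAbove (range φ) := by
        refine ⟨‖iteratedFDeriv ℝ (k + 1) (fun q => kick ht h.regular (ξ q)) p‖, ?_⟩
        rintro _ ⟨τ, rfl⟩
        refine ContinuousMultilinearMap.opNorm_le_bound (norm_nonneg _) fun m => ?_
        rw [iteratedFDeriv_eval hkick hk]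
        exact (ContinuousMap.norm_coe_le_norm _ τ).trans
          (ContinuousMultilinearMap.le_opNorm _ m)
      -- `M` is finite because the derivative exists in path space. The bootstrap then yields `M ≤ a
      -- (1+M)` with `a = e * flowConst N / 2 ≤ 1/2`, hence `M ≤ 1`.
      set M := ⨆ τ, φ τ with hMdef
      have hM0 : 0 ≤ M := Real.iSup_nonneg fun τ => norm_nonneg _
      have hforce := hstep (k + 1) hk M hM0 (fun i h1 hi => ih (by omega) i h1 (by omega))
        (fun _ τ => le_ciSup hbdd τ)
      have hle : M ≤ e * (flowConst N / 2) * (1 + M) := by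
        refine ciSup_le fun τ => ?_
        have hτ := τ.2.1
        have hc0 : 0 ≤ e * (flowConst N / 2) * (1 + M) := by
          have := two_le_flowConst N
          positivity
        refine (norm_iteratedFDeriv_backInt_backInt_le ht hnem hk hc0 τ p
          fun σ _ => hforce σ).2.trans ?_
        exact mul_le_of_le_one_right hc0 (rpow_weight_le_one hτ (by norm_num))
      have hM1 : M ≤ 1 := by nlinarith
      exact fun τ => (le_ciSup hbdd τ).trans hM1
  -- With `M = 1` the factor `1+M = 2` restores the half of `flowConst N` set aside in the
  -- bootstrap.
  refine (hstep k hk 1 zero_le_one (fun i h1 hi => hdev k hk i h1 hi.le)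
    (fun h1 => hdev k hk k h1 le_rfl) τ).trans_eq ?_
  ring

/-- Bounds for the deviations of velocity and position from free transport in a frame. -/
theorem norm_iteratedFDeriv_deviation_le (ht : 0 ≤ t) (h : FieldBound N e E)
    (hsmall : e * flowConst N ≤ 1) {γ : Sp d × Sp d → C(Icc (0 : ℝ) t, Sp d)}
    (hγ : ContDiff ℝ N γ) (hsol : ∀ p, γ p = freePath d t p + kick ht h.regular (γ p))
    (c : Sp d × Sp d) (L : P →L[ℝ] Sp d × Sp d)
    (hL : ∀ (s : Icc (0 : ℝ) t) q, ‖freePath d t (L q) s‖ ≤ (1 + s) * ‖q‖)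
    {k : ℕ} (hk : k ≤ N) (s : Icc (0 : ℝ) t) (p : P) :
    ‖iteratedFDeriv ℝ k
        (fun q => backInt t ht (nem (fieldOn t h.regular) (γ (c + L q))) s) p‖
      ≤ e * flowConst N * (1 + (s : ℝ)) ^ (-(7 / 4) : ℝ) ∧
    ‖iteratedFDeriv ℝ k (fun q => kick ht h.regular (γ (c + L q)) s) p‖
      ≤ e * flowConst N * (1 + (s : ℝ)) ^ (-(3 / 4) : ℝ) := by
  have hξ : ContDiff ℝ N fun q => γ (c + L q) := hγ.comp (contDiff_const.add L.contDiff)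
  have h2 := two_le_flowConst N
  have := h.nonneg
  exact norm_iteratedFDeriv_backInt_backInt_le ht
    ((contDiff_nem_fieldOn h.regular).comp hξ) hk (by positivity) s p
    fun τ _ => norm_iteratedFDeriv_force_le ht h hsmall hγ hsol c L hL hk τ p

/-- Displacement from free transport near the final time. -/
lemma norm_kick_le (ht : 0 ≤ t) (h : FieldBound N e E) (γ : C(Icc (0 : ℝ) t, Sp d))
    (s : Icc (0 : ℝ) t) :
    ‖kick ht h.regular γ s‖ ≤ (t - s) * (e * (1 + (s : ℝ)) ^ (-(7 / 4) : ℝ)) := by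
  have he := h.nonneg
  have hst : (0 : ℝ) ≤ t - s := by linarith [s.2.2]
  -- Decay is used in the inner integral only; the outer one contributes the length `t-s`, which is
  -- divided out later in the average velocity.
  rw [kick, backInt_apply]
  refine (intervalIntegral.norm_integral_le_of_norm_le_const
    (C := e * (1 + (s : ℝ)) ^ (-(7 / 4) : ℝ)) fun τ hτ => ?_).trans_eq ?_
  · rw [uIoc_of_le s.2.2] at hτ
    have hτ' : τ ∈ Icc 0 t := ⟨s.2.1.trans hτ.1.le, hτ.2⟩
    rw [projIcc_of_mem ht hτ']
    have := norm_backInt_le ht (by norm_num) he ⟨τ, hτ'⟩ (r := 11 / 4)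
      (f := nem (fieldOn t h.regular) γ) fun σ hσ => h.norm_le σ.2.1 _
    refine this.trans ?_
    norm_num
    have hmono : (1 + τ) ^ (-(7 / 4) : ℝ) ≤ (1 + (s : ℝ)) ^ (-(7 / 4) : ℝ) :=
      Real.rpow_le_rpow_of_nonpos (by linarith [s.2.1]) (by linarith [hτ.1]) (by norm_num)
    refine mul_le_mul (by linarith) hmono (Real.rpow_nonneg (by linarith [hτ'.1]) _) he
  · rw [abs_of_nonneg hst]
    ring

/-- The velocity derivative of the displacement at fixed final position. -/
theorem norm_fderiv_kick_le (ht : 0 ≤ t) (h : FieldBound N e E) (hN : 1 ≤ N) (he2 : e ≤ 1 / 2)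
    {γ : Sp d × Sp d → C(Icc (0 : ℝ) t, Sp d)}
    (hγ : ContDiff ℝ N γ) (hsol : ∀ p, γ p = freePath d t p + kick ht h.regular (γ p))
    (x v : Sp d) (s : Icc (0 : ℝ) t) :
    ‖fderiv ℝ (fun w => kick ht h.regular (γ (x, w)) s) v‖
      ≤ (t - s) * (2 * e * (1 + (s : ℝ)) ^ (-(7 / 4) : ℝ)) := by
  have he := h.nonneg
  have hs0 : (0 : ℝ) ≤ s := s.2.1
  have hst : (0 : ℝ) ≤ t - s := by linarith [s.2.2]
  set ξ : Sp d → C(Icc (0 : ℝ) t, Sp d) := fun w => γ (x, w) with hξdef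
  have hξ : ContDiff ℝ N ξ := hγ.comp (contDiff_const.prodMk contDiff_id)
  have hnem : ContDiff ℝ N fun q => nem (fieldOn t h.regular) (ξ q) :=
    (contDiff_nem_fieldOn h.regular).comp hξ
  have hkick : ContDiff ℝ N fun q => kick ht h.regular (ξ q) :=
    (contDiff_kick ht h.regular).comp hξ
  have hN0 : (N : WithTop ℕ∞) ≠ 0 := by simpa using (Nat.one_le_iff_ne_zero.1 hN)
  have hforce : ∀ τ : Icc (0 : ℝ) t, ‖fderiv ℝ (fun q => E τ (ξ q τ)) v‖
      ≤ ‖fderiv ℝ (E τ) (ξ v τ)‖ * ‖fderiv ℝ (fun q => ξ q τ) v‖ := by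
    intro τ
    have h1 := ((h.regular.1 τ τ.2.1).differentiable hN0 (ξ v τ)).hasFDerivAt
    have h2 := ((contDiff_eval hξ τ).differentiable hN0 v).hasFDerivAt
    have h3 : HasFDerivAt (fun q => E τ (ξ q τ)) _ v := HasFDerivAt.comp v h1 h2
    rw [h3.fderiv]
    exact ContinuousLinearMap.opNorm_comp_le _ _
  have hpath : ∀ τ : Icc (0 : ℝ) t, ‖fderiv ℝ (fun q => ξ q τ) v‖
      ≤ (t - τ) + ‖fderiv ℝ (fun q => kick ht h.regular (ξ q) τ) v‖ := by
    intro τ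
    have hτ : (0 : ℝ) ≤ t - τ := by linarith [τ.2.2]
    have h2 := ((contDiff_eval hkick τ).differentiable hN0 v).hasFDerivAt
    have heq : (fun q => ξ q τ) = fun q => (x - (t - τ) • q) + kick ht h.regular (ξ q) τ := by
      ext1 q
      exact congrArg (fun f => f τ) (hsol (x, q))
    have h3 : HasFDerivAt (fun q => (x - (t - (τ : ℝ)) • q) + kick ht h.regular (ξ q) τ)
        (-((t - (τ : ℝ)) • ContinuousLinearMap.id ℝ (Sp d))
          + fderiv ℝ (fun q => kick ht h.regular (ξ q) τ) v) v :=
      (((hasFDerivAt_id (𝕜 := ℝ) v).const_smul (t - (τ : ℝ))).const_sub x).add h2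
    rw [heq, h3.fderiv]
    refine (norm_add_le _ _).trans ?_
    gcongr
    rw [norm_neg, norm_smul, Real.norm_of_nonneg hτ]
    exact mul_le_of_le_one_right hτ ContinuousLinearMap.norm_id_le
  let φ : Icc (0 : ℝ) t → ℝ := fun τ => ‖fderiv ℝ (fun q => ξ q τ) v‖
  have hbdd : BddAbove (φ '' Ici s) := by
    refine ⟨‖fderiv ℝ ξ v‖, ?_⟩
    rintro _ ⟨τ, -, rfl⟩
    have h2 := (hξ.differentiable hN0 v).hasFDerivAt
    have h3 : HasFDerivAt (fun q => ξ q τ) ((evalL τ).comp (fderiv ℝ ξ v)) v :=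
      HasFDerivAt.comp v (evalL (G := Sp d) τ).hasFDerivAt h2
    simp only [φ]
    rw [h3.fderiv]
    exact ContinuousLinearMap.opNorm_le_bound _ (ContinuousLinearMap.opNorm_nonneg _) fun m =>
      (ContinuousMap.norm_coe_le_norm _ τ).trans (ContinuousLinearMap.le_opNorm _ m)
  set M := sSup (φ '' Ici s) with hMdef
  have hφM : ∀ τ, s ≤ τ → φ τ ≤ M := fun τ hτ => le_csSup hbdd ⟨τ, hτ, rfl⟩
  have hM0 : 0 ≤ M := (norm_nonneg _).trans (hφM s le_rfl)
  -- Here `M` is the supremum over `[s,t]` of the velocity derivative of the path. The free part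
  -- contributes at most `t-s` and the force at most `e M`, with `e ≤ 1/2`.
  have hM : M ≤ 2 * (t - s) := by
    have hle : M ≤ (t - s) + e * M := by
      refine csSup_le ⟨_, s, self_mem_Ici, rfl⟩ ?_
      rintro _ ⟨τ, hτ, rfl⟩
      have hτ0 := τ.2.1
      refine (hpath τ).trans ?_
      have hτs : (s : ℝ) ≤ τ := hτ
      have := (norm_iteratedFDeriv_backInt_backInt_le ht hnem hN (c := e * M) (by positivity) τ v
        fun σ hσ => by
          rw [norm_iteratedFDeriv_one]
          refine (hforce σ).trans ?_
          have h1 := h.norm_fderiv_le hN σ.2.1 (ξ v σ)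
          have h2 := hφM σ (hτ.trans hσ)
          have hnn : (0 : ℝ) ≤ (1 + (σ : ℝ)) ^ (-(11 / 4) : ℝ) :=
            Real.rpow_nonneg (by linarith [σ.2.1]) _
          calc _ ≤ (e * (1 + (σ : ℝ)) ^ (-(11 / 4) : ℝ)) * M := by gcongr
            _ = _ := by ring).2
      rw [norm_iteratedFDeriv_one] at this
      have h5 := this.trans (mul_le_of_le_one_right (by positivity)
        (rpow_weight_le_one hτ0 (by norm_num)))
      have h6 : ‖fderiv ℝ (fun q => kick ht h.regular (ξ q) τ) v‖ ≤ e * M := h5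
      linarith
    nlinarith
  -- The first derivative of the field has one extra power of decay, so the force derivative has
  -- weight `-15/4` and two integrations still leave `-7/4`. The factor `t-s` comes from `M`.
  have hJ : ∀ τ : Icc (0 : ℝ) t, s ≤ τ →
      ‖iteratedFDeriv ℝ 1 (fun q => backInt t ht (nem (fieldOn t h.regular) (ξ q)) τ) v‖
        ≤ (e * M / (11 / 4)) * (1 + (τ : ℝ)) ^ (-(11 / 4) : ℝ) := by
    intro τ hτ
    have := norm_iteratedFDeriv_backInt_le ht hnem hN (r := 15 / 4) (c := e * M) (by norm_num)
      (by positivity) τ v fun σ hσ => by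
        rw [norm_iteratedFDeriv_one]
        refine (hforce σ).trans ?_
        have hσ0 : (0 : ℝ) < 1 + σ := by linarith [σ.2.1]
        have h1 := h.bound σ σ.2.1 1 hN (ξ v σ)
        rw [pow_one, norm_iteratedFDeriv_one] at h1
        have h2 := hφM σ (hτ.trans hσ)
        have h3 : (1 + (σ : ℝ)) ^ (-(11 / 4) : ℝ)
            = (1 + σ) * (1 + (σ : ℝ)) ^ (-(15 / 4) : ℝ) := by
          rw [← Real.rpow_one_add' hσ0.le (by norm_num)]
          norm_num
        rw [h3, mul_left_comm] at h1
        have h4 := le_of_mul_le_mul_left h1 hσ0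
        have hnn : (0 : ℝ) ≤ (1 + (σ : ℝ)) ^ (-(15 / 4) : ℝ) := Real.rpow_nonneg hσ0.le _
        calc _ ≤ (e * (1 + (σ : ℝ)) ^ (-(15 / 4) : ℝ)) * M := by gcongr
          _ = _ := by ring
    norm_num at this ⊢
    exact this
  have hb : ContDiff ℝ N fun q => backInt t ht (nem (fieldOn t h.regular) (ξ q)) :=
    (backInt (G := Sp d) t ht).contDiff.comp hnem
  have hfin := norm_iteratedFDeriv_backInt_le ht hb hN (r := 11 / 4) (by norm_num) (by positivity)
    s v hJ
  rw [norm_iteratedFDeriv_one] at hfin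
  refine hfin.trans ?_
  norm_num
  have hnn : (0 : ℝ) ≤ (1 + (s : ℝ)) ^ (-(7 / 4) : ℝ) := Real.rpow_nonneg (by linarith) _
  calc e * M / (11 / 4) / (7 / 4) * (1 + (s : ℝ)) ^ (-(7 / 4) : ℝ)
      = (e * (1 + (s : ℝ)) ^ (-(7 / 4) : ℝ)) * (16 / 77 * M) := by ring
    _ ≤ (e * (1 + (s : ℝ)) ^ (-(7 / 4) : ℝ)) * (2 * (t - s)) := by
        exact mul_le_mul_of_nonneg_left (by linarith) (by positivity)
    _ = _ := by ring

end FrameBounds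

end VlasovForcing

namespace VlasovForcing

/-! ### Change of variables for near-identity maps -/

section NearIdentity

variable {F : Type*} [NormedAddCommGroup F] [NormedSpace ℝ F] [FiniteDimensional ℝ F]

lemma contDiff_det : ContDiff ℝ 1 fun B : F →L[ℝ] F => B.det := by
  let b := Module.finBasis ℝ F
  have h1 : ∀ B : F →L[ℝ] F, B.det = (LinearMap.toMatrix b b (B : F →ₗ[ℝ] F)).det := fun B =>
    (LinearMap.det_toMatrix b _).symm
  simp only [h1, Matrix.det_apply, LinearMap.toMatrix_apply]
  refine ContDiff.sum fun σ _ => ContDiff.const_smul _ (contDiff_prod fun i _ => ?_)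
  have h2 : ContDiff ℝ 1 fun B : F →L[ℝ] F => B (b i) := contDiff_id.clm_apply contDiff_const
  exact ((b.coord (σ i)).toContinuousLinearMap.contDiff).comp h2

/-- The determinant is `C^1`, hence Lipschitz near the identity, where it equals one. The radius is
also chosen so that the deviation is at most `1/2`; `K + 1` replaces the Lipschitz constant `K` to
keep the denominator and the constant positive. -/
lemma exists_abs_det_bound (F : Type*) [NormedAddCommGroup F] [NormedSpace ℝ F]
    [FiniteDimensional ℝ F] :
    ∃ η C : ℝ, 0 < η ∧ η ≤ 1 / 2 ∧ 0 < C ∧ ∀ B : F →L[ℝ] F, ‖B‖ ≤ η →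
      |(|(ContinuousLinearMap.id ℝ F + B).det| - 1)| ≤ C * ‖B‖ ∧
      1 / 2 ≤ |(ContinuousLinearMap.id ℝ F + B).det| := by
  have h1 : ContDiff ℝ 1 fun B : F →L[ℝ] F => (ContinuousLinearMap.id ℝ F + B).det :=
    contDiff_det.comp (contDiff_const.add contDiff_id)
  obtain ⟨K, s, hs, hK⟩ := (h1.contDiffAt (x := 0)).exists_lipschitzOnWith
  obtain ⟨r, hr, hball⟩ := Metric.mem_nhds_iff.1 hs
  have hK0 : (0 : ℝ) ≤ K := K.2
  refine ⟨min (r / 2) (1 / (2 * (K + 1))), K + 1, by positivity, ?_, by positivity, fun B hB => ?_⟩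
  · refine (min_le_right _ _).trans ?_
    rw [div_le_div_iff₀ (by positivity) (by norm_num)]
    linarith
  have hBr : B ∈ s := hball (by
    have := hB.trans (min_le_left _ _)
    simp only [Metric.mem_ball, dist_zero_right]
    linarith)
  have h0 : (0 : F →L[ℝ] F) ∈ s := hball (Metric.mem_ball_self hr)
  have h2 := hK.dist_le_mul B hBr 0 h0
  have hid : (ContinuousLinearMap.id ℝ F + 0).det = 1 := by
    rw [add_zero]
    exact LinearMap.det_id
  rw [hid, Real.dist_eq, dist_zero_right] at h2
  have h3 : |(|(ContinuousLinearMap.id ℝ F + B).det| - 1)| ≤ K * ‖B‖ := by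
    refine le_trans ?_ h2
    have := abs_abs_sub_abs_le (ContinuousLinearMap.id ℝ F + B).det 1
    rwa [abs_one] at this
  have h4 : K * ‖B‖ ≤ (K + 1) * ‖B‖ := by nlinarith [norm_nonneg B]
  refine ⟨h3.trans h4, ?_⟩
  have h5 : (K + 1) * ‖B‖ ≤ 1 / 2 := by
    have := hB.trans (min_le_right _ _)
    rw [le_div_iff₀ (by positivity)] at this
    linarith
  have := (abs_le.1 (h3.trans (h4.trans h5))).1
  linarith

variable {U : F → F} {B : F → F →L[ℝ] F}

lemma approximatesLinearOn_of_perturbation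
    (hU : ∀ x, HasFDerivAt U (ContinuousLinearMap.id ℝ F + B x) x) (hB : ∀ x, ‖B x‖ ≤ 1 / 2) :
    ApproximatesLinearOn U (ContinuousLinearEquiv.refl ℝ F : F →L[ℝ] F) univ (1 / 2) := by
  intro x _ y _
  have h1 : ∀ z, HasFDerivAt (fun w => U w - w) (B z) z := fun z => by
    have := (hU z).sub (hasFDerivAt_id z)
    rwa [add_sub_cancel_left] at this
  have h2 := (convex_univ (𝕜 := ℝ) (E := F)).norm_image_sub_le_of_norm_hasFDerivWithin_le
    (fun z _ => (h1 z).hasFDerivWithinAt) (fun z _ => hB z) (mem_univ y) (mem_univ x)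
  calc ‖U x - U y - (x - y)‖ = ‖U x - x - (U y - y)‖ := by congr 1; abel
    _ ≤ 1 / 2 * ‖x - y‖ := h2
    _ = _ := by norm_num

/-- `U - id` has derivative `B`, so it is `1/2`-Lipschitz, and a map this close to the identity is
globally injective and surjective. The change of variables then holds on the whole space. -/
lemma bijective_of_perturbation
    (hU : ∀ x, HasFDerivAt U (ContinuousLinearMap.id ℝ F + B x) x) (hB : ∀ x, ‖B x‖ ≤ 1 / 2) :
    Function.Bijective U := by
  have happ := approximatesLinearOn_of_perturbation hU hB
  have hc : Subsingleton F ∨ (1 / 2 : NNReal) <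
      ‖((ContinuousLinearEquiv.refl ℝ F).symm : F →L[ℝ] F)‖₊⁻¹ := by
    rcases subsingleton_or_nontrivial F with hs | hs
    · exact Or.inl hs
    · right
      have : ‖((ContinuousLinearEquiv.refl ℝ F).symm : F →L[ℝ] F)‖₊ = 1 := by
        ext
        exact ContinuousLinearMap.norm_id
      rw [this, inv_one]
      exact NNReal.half_lt_self one_ne_zero
  exact ⟨injOn_univ.1 (happ.injOn hc), happ.surjective hc⟩

variable [MeasurableSpace F] [BorelSpace F] (m : Measure F) [m.IsAddHaarMeasure]

lemma lintegral_comp_perturbation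
    (hU : ∀ x, HasFDerivAt U (ContinuousLinearMap.id ℝ F + B x) x) (hB : ∀ x, ‖B x‖ ≤ 1 / 2)
    (g : F → ℝ≥0∞) :
    ∫⁻ x, ENNReal.ofReal |(ContinuousLinearMap.id ℝ F + B x).det| * g (U x) ∂m = ∫⁻ x, g x ∂m := by
  have hbij := bijective_of_perturbation hU hB
  have := lintegral_image_eq_lintegral_abs_det_fderiv_mul m MeasurableSet.univ
    (fun x _ => (hU x).hasFDerivWithinAt) hbij.1.injOn g
  rw [image_univ, hbij.2.range_eq] at this
  simpa using this.symm

lemma integral_comp_perturbation {G : Type*} [NormedAddCommGroup G] [NormedSpace ℝ G]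
    (hU : ∀ x, HasFDerivAt U (ContinuousLinearMap.id ℝ F + B x) x) (hB : ∀ x, ‖B x‖ ≤ 1 / 2)
    (g : F → G) :
    ∫ x, |(ContinuousLinearMap.id ℝ F + B x).det| • g (U x) ∂m = ∫ x, g x ∂m := by
  have hbij := bijective_of_perturbation hU hB
  have := integral_image_eq_integral_abs_det_fderiv_smul m MeasurableSet.univ
    (fun x _ => (hU x).hasFDerivWithinAt) hbij.1.injOn g
  rw [image_univ, hbij.2.range_eq] at this
  simpa using this.symm

lemma integrable_comp_perturbation {G : Type*} [NormedAddCommGroup G] [NormedSpace ℝ G]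
    (hU : ∀ x, HasFDerivAt U (ContinuousLinearMap.id ℝ F + B x) x) (hB : ∀ x, ‖B x‖ ≤ 1 / 2)
    {g : F → G} (hg : Integrable g m) :
    Integrable (fun x => |(ContinuousLinearMap.id ℝ F + B x).det| • g (U x)) m := by
  have hbij := bijective_of_perturbation hU hB
  have := integrableOn_image_iff_integrableOn_abs_det_fderiv_smul m MeasurableSet.univ
    (fun x _ => (hU x).hasFDerivWithinAt) hbij.1.injOn g
  rw [image_univ, hbij.2.range_eq, integrableOn_univ, integrableOn_univ] at this
  exact this.1 hg

lemma lintegral_comp_perturbation_le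
    (hU : ∀ x, HasFDerivAt U (ContinuousLinearMap.id ℝ F + B x) x) (hB : ∀ x, ‖B x‖ ≤ 1 / 2)
    (hdet : ∀ x, 1 / 2 ≤ |(ContinuousLinearMap.id ℝ F + B x).det|) (g : F → ℝ≥0∞) :
    ∫⁻ x, g (U x) ∂m ≤ 2 * ∫⁻ x, g x ∂m := by
  rw [← lintegral_comp_perturbation m hU hB g, ← lintegral_const_mul' _ _ (by simp)]
  refine lintegral_mono fun x => ?_
  rw [← mul_assoc]
  refine le_mul_of_one_le_left zero_le ?_
  have h1 : (2 : ℝ≥0∞) = ENNReal.ofReal 2 := by simp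
  rw [h1, ← ENNReal.ofReal_mul (by norm_num), ENNReal.one_le_ofReal]
  linarith [hdet x]

/-- A lower bound on the Jacobian prevents null sets from having preimages of positive measure. This
allows composition with functions known only almost everywhere. -/
lemma quasiMeasurePreserving_perturbation
    (hU : ∀ x, HasFDerivAt U (ContinuousLinearMap.id ℝ F + B x) x) (hB : ∀ x, ‖B x‖ ≤ 1 / 2)
    (hdet : ∀ x, 1 / 2 ≤ |(ContinuousLinearMap.id ℝ F + B x).det|) :
    Measure.QuasiMeasurePreserving U m m := by
  have hm : Measurable U :=
    (continuous_iff_continuousAt.2 fun x => (hU x).continuousAt).measurable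
  refine ⟨hm, Measure.AbsolutelyContinuous.mk fun s hs h0 => ?_⟩
  rw [Measure.map_apply hm hs]
  have := lintegral_comp_perturbation_le m hU hB hdet (s.indicator 1)
  rw [lintegral_indicator_one hs, h0, mul_zero, nonpos_iff_eq_zero] at this
  rw [← this, ← lintegral_indicator_one (hm hs)]
  rfl

end NearIdentity

end VlasovForcing

namespace VlasovForcing

/-! ### Differentiation of parametric integrals -/

section ParametricIntegral

variable {P G : Type*} [NormedAddCommGroup P] [NormedSpace ℝ P]
  [NormedAddCommGroup G] [NormedSpace ℝ G]

lemma fderiv_iteratedFDeriv_eq (f : P → G) (k : ℕ) (p : P) :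
    fderiv ℝ (iteratedFDeriv ℝ k f) p
      = continuousMultilinearCurryLeftEquiv ℝ (fun _ : Fin (k + 1) => P) G
        (iteratedFDeriv ℝ (k + 1) f p) := by
  rw [iteratedFDeriv_succ_eq_comp_left, Function.comp_apply, LinearIsometryEquiv.apply_symm_apply]

/-- Differentiation of parametric integrals to order `N`, under local domination. -/
theorem contDiff_integral_of_dominated {Ω : Type*} [MeasurableSpace Ω] {m : Measure Ω} {N : ℕ}
    {F : Ω → P → G} (hF : ∀ a, ContDiff ℝ N (F a))
    (hmeas : ∀ k, k ≤ N → ∀ p, AEStronglyMeasurable (fun a => iteratedFDeriv ℝ k (F a) p) m)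
    (hdom : ∀ k, k ≤ N → ∀ p₀, ∃ b : Ω → ℝ, Integrable b m ∧
      ∀ᵐ a ∂m, ∀ p ∈ Metric.ball p₀ 1, ‖iteratedFDeriv ℝ k (F a) p‖ ≤ b a) :
    ContDiff ℝ N (fun p => ∫ a, F a p ∂m) ∧
      ∀ k, k ≤ N → ∀ p,
        iteratedFDeriv ℝ k (fun p => ∫ a, F a p ∂m) p = ∫ a, iteratedFDeriv ℝ k (F a) p ∂m := by
  have hint : ∀ k, k ≤ N → ∀ p, Integrable (fun a => iteratedFDeriv ℝ k (F a) p) m := by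
    intro k hk p
    obtain ⟨b, hb, hle⟩ := hdom k hk p
    exact hb.mono' (hmeas k hk p) (hle.mono fun a h => h p (Metric.mem_ball_self one_pos))
  have hder : ∀ k, k < N → ∀ p, HasFDerivAt (fun p => ∫ a, iteratedFDeriv ℝ k (F a) p ∂m)
      (∫ a, fderiv ℝ (iteratedFDeriv ℝ k (F a)) p ∂m) p := by
    intro k hk p
    obtain ⟨b, hb, hle⟩ := hdom (k + 1) hk p
    refine hasFDerivAt_integral_of_dominated_of_fderiv_le (𝕜 := ℝ)
      (F' := fun p a => fderiv ℝ (iteratedFDeriv ℝ k (F a)) p) (Metric.ball_mem_nhds p one_pos)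
      (Filter.Eventually.of_forall fun q => hmeas k hk.le q) (hint k hk.le p) ?_ ?_ hb ?_
    · simp only [fderiv_iteratedFDeriv_eq]
      exact (continuousMultilinearCurryLeftEquiv ℝ (fun _ : Fin (k + 1) => P)
        G).continuous.comp_aestronglyMeasurable (hmeas (k + 1) hk p)
    · filter_upwards [hle] with a h q hq
      rw [fderiv_iteratedFDeriv_eq, LinearIsometryEquiv.norm_map]
      exact h q hq
    · refine ae_of_all _ fun a q _ => ?_
      exact ((hF a).differentiable_iteratedFDeriv (by exact_mod_cast hk) q).hasFDerivAt
  have heq : ∀ k, k ≤ N → ∀ p,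
        iteratedFDeriv ℝ k (fun p => ∫ a, F a p ∂m) p = ∫ a, iteratedFDeriv ℝ k (F a) p ∂m := by
    intro k
    induction k with
    | zero =>
      intro _ p
      simp only [iteratedFDeriv_zero_eq_comp, Function.comp_apply]
      exact (((continuousMultilinearCurryFin0 ℝ P G).symm.toContinuousLinearEquiv
        ).integral_comp_comm _).symm
    | succ k ih =>
      intro hk p
      have h1 : iteratedFDeriv ℝ k (fun p => ∫ a, F a p ∂m)
          = fun p => ∫ a, iteratedFDeriv ℝ k (F a) p ∂m := funext (ih (by omega))
      rw [iteratedFDeriv_succ_eq_comp_left, Function.comp_apply, h1, (hder k hk p).fderiv]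
      simp only [fderiv_iteratedFDeriv_eq]
      rw [LinearIsometryEquiv.symm_apply_eq]
      exact ContinuousLinearEquiv.integral_comp_comm (𝕜 := ℝ)
        (E := ContinuousMultilinearMap ℝ (fun _ : Fin (k + 1) => P) G)
        (F := P →L[ℝ] ContinuousMultilinearMap ℝ (fun _ : Fin k => P) G)
        (continuousMultilinearCurryLeftEquiv ℝ (fun _ : Fin (k + 1) => P)
          G).toContinuousLinearEquiv (μ := m) fun a => iteratedFDeriv ℝ (k + 1) (F a) p
  refine ⟨?_, heq⟩
  rw [contDiff_nat_iff_continuous_differentiable]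
  refine ⟨fun k hk => ?_, fun k hk => ?_⟩
  · have hk' : k ≤ N := by exact_mod_cast hk
    rw [funext (heq k hk')]
    refine continuous_iff_continuousAt.2 fun p => ?_
    obtain ⟨b, hb, hle⟩ := hdom k hk' p
    refine continuousAt_of_dominated (bound := b)
      (Filter.Eventually.of_forall fun q => hmeas k hk' q) ?_ hb ?_
    · filter_upwards [Metric.ball_mem_nhds p one_pos] with q hq
      exact hle.mono fun a h => h q hq
    · exact ae_of_all _ fun a =>
        ((hF a).continuous_iteratedFDeriv (by exact_mod_cast hk')).continuousAt
  · have hk' : k < N := by exact_mod_cast hk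
    rw [funext (heq k hk'.le)]
    exact fun p => (hder k hk' p).differentiableAt

/-- Currying one variable at a time reduces to linear maps on a finite-dimensional space, where
pointwise and norm continuity agree. It supplies the measurability of derivatives in the time and
velocity variables. -/
lemma continuous_multilinear_of_forall_apply {Z : Type*} [TopologicalSpace Z]
    [FiniteDimensional ℝ P] {k : ℕ} {M : Z → ContinuousMultilinearMap ℝ (fun _ : Fin k => P) G}
    (h : ∀ x, Continuous fun z => M z x) : Continuous M := by
  induction k with
  | zero =>
    rw [← (continuousMultilinearCurryFin0 ℝ P G).toHomeomorph.comp_continuous_iff]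
    exact h 0
  | succ k ih =>
    rw [← (continuousMultilinearCurryLeftEquiv ℝ (fun _ : Fin (k + 1) => P)
      G).toHomeomorph.comp_continuous_iff, continuous_clm_apply]
    intro y
    refine ih fun x => ?_
    exact h (Fin.cons y x)

end ParametricIntegral

/-! ### Faà di Bruno estimates and their differences -/

section TaylorComp

variable {E F G : Type*} [NormedAddCommGroup E] [NormedSpace ℝ E]
  [NormedAddCommGroup F] [NormedSpace ℝ F] [NormedAddCommGroup G] [NormedSpace ℝ G]

/-- There is one term for each ordered partition. Its parts are nonempty, so only inner jets of
order between `1` and `k` occur, and there are at most `k` of them. -/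
lemma norm_taylorComp_le (q : FormalMultilinearSeries ℝ F G) (p : FormalMultilinearSeries ℝ E F)
    (k : ℕ) {Q : ℝ} (hq : ∀ j, j ≤ k → ‖q j‖ ≤ Q) (hp : ∀ i, 1 ≤ i → i ≤ k → ‖p i‖ ≤ 2) :
    ‖q.taylorComp p k‖ ≤ Fintype.card (OrderedFinpartition k) * 2 ^ k * Q := by
  have hQ : 0 ≤ Q := (norm_nonneg _).trans (hq 0 (Nat.zero_le _))
  refine (norm_sum_le _ _).trans ?_
  refine (Finset.sum_le_card_nsmul _ _ (2 ^ k * Q) fun c _ => ?_).trans_eq ?_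
  · refine (c.norm_compAlongOrderedFinpartition_le _ _).trans ?_
    rw [mul_comm]
    refine mul_le_mul ?_ (hq _ c.length_le) (norm_nonneg _) (by positivity)
    calc ∏ i, ‖p (c.partSize i)‖ ≤ ∏ _i : Fin c.length, (2 : ℝ) :=
          Finset.prod_le_prod (fun _ _ => norm_nonneg _)
            fun i _ => hp _ (c.partSize_pos i) (c.partSize_le i)
      _ = 2 ^ c.length := by simp
      _ ≤ 2 ^ k := pow_le_pow_right₀ (by norm_num) c.length_le
  · rw [Finset.card_univ, nsmul_eq_mul, mul_assoc]

/-- Inner jets are exchanged one at a time, at most `k` exchanges, and the outer jet once; this is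
the factor `k + 1`. The zeroth inner jets never enter, so only the orders `i ≥ 1` are compared. -/
lemma norm_taylorComp_sub_le (q₁ q₂ : FormalMultilinearSeries ℝ F G)
    (p₁ p₂ : FormalMultilinearSeries ℝ E F) (k : ℕ) {Q δ : ℝ} (hδ : 0 ≤ δ)
    (hq : ∀ j, j ≤ k → ‖q₁ j‖ ≤ Q) (hqq : ∀ j, j ≤ k → ‖q₁ j - q₂ j‖ ≤ Q * δ)
    (hp₁ : ∀ i, 1 ≤ i → i ≤ k → ‖p₁ i‖ ≤ 2) (hp₂ : ∀ i, 1 ≤ i → i ≤ k → ‖p₂ i‖ ≤ 2)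
    (hpp : ∀ i, 1 ≤ i → i ≤ k → ‖p₁ i - p₂ i‖ ≤ δ) :
    ‖q₁.taylorComp p₁ k - q₂.taylorComp p₂ k‖
      ≤ Fintype.card (OrderedFinpartition k) * ((k + 1) * 2 ^ k) * (Q * δ) := by
  have hQ : 0 ≤ Q := (norm_nonneg _).trans (hq 0 (Nat.zero_le _))
  simp only [FormalMultilinearSeries.taylorComp, ← Finset.sum_sub_distrib]
  refine (norm_sum_le _ _).trans ?_
  refine (Finset.sum_le_card_nsmul _ _ (((k + 1) * 2 ^ k) * (Q * δ)) fun c _ => ?_).trans_eq ?_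
  · refine (c.norm_compAlongOrderedFinpartition_sub_compAlongOrderedFinpartition_le ..).trans ?_
    have hlen : (c.length : ℝ) ≤ k := by exact_mod_cast c.length_le
    have h1 : ‖fun i => p₁ (c.partSize i)‖ ≤ 2 := (pi_norm_le_iff_of_nonneg (by norm_num)).2
      fun i => hp₁ _ (c.partSize_pos i) (c.partSize_le i)
    have h2 : ‖fun i => p₂ (c.partSize i)‖ ≤ 2 := (pi_norm_le_iff_of_nonneg (by norm_num)).2
      fun i => hp₂ _ (c.partSize_pos i) (c.partSize_le i)
    have h3 : ‖(fun i => p₁ (c.partSize i)) - fun i => p₂ (c.partSize i)‖ ≤ δ :=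
      (pi_norm_le_iff_of_nonneg hδ).2 fun i => hpp _ (c.partSize_pos i) (c.partSize_le i)
    have h4 : max ‖fun i => p₁ (c.partSize i)‖ ‖fun i => p₂ (c.partSize i)‖ ^ (c.length - 1)
        ≤ 2 ^ k := (pow_le_pow_left₀ (le_max_of_le_left (norm_nonneg _)) (max_le h1 h2) _).trans
          (pow_le_pow_right₀ (by norm_num) ((Nat.sub_le _ _).trans c.length_le))
    have h5 : ∏ i, ‖p₂ (c.partSize i)‖ ≤ 2 ^ k :=
      calc ∏ i, ‖p₂ (c.partSize i)‖ ≤ ∏ _i : Fin c.length, (2 : ℝ) :=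
          Finset.prod_le_prod (fun _ _ => norm_nonneg _)
            fun i _ => hp₂ _ (c.partSize_pos i) (c.partSize_le i)
        _ = 2 ^ c.length := by simp
        _ ≤ 2 ^ k := pow_le_pow_right₀ (by norm_num) c.length_le
    calc _ ≤ Q * k * 2 ^ k * δ + Q * δ * 2 ^ k := by
          refine add_le_add ?_ ?_
          · refine mul_le_mul (mul_le_mul (mul_le_mul (hq _ c.length_le) hlen (by positivity) hQ)
              h4 (by positivity) (by positivity)) h3 (norm_nonneg _) (by positivity)
          · exact mul_le_mul (hqq _ c.length_le) h5
              (Finset.prod_nonneg fun _ _ => norm_nonneg _) (by positivity)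
      _ = _ := by ring
  · rw [Finset.card_univ, nsmul_eq_mul]
    ring

end TaylorComp

/-! ### Polynomial velocity weights -/

section Weights

variable {d : ℕ}

/-- The polynomial weight `(1+|v|)^{-(d+1)}`. -/
def wt (d : ℕ) (v : Sp d) : ℝ := (1 + ‖v‖) ^ (-((d : ℝ) + 1))

lemma wt_nonneg (v : Sp d) : 0 ≤ wt d v := Real.rpow_nonneg (by positivity) _

lemma continuous_wt : Continuous (wt d) := by
  unfold wt
  refine Continuous.rpow_const (by fun_prop) fun v => Or.inl (by positivity)

lemma integrable_wt : Integrable (wt d) := by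
  refine integrable_one_add_norm (by simp)

/-- Peetre's inequality, from `1+|v| ≤ (1+|h|)(1+|v+h|)`. -/
lemma wt_add_le (v h : Sp d) : wt d (v + h) ≤ (1 + ‖h‖) ^ ((d : ℝ) + 1) * wt d v := by
  have h1 : 1 + ‖v‖ ≤ (1 + ‖h‖) * (1 + ‖v + h‖) := by
    have := norm_sub_le (v + h) h
    rw [add_sub_cancel_right] at this
    nlinarith [norm_nonneg h, norm_nonneg (v + h), mul_nonneg (norm_nonneg h) (norm_nonneg (v + h))]
  have h2 := Real.rpow_le_rpow_of_nonpos (z := -((d : ℝ) + 1)) (by positivity) h1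
    (by have : (0 : ℝ) ≤ d := by positivity
        linarith)
  rw [Real.mul_rpow (by positivity) (by positivity)] at h2
  unfold wt
  rw [Real.rpow_neg (by positivity) ((d : ℝ) + 1)] at h2
  rwa [inv_mul_le_iff₀ (by positivity)] at h2

lemma wt_le_of_norm_sub_le {v w : Sp d} (h : ‖w - v‖ ≤ 1) :
    wt d w ≤ 2 ^ ((d : ℝ) + 1) * wt d v := by
  have := wt_add_le v (w - v)
  rw [add_sub_cancel] at this
  refine this.trans ?_
  have := wt_nonneg v
  gcongr
  linarith

lemma le_two_mul_jb (r : ℝ) : 1 + r ≤ 2 * jb r := by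
  unfold jb
  have : (1 + r) / 2 ≤ Real.sqrt (1 + r ^ 2) := by
    apply Real.le_sqrt_of_sq_le
    nlinarith [sq_nonneg (r - 1)]
  linarith

lemma jb_le {r : ℝ} (hr : 0 ≤ r) : jb r ≤ 1 + r := by
  unfold jb
  rw [Real.sqrt_le_left (by linarith)]
  nlinarith

lemma one_le_jb (r : ℝ) : 1 ≤ jb r := by
  unfold jb
  rw [Real.one_le_sqrt]
  nlinarith

lemma le_jb (r : ℝ) : r ≤ jb r := by
  unfold jb
  apply Real.le_sqrt_of_sq_le
  linarith

/-- Decay of order `d+1`, just enough for integrability, is all that is needed from `μ`. Summing the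
constants over the orders gives a single one, and `2^(d+1)` passes from `⟨v⟩` to `1+|v|`. -/
lemma RapidDecay.exists_bound {μ : Sp d → ℝ} (hμ : RapidDecay μ) (n : ℕ) :
    ∃ C : ℝ, 0 < C ∧ ∀ i, i ≤ n → ∀ v, ‖iteratedFDeriv ℝ i μ v‖ ≤ C * wt d v := by
  have hd : (0 : ℝ) < (d : ℝ) + 1 := by positivity
  choose C hC hle using fun i => hμ.2 i ((d : ℝ) + 1) hd
  refine ⟨(∑ i ∈ Finset.range (n + 1), C i) * 2 ^ ((d : ℝ) + 1), ?_, fun i hi v => ?_⟩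
  · have : 0 < ∑ i ∈ Finset.range (n + 1), C i :=
      Finset.sum_pos (fun i _ => hC i) ⟨0, by simp⟩
    positivity
  · refine (hle i v).trans ?_
    rw [mul_assoc]
    have h1 : C i ≤ ∑ i ∈ Finset.range (n + 1), C i :=
      Finset.single_le_sum (fun i _ => (hC i).le) (by simp; omega)
    have hjb : 0 < jb ‖v‖ := zero_lt_one.trans_le (one_le_jb _)
    have h2 : jb ‖v‖ ^ (-((d : ℝ) + 1)) ≤ 2 ^ ((d : ℝ) + 1) * wt d v := by
      have h3 := Real.rpow_le_rpow_of_nonpos (z := -((d : ℝ) + 1)) (by positivity)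
        (le_two_mul_jb ‖v‖) (by linarith)
      rw [Real.mul_rpow (by norm_num) hjb.le, Real.rpow_neg (by norm_num),
        inv_mul_le_iff₀ (by positivity)] at h3
      exact h3
    exact mul_le_mul h1 h2 (Real.rpow_nonneg hjb.le _) (Finset.sum_nonneg fun i _ => (hC i).le)

end Weights

end VlasovForcing

/-! ### The flow at a fixed final time and its basic sizes -/

namespace VlasovForcing

/-- The characteristic flow ending at time `t`, as a smooth map into continuous paths, for a field
so small that the relevant Jacobians are close to one. -/
structure Flow {d : ℕ} (N : ℕ) (E : ℝ → Sp d → Sp d) (e t D : ℝ)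
    (X V : ℝ → ℝ → Sp d → Sp d → Sp d) where
  time_nonneg : 0 ≤ t
  field : FieldBound N e E
  one_le : 1 ≤ N
  small : e * flowConst N ≤ 1 / 2
  det_bound : ∀ B : Sp d →L[ℝ] Sp d, ‖B‖ ≤ e * flowConst N →
    |(|(ContinuousLinearMap.id ℝ (Sp d) + B).det| - 1)| ≤ D * ‖B‖ ∧
      1 / 2 ≤ |(ContinuousLinearMap.id ℝ (Sp d) + B).det|
  det_bound_phase : ∀ B : Sp d × Sp d →L[ℝ] Sp d × Sp d, ‖B‖ ≤ e * flowConst N →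
    1 / 2 ≤ |(ContinuousLinearMap.id ℝ (Sp d × Sp d) + B).det|
  path : Sp d × Sp d → C(Icc (0 : ℝ) t, Sp d)
  contDiff_path : ContDiff ℝ N path
  path_eq : ∀ p, path p = freePath d t p + kick time_nonneg field.regular (path p)
  pos_eq : ∀ (s : Icc (0 : ℝ) t) x v, X s t x v = path (x, v) s
  vel_eq : ∀ (s : Icc (0 : ℝ) t) x v,
    V s t x v = v - backInt t time_nonneg (nem (fieldOn t field.regular) (path (x, v))) s

/-- The threshold is the smaller of the determinant radii on velocity space and on phase space,
divided by `flowConst N`. The radii are at most `1/2`, which also provides the contraction condition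
on `e`. -/
theorem exists_flow (d N : ℕ) (hN : 1 ≤ N) : ∃ e₀ D : ℝ, 0 < e₀ ∧ 0 < D ∧
    ∀ e, e ≤ e₀ → ∀ (E : ℝ → Sp d → Sp d) (X V : ℝ → ℝ → Sp d → Sp d → Sp d),
      FieldBound N e E → IsCharacteristics E X V → ∀ t, 0 ≤ t → Nonempty (Flow N E e t D X V) := by
  obtain ⟨η, D, hη, hη2, hD, hdet⟩ := exists_abs_det_bound (Sp d)
  obtain ⟨η', D', hη', hη2', hD', hdet'⟩ := exists_abs_det_bound (Sp d × Sp d)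
  have hfc := two_le_flowConst N
  refine ⟨min η η' / flowConst N, D, by positivity, hD, fun e he E X V hE hXV t ht => ?_⟩
  rw [le_div_iff₀ (by positivity)] at he
  have he0 := hE.nonneg
  have h1 := he.trans (min_le_left _ _)
  obtain ⟨γ, h2, h3, h4, h5⟩ := exists_contDiff_flow ht hE hN (by nlinarith) hXV
  exact ⟨⟨ht, hE, hN, h1.trans hη2, fun B hB => hdet B (hB.trans h1),
    fun B hB => (hdet' B (hB.trans (he.trans (min_le_right _ _)))).2, γ, h2, h3, h4, h5⟩⟩

namespace Flow

variable {d N : ℕ} {E : ℝ → Sp d → Sp d} {e t D : ℝ} {X V : ℝ → ℝ → Sp d → Sp d → Sp d}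
  (S : Flow N E e t D X V)

/-- The velocity deviation (with a minus sign). -/
def drag (p : Sp d × Sp d) : C(Icc (0 : ℝ) t, Sp d) :=
  backInt t S.time_nonneg (nem (fieldOn t S.field.regular) (S.path p))

/-- The displacement from free transport. -/
def disp (p : Sp d × Sp d) : C(Icc (0 : ℝ) t, Sp d) :=
  kick S.time_nonneg S.field.regular (S.path p)

/-- The velocity along the flow. -/
def vel (p : Sp d × Sp d) (s : Icc (0 : ℝ) t) : Sp d := p.2 - S.drag p s

/-- The size of the deviations from free transport. -/
def dev (_S : Flow N E e t D X V) (s : ℝ) : ℝ := e * flowConst N * (1 + s) ^ (-(7 / 4) : ℝ)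

lemma contDiff_drag : ContDiff ℝ N S.drag :=
  (backInt (G := Sp d) t S.time_nonneg).contDiff.comp
    ((contDiff_nem_fieldOn S.field.regular).comp S.contDiff_path)

lemma contDiff_disp : ContDiff ℝ N S.disp :=
  (contDiff_kick S.time_nonneg S.field.regular).comp S.contDiff_path

lemma path_apply (p : Sp d × Sp d) (s : Icc (0 : ℝ) t) :
    S.path p s = (p.1 - (t - s) • p.2) + S.disp p s :=
  congrArg (fun f => f s) (S.path_eq p)

lemma natCast_ne_zero (S : Flow N E e t D X V) : (N : WithTop ℕ∞) ≠ 0 := by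
  simpa using (Nat.one_le_iff_ne_zero.1 S.one_le)

lemma e_nonneg (S : Flow N E e t D X V) : 0 ≤ e := S.field.nonneg

lemma dev_nonneg {s : ℝ} (hs : 0 ≤ s) : 0 ≤ S.dev s := by
  have := S.e_nonneg
  have := two_le_flowConst N
  unfold dev
  have : 0 ≤ (1 + s) ^ (-(7 / 4) : ℝ) := Real.rpow_nonneg (by linarith) _
  positivity

lemma small_nonneg (S : Flow N E e t D X V) : 0 ≤ e * flowConst N := by
  have := S.e_nonneg
  have := two_le_flowConst N
  positivity

lemma dev_le_small {s : ℝ} (hs : 0 ≤ s) : S.dev s ≤ e * flowConst N :=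
  mul_le_of_le_one_right S.small_nonneg (rpow_weight_le_one hs (by norm_num))

lemma dev_le_half {s : ℝ} (hs : 0 ≤ s) : S.dev s ≤ 1 / 2 := (S.dev_le_small hs).trans S.small

lemma two_mul_le_dev {s : ℝ} (hs : 0 ≤ s) : 2 * e * (1 + s) ^ (-(7 / 4) : ℝ) ≤ S.dev s := by
  have := S.e_nonneg
  have := two_le_flowConst N
  unfold dev
  have : 0 ≤ (1 + s) ^ (-(7 / 4) : ℝ) := Real.rpow_nonneg (by linarith) _
  exact mul_le_mul_of_nonneg_right (by nlinarith) this

lemma norm_drag_le (p : Sp d × Sp d) (s : Icc (0 : ℝ) t) : ‖S.drag p s‖ ≤ S.dev s := by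
  have he := S.e_nonneg
  have := norm_backInt_le S.time_nonneg (by norm_num) he s (r := 11 / 4)
      (f := nem (fieldOn t S.field.regular) (S.path p)) fun σ hσ => S.field.norm_le σ.2.1 _
  refine this.trans (le_trans ?_ (S.two_mul_le_dev s.2.1))
  norm_num
  have : 0 ≤ (1 + (s : ℝ)) ^ (-(7 / 4) : ℝ) := Real.rpow_nonneg (by linarith [s.2.1]) _
  gcongr
  linarith

/-! ### The average velocity as a change of variables -/

section AverageVelocity

/-- The average velocity between the times `s` and `t`. -/
def avgVel (s : Icc (0 : ℝ) t) (x v : Sp d) : Sp d := (t - s : ℝ)⁻¹ • (x - S.path (x, v) s)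

/-- The derivative of the deviation of the average velocity. -/
def avgVelDeriv (s : Icc (0 : ℝ) t) (x v : Sp d) : Sp d →L[ℝ] Sp d :=
  -((t - s : ℝ)⁻¹ • fderiv ℝ (fun w => S.disp (x, w) s) v)

variable {s : Icc (0 : ℝ) t}

/-- This is the purpose of the average velocity: in terms of it, the true position at time `s` is
exactly a free position. -/
lemma path_eq_avgVel (hs : (s : ℝ) < t) (x v : Sp d) :
    S.path (x, v) s = x - (t - s) • S.avgVel s x v := by
  rw [avgVel, smul_smul, mul_inv_cancel₀ (by linarith), one_smul, sub_sub_cancel]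

lemma avgVel_eq (hs : (s : ℝ) < t) (x v : Sp d) :
    S.avgVel s x v = v - (t - s : ℝ)⁻¹ • S.disp (x, v) s := by
  rw [avgVel, S.path_apply]
  simp only
  rw [show x - (x - (t - (s : ℝ)) • v + S.disp (x, v) s)
    = (t - (s : ℝ)) • v - S.disp (x, v) s by abel, smul_sub, smul_smul,
    inv_mul_cancel₀ (by linarith), one_smul]

/-- The displacement vanishes like `t-s` near the final time, so dividing by `t-s` loses nothing,
even as `s` tends to `t`. -/
lemma norm_avgVel_sub_le (hs : (s : ℝ) < t) (x v : Sp d) : ‖S.avgVel s x v - v‖ ≤ S.dev s := by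
  have hts : 0 < t - (s : ℝ) := by linarith
  rw [S.avgVel_eq hs, sub_sub_cancel_left, norm_neg, norm_smul, norm_inv,
    Real.norm_of_nonneg hts.le, inv_mul_le_iff₀ hts]
  refine (norm_kick_le S.time_nonneg S.field _ s).trans ?_
  have := S.two_mul_le_dev s.2.1
  have h2 : 0 ≤ e * (1 + (s : ℝ)) ^ (-(7 / 4) : ℝ) :=
    mul_nonneg S.e_nonneg (Real.rpow_nonneg (by linarith [s.2.1]) _)
  gcongr
  linarith

lemma hasFDerivAt_avgVel (hs : (s : ℝ) < t) (x v : Sp d) :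
    HasFDerivAt (S.avgVel s x) (ContinuousLinearMap.id ℝ (Sp d) + S.avgVelDeriv s x v) v := by
  have h1 : ContDiff ℝ N fun w => S.disp (x, w) :=
    S.contDiff_disp.comp (contDiff_const.prodMk contDiff_id)
  have h2 := ((contDiff_eval h1 s).differentiable S.natCast_ne_zero v).hasFDerivAt
  have h3 : S.avgVel s x = fun w => w - (t - s : ℝ)⁻¹ • S.disp (x, w) s :=
    funext fun w => S.avgVel_eq hs x w
  rw [h3, avgVelDeriv, ← sub_eq_add_neg]
  exact (hasFDerivAt_id v).sub (h2.const_smul (t - s : ℝ)⁻¹)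

lemma norm_avgVelDeriv_le (hs : (s : ℝ) < t) (x v : Sp d) : ‖S.avgVelDeriv s x v‖ ≤ S.dev s := by
  have hts : 0 < t - (s : ℝ) := by linarith
  rw [avgVelDeriv, norm_neg, norm_smul, norm_inv, Real.norm_of_nonneg hts.le, inv_mul_le_iff₀ hts]
  have he : e ≤ 1 / 2 := by
    have := S.small
    have := S.e_nonneg
    have := two_le_flowConst N
    nlinarith
  refine (norm_fderiv_kick_le S.time_nonneg S.field S.one_le he S.contDiff_path S.path_eq
    x v s).trans ?_
  have := S.two_mul_le_dev s.2.1
  gcongr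

lemma norm_avgVelDeriv_le_half (hs : (s : ℝ) < t) (x v : Sp d) : ‖S.avgVelDeriv s x v‖ ≤ 1 / 2 :=
  (S.norm_avgVelDeriv_le hs x v).trans (S.dev_le_half s.2.1)

/-- The Jacobian of the average velocity. -/
def jac (s : Icc (0 : ℝ) t) (x v : Sp d) : ℝ :=
  |(ContinuousLinearMap.id ℝ (Sp d) + S.avgVelDeriv s x v).det|

lemma abs_jac_sub_one_le (hD : 0 ≤ D) (hs : (s : ℝ) < t) (x v : Sp d) :
    |S.jac s x v - 1| ≤ D * S.dev s := by
  have h := S.norm_avgVelDeriv_le hs x v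
  refine (S.det_bound _ (h.trans (S.dev_le_small s.2.1))).1.trans ?_
  gcongr

lemma half_le_jac (hs : (s : ℝ) < t) (x v : Sp d) : 1 / 2 ≤ S.jac s x v :=
  (S.det_bound _ ((S.norm_avgVelDeriv_le hs x v).trans (S.dev_le_small s.2.1))).2

lemma integral_avgVel {G : Type*} [NormedAddCommGroup G] [NormedSpace ℝ G] (hs : (s : ℝ) < t)
    (x : Sp d) (g : Sp d → G) :
    ∫ v, S.jac s x v • g (S.avgVel s x v) = ∫ u, g u :=
  integral_comp_perturbation volume (S.hasFDerivAt_avgVel hs x) (S.norm_avgVelDeriv_le_half hs x) g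

lemma integrable_avgVel {G : Type*} [NormedAddCommGroup G] [NormedSpace ℝ G] (hs : (s : ℝ) < t)
    (x : Sp d) {g : Sp d → G} (hg : Integrable g) :
    Integrable fun v => S.jac s x v • g (S.avgVel s x v) :=
  integrable_comp_perturbation volume (S.hasFDerivAt_avgVel hs x)
    (S.norm_avgVelDeriv_le_half hs x) hg

lemma lintegral_avgVel_le (hs : (s : ℝ) < t) (x : Sp d) (g : Sp d → ℝ≥0∞) :
    ∫⁻ v, g (S.avgVel s x v) ≤ 2 * ∫⁻ u, g u :=
  lintegral_comp_perturbation_le volume (S.hasFDerivAt_avgVel hs x)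
    (S.norm_avgVelDeriv_le_half hs x) (S.half_le_jac hs x) g

end AverageVelocity

/-! ### The moving frame -/

section Frame

/-- The frame `ζ ↦ (⟨t⟩ ζ, (t/⟨t⟩) ζ)` of initial data at time `t`. -/
def frame (d : ℕ) (t : ℝ) : Sp d →L[ℝ] Sp d × Sp d :=
  (jb t • ContinuousLinearMap.id ℝ (Sp d)).prod ((t / jb t) • ContinuousLinearMap.id ℝ (Sp d))

@[simp] lemma frame_apply (t : ℝ) (ζ : Sp d) : frame d t ζ = (jb t • ζ, (t / jb t) • ζ) := rfl

lemma jb_sq (t : ℝ) : jb t ^ 2 = 1 + t ^ 2 := Real.sq_sqrt (by positivity)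

lemma frame_coeff {t : ℝ} (s : ℝ) : jb t - (t - s) * (t / jb t) = (1 + t * s) / jb t := by
  have h1 : jb t ≠ 0 := (zero_lt_one.trans_le (one_le_jb t)).ne'
  field_simp
  rw [jb_sq]
  ring

/-- The free position has coefficient `(1+ts)/⟨t⟩` by `frame_coeff`, and `⟨t⟩` dominates both `1`
and `t`. The slope `t/⟨t⟩` in velocity is chosen for this: at early times it cancels most of the
spatial factor `⟨t⟩`. -/
lemma norm_freePath_frame_le {t : ℝ} (s : Icc (0 : ℝ) t) (ζ : Sp d) :
    ‖freePath d t (frame d t ζ) s‖ ≤ (1 + s) * ‖ζ‖ := by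
  have hs := s.2.1
  have ht : 0 ≤ t := hs.trans s.2.2
  have h1 : 0 < jb t := zero_lt_one.trans_le (one_le_jb t)
  have h2 : freePath d t (frame d t ζ) s = ((1 + t * s) / jb t) • ζ := by
    rw [← frame_coeff, sub_smul, mul_smul]
    rfl
  rw [h2, norm_smul, Real.norm_of_nonneg (by positivity)]
  gcongr
  rw [div_le_iff₀ h1]
  nlinarith [le_jb t, one_le_jb t]

lemma norm_iteratedFDeriv_frame_le (c : Sp d × Sp d) {k : ℕ} (hk : k ≤ N) (s : Icc (0 : ℝ) t)
    (ζ : Sp d) :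
    ‖iteratedFDeriv ℝ k (fun ζ => S.drag (c + frame d t ζ) s) ζ‖ ≤ S.dev s ∧
    ‖iteratedFDeriv ℝ k (fun ζ => S.disp (c + frame d t ζ) s) ζ‖ ≤ (1 + s) * S.dev s := by
  have h := norm_iteratedFDeriv_deviation_le S.time_nonneg S.field
    (S.small.trans (by norm_num)) S.contDiff_path S.path_eq c (frame d t) norm_freePath_frame_le
    hk s ζ
  refine ⟨h.1, h.2.trans_eq ?_⟩
  have hs : (0 : ℝ) ≤ 1 + s := by linarith [s.2.1]
  rw [dev, mul_left_comm, ← Real.rpow_one_add' hs (by norm_num)]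
  norm_num

end Frame

/-! ### Near volume preservation of the flow to time zero -/

section PhaseSpace

/-- The flow map from time `t` to time `0`. -/
def phaseMap (p : Sp d × Sp d) : Sp d × Sp d :=
  (S.path p ⟨0, le_rfl, S.time_nonneg⟩, S.vel p ⟨0, le_rfl, S.time_nonneg⟩)

/-- Free transport from time `0` to time `t`. -/
def shear (d : ℕ) (t : ℝ) : Sp d × Sp d →L[ℝ] Sp d × Sp d :=
  (ContinuousLinearMap.fst ℝ (Sp d) (Sp d) + t • ContinuousLinearMap.snd ℝ (Sp d) (Sp d)).prod
    (ContinuousLinearMap.snd ℝ (Sp d) (Sp d))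

@[simp] lemma shear_apply (t : ℝ) (p : Sp d × Sp d) : shear d t p = (p.1 + t • p.2, p.2) := rfl

lemma norm_freePath_shear_le (s : Icc (0 : ℝ) t) (p : Sp d × Sp d) :
    ‖freePath d t (shear d t p) s‖ ≤ (1 + s) * ‖p‖ := by
  have hs := s.2.1
  have h2 : freePath d t (shear d t p) s = p.1 + (s : ℝ) • p.2 := by
    rw [freePath_apply, shear_apply]
    module
  rw [h2]
  calc _ ≤ ‖p.1‖ + s * ‖p.2‖ := by
        refine (norm_add_le _ _).trans ?_
        rw [norm_smul, Real.norm_of_nonneg hs]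
    _ ≤ ‖p‖ + s * ‖p‖ := by
        gcongr
        exacts [norm_fst_le p, norm_snd_le p]
    _ = _ := by ring

instance : (volume : Measure (Sp d × Sp d)).IsAddHaarMeasure :=
  inferInstanceAs ((volume : Measure (Sp d)).prod (volume : Measure (Sp d))).IsAddHaarMeasure

lemma measurePreserving_shear (t : ℝ) :
    MeasurePreserving (shear d t) volume volume := by
  have h1 : MeasurePreserving (fun p : Sp d × Sp d => (p.1, p.2 + t • p.1)) volume volume := by
    refine (MeasurePreserving.id volume).skew_product (g := fun v x => x + t • v)
      (by fun_prop) (ae_of_all _ fun v => ?_)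
    exact map_add_right_eq_self _ _
  have h2 := (Measure.measurePreserving_swap (μ := (volume : Measure (Sp d)))
    (ν := (volume : Measure (Sp d))))
  exact (h2.comp h1).comp h2

lemma shear_neg_shear (t : ℝ) (p : Sp d × Sp d) : shear d t (shear d (-t) p) = p := by
  simp

/-- The derivative of the deviation of the flow map, after free transport. -/
def phaseDeriv (p : Sp d × Sp d) : Sp d × Sp d →L[ℝ] Sp d × Sp d :=
  -- The summand `0` gives the argument the shape `c + L q` of the frame estimates.
  (fderiv ℝ (fun q => S.disp (0 + shear d t q) ⟨0, le_rfl, S.time_nonneg⟩) p).prod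
    (-fderiv ℝ (fun q => S.drag (0 + shear d t q) ⟨0, le_rfl, S.time_nonneg⟩) p)

lemma hasFDerivAt_phaseMap_shear (p : Sp d × Sp d) :
    HasFDerivAt (fun q => S.phaseMap (shear d t q))
      (ContinuousLinearMap.id ℝ (Sp d × Sp d) + S.phaseDeriv p) p := by
  have h1 : ContDiff ℝ N fun q => S.disp (0 + shear d t q) :=
    S.contDiff_disp.comp (contDiff_const.add (shear d t).contDiff)
  have h2 : ContDiff ℝ N fun q => S.drag (0 + shear d t q) :=
    S.contDiff_drag.comp (contDiff_const.add (shear d t).contDiff)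
  have h3 := ((contDiff_eval h1 ⟨0, le_rfl, S.time_nonneg⟩).differentiable
    S.natCast_ne_zero p).hasFDerivAt
  have h4 := ((contDiff_eval h2 ⟨0, le_rfl, S.time_nonneg⟩).differentiable
    S.natCast_ne_zero p).hasFDerivAt
  have h5 := (hasFDerivAt_id (𝕜 := ℝ) p).add (h3.prodMk h4.neg)
  refine h5.congr_of_eventuallyEq (Filter.Eventually.of_forall fun q => ?_)
  simp only [phaseMap, vel, S.path_apply, zero_add, shear_apply, sub_zero, add_sub_cancel_right,
    Pi.add_apply, id, Pi.neg_apply]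
  ext1 <;> simp [sub_eq_add_neg]

lemma norm_phaseDeriv_le (p : Sp d × Sp d) : ‖S.phaseDeriv p‖ ≤ e * flowConst N := by
  have h := norm_iteratedFDeriv_deviation_le S.time_nonneg S.field
    (S.small.trans (by norm_num)) S.contDiff_path S.path_eq 0 (shear d t) norm_freePath_shear_le
    S.one_le ⟨0, le_rfl, S.time_nonneg⟩ p
  simp only [norm_iteratedFDeriv_one, add_zero, Real.one_rpow, mul_one] at h
  refine ContinuousLinearMap.opNorm_le_bound _ S.small_nonneg fun q => ?_
  refine max_le ?_ ?_
  · exact ContinuousLinearMap.le_of_opNorm_le _ h.2 q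
  · refine ContinuousLinearMap.le_of_opNorm_le _ ?_ q
    rw [norm_neg]
    exact h.1

lemma phaseMap_eq_comp : S.phaseMap = (fun q => S.phaseMap (shear d t q)) ∘ shear d (-t) := by
  ext1 p
  simp only [Function.comp_apply, shear_neg_shear]

/-- The flow map is a near-identity map composed with a volume-preserving shear. The lower Jacobian
bound `1/2` supplies the factor `2`, which suffices in place of exact preservation of volume. -/
theorem lintegral_phaseMap_le (g : Sp d × Sp d → ℝ≥0∞) :
    ∫⁻ p, g (S.phaseMap p) ≤ 2 * ∫⁻ p, g p := by
  have hB := fun p => (S.norm_phaseDeriv_le p).trans S.small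
  have hdet := fun p => S.det_bound_phase _ (S.norm_phaseDeriv_le p)
  rw [phaseMap_eq_comp]
  simp only [Function.comp_apply]
  rw [(measurePreserving_shear (-t)).lintegral_comp_emb
    (f := fun q => g (S.phaseMap (shear d t q))) ?_ ]
  · exact lintegral_comp_perturbation_le volume S.hasFDerivAt_phaseMap_shear hB hdet g
  · refine (shear d (-t)).continuous.measurableEmbedding fun p q hpq => ?_
    simp only [shear_apply, Prod.mk.injEq] at hpq
    obtain ⟨h1, h2⟩ := hpq
    rw [h2, add_left_inj] at h1
    exact Prod.ext h1 h2

lemma quasiMeasurePreserving_phaseMap :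
    Measure.QuasiMeasurePreserving S.phaseMap volume volume := by
  have hB := fun p => (S.norm_phaseDeriv_le p).trans S.small
  have hdet := fun p => S.det_bound_phase _ (S.norm_phaseDeriv_le p)
  have hq := quasiMeasurePreserving_perturbation volume S.hasFDerivAt_phaseMap_shear hB hdet
  rw [phaseMap_eq_comp]
  exact hq.comp (measurePreserving_shear (-t)).quasiMeasurePreserving

end PhaseSpace

end Flow

end VlasovForcing

namespace VlasovForcing

/-! ### Jets of the integrand as a function on phase space -/

section Density

variable {d N : ℕ} {E : ℝ → Sp d → Sp d} {e : ℝ}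

/-- The sum of the rescaled derivatives of the field. -/
def env (N : ℕ) (E : ℝ → Sp d → Sp d) (s : ℝ) (x : Sp d) : ℝ :=
  ∑ i ∈ Finset.range (N + 1), (1 + s) ^ i * ‖iteratedFDeriv ℝ i (E s) x‖

lemma env_nonneg {s : ℝ} (hs : 0 ≤ s) (x : Sp d) : 0 ≤ env N E s x :=
  Finset.sum_nonneg fun i _ => by positivity

lemma le_env {s : ℝ} (hs : 0 ≤ s) (x : Sp d) {i : ℕ} (hi : i ≤ N) :
    (1 + s) ^ i * ‖iteratedFDeriv ℝ i (E s) x‖ ≤ env N E s x :=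
  Finset.single_le_sum (f := fun i => (1 + s) ^ i * ‖iteratedFDeriv ℝ i (E s) x‖)
    (fun i _ => by positivity) (by simp; omega)

lemma env_le (h : FieldBound N e E) {s : ℝ} (hs : 0 ≤ s) (x : Sp d) :
    env N E s x ≤ (N + 1) * e := by
  refine (Finset.sum_le_card_nsmul _ _ e fun i hi => ?_).trans_eq (by simp)
  refine (h.bound s hs i (by simpa [Nat.lt_succ_iff] using hi) x).trans ?_
  exact mul_le_of_le_one_right h.nonneg (rpow_weight_le_one hs (by norm_num))

lemma continuousOn_env (hE : FieldRegular N E) :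
    ContinuousOn (fun p : ℝ × Sp d => env N E p.1 p.2) (Ici 0 ×ˢ univ) := by
  unfold env
  refine continuousOn_finsetSum _ fun i hi => ?_
  exact ((continuous_const.add continuous_fst).pow i).continuousOn.mul
    (hE.2 i (by simpa [Nat.lt_succ_iff] using hi)).norm

/-- The product of a covector density in velocity and the rescaled field in position. -/
def density (E : ℝ → Sp d → Sp d) (g : Sp d → Sp d →L[ℝ] ℝ) (s : ℝ) (p : Sp d × Sp d) : ℝ :=
  g p.2 (E s ((1 + s) • p.1))

variable {g : Sp d → Sp d →L[ℝ] ℝ}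

lemma contDiff_density (hE : FieldRegular N E) (hg : ContDiff ℝ N g) {s : ℝ} (hs : 0 ≤ s) :
    ContDiff ℝ N (density E g s) :=
  (hg.comp contDiff_snd).clm_apply ((hE.1 s hs).comp (contDiff_fst.const_smul _))

lemma norm_iteratedFDeriv_density_le (hE : FieldRegular N E) (hg : ContDiff ℝ N g) {s : ℝ}
    (hs : 0 ≤ s) (p : Sp d × Sp d) {j : ℕ} (hj : j ≤ N) {κ : ℝ}
    (hκ : ∀ i, i ≤ N → ‖iteratedFDeriv ℝ i g p.2‖ ≤ κ) :
    ‖iteratedFDeriv ℝ j (density E g s) p‖ ≤ 2 ^ N * (κ * env N E s ((1 + s) • p.1)) := by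
  have hκ0 : 0 ≤ κ := (norm_nonneg _).trans (hκ 0 (Nat.zero_le _))
  have hs1 : (0 : ℝ) ≤ 1 + s := by linarith
  have henv := env_nonneg (N := N) (E := E) hs ((1 + s) • p.1)
  have h1 : ∀ i, i ≤ N → ‖iteratedFDeriv ℝ i (fun q : Sp d × Sp d => g q.2) p‖ ≤ κ := by
    intro i hi
    have := norm_iteratedFDeriv_comp_affine_le hg 0 (ContinuousLinearMap.snd ℝ (Sp d) (Sp d)) hi p
    simp only [zero_add, ContinuousLinearMap.coe_snd'] at this
    refine this.trans ((mul_le_of_le_one_right (norm_nonneg _)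
      (pow_le_one₀ (norm_nonneg _) (ContinuousLinearMap.norm_snd_le _ _ _))).trans (hκ i hi))
  have h2 : ∀ i, i ≤ N → ‖iteratedFDeriv ℝ i (fun q : Sp d × Sp d => E s ((1 + s) • q.1)) p‖
      ≤ env N E s ((1 + s) • p.1) := by
    intro i hi
    have h3 : ContDiff ℝ N fun y => E s ((1 + s) • y) := (hE.1 s hs).comp (contDiff_const_smul _)
    have := norm_iteratedFDeriv_comp_affine_le h3 0 (ContinuousLinearMap.fst ℝ (Sp d) (Sp d)) hi p
    simp only [zero_add, ContinuousLinearMap.coe_fst'] at this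
    refine this.trans ((mul_le_of_le_one_right (norm_nonneg _)
      (pow_le_one₀ (norm_nonneg _) (ContinuousLinearMap.norm_fst_le _ _ _))).trans ?_)
    exact (norm_iteratedFDeriv_comp_smul_le (hE.1 s hs) hs1 hi _).trans (le_env hs _ hi)
  refine (norm_iteratedFDeriv_clm_apply (hg.comp contDiff_snd)
    ((hE.1 s hs).comp (contDiff_fst.const_smul _)) p (n := j) (by exact_mod_cast hj)).trans ?_
  calc ∑ i ∈ Finset.range (j + 1), (j.choose i : ℝ) *
        ‖iteratedFDeriv ℝ i (g ∘ Prod.snd) p‖ *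
        ‖iteratedFDeriv ℝ (j - i) (E s ∘ fun q : Sp d × Sp d => (1 + s) • q.1) p‖
      ≤ ∑ i ∈ Finset.range (j + 1), (j.choose i : ℝ) * (κ * env N E s ((1 + s) • p.1)) := by
        refine Finset.sum_le_sum fun i hi => ?_
        have hi' : i ≤ j := by simpa [Nat.lt_succ_iff] using hi
        rw [mul_assoc]
        refine mul_le_mul_of_nonneg_left ?_ (by positivity)
        exact mul_le_mul (h1 i (hi'.trans hj)) (h2 (j - i) ((Nat.sub_le _ _).trans hj))
          (norm_nonneg _) hκ0
    _ = 2 ^ j * (κ * env N E s ((1 + s) • p.1)) := by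
        rw [← Finset.sum_mul]
        congr 1
        exact_mod_cast Nat.sum_range_choose j
    _ ≤ _ := by
        gcongr
        norm_num

/-- Translating the velocity argument amounts to translating `g`. A difference of jets at two
velocities is thus one jet with `g` differenced, and the order of differentiation of the field does
not increase. -/
lemma iteratedFDeriv_density_sub (hE : FieldRegular N E) (hg : ContDiff ℝ N g) {s : ℝ}
    (hs : 0 ≤ s) (y w w' : Sp d) {j : ℕ} (hj : j ≤ N) :
    iteratedFDeriv ℝ j (density E g s) (y, w) - iteratedFDeriv ℝ j (density E g s) (y, w')
      = iteratedFDeriv ℝ j (density E (fun z => g z - g (z + (w' - w))) s) (y, w) := by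
  have hg' : ContDiff ℝ N fun z => g (z + (w' - w)) := hg.comp (contDiff_id.add contDiff_const)
  have h1 : density E (fun z => g z - g (z + (w' - w))) s
      = density E g s - density E (fun z => g (z + (w' - w))) s := by
    ext1 p
    simp [density]
  have h2 : density E (fun z => g (z + (w' - w))) s = fun p => density E g s (p + (0, w' - w)) := by
    ext1 p
    simp [density]
  have hj' : (j : WithTop ℕ∞) ≤ N := by exact_mod_cast hj
  rw [h1, iteratedFDeriv_sub_apply ((contDiff_density hE hg hs).of_le hj').contDiffAt
    ((contDiff_density hE hg' hs).of_le hj').contDiffAt, h2, iteratedFDeriv_comp_add_right]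
  simp

/-- The mean value inequality on the segment joining the velocities uses one additional derivative
of `g`; this is the source of the order `N + 1`. -/
lemma norm_iteratedFDeriv_density_sub_le (hE : FieldRegular N E) (hg : ContDiff ℝ (N + 1 : ℕ) g)
    {s : ℝ} (hs : 0 ≤ s) (y w w' : Sp d) {j : ℕ} (hj : j ≤ N) {κ : ℝ}
    (hκ : ∀ i, i ≤ N + 1 → ∀ z ∈ segment ℝ w w', ‖iteratedFDeriv ℝ i g z‖ ≤ κ) :
    ‖iteratedFDeriv ℝ j (density E g s) (y, w) - iteratedFDeriv ℝ j (density E g s) (y, w')‖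
      ≤ 2 ^ N * (κ * ‖w - w'‖ * env N E s ((1 + s) • y)) := by
  have hgN : ContDiff ℝ N g := hg.of_le (by exact_mod_cast N.le_succ)
  have hg' : ContDiff ℝ N fun z => g (z + (w' - w)) := hgN.comp (contDiff_id.add contDiff_const)
  rw [iteratedFDeriv_density_sub hE hgN hs y w w' hj]
  refine norm_iteratedFDeriv_density_le hE (hgN.sub hg') hs (y, w) hj fun i hi => ?_
  have hi' : (i : WithTop ℕ∞) ≤ N := by exact_mod_cast hi
  have h1 : iteratedFDeriv ℝ i (fun z => g z - g (z + (w' - w))) w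
      = iteratedFDeriv ℝ i g w - iteratedFDeriv ℝ i g w' := by
    have : (fun z => g z - g (z + (w' - w))) = g - fun z => g (z + (w' - w)) := rfl
    rw [this, iteratedFDeriv_sub_apply (hgN.of_le hi').contDiffAt (hg'.of_le hi').contDiffAt,
      iteratedFDeriv_comp_add_right]
    simp
  simp only
  rw [h1]
  refine (convex_segment w w').norm_image_sub_le_of_norm_fderiv_le (𝕜 := ℝ)
    (fun z _ => hg.differentiable_iteratedFDeriv (by exact_mod_cast Nat.lt_succ_of_le hi) z)
    (fun z hz => ?_) (right_mem_segment ℝ w w') (left_mem_segment ℝ w w')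
  rw [fderiv_iteratedFDeriv_eq, LinearIsometryEquiv.norm_map]
  exact hκ (i + 1) (by omega) z hz

lemma iteratedFDeriv_affine_eq {P G : Type*} [NormedAddCommGroup P] [NormedSpace ℝ P]
    [NormedAddCommGroup G] [NormedSpace ℝ G] (a : G) (A : P →L[ℝ] G) {i : ℕ} (hi : 1 ≤ i) (p : P) :
    iteratedFDeriv ℝ i (fun q => a + A q) p = iteratedFDeriv ℝ i A p := by
  have h1 : (fun q => a + A q) = (fun _ : P => a) + (A : P → G) := rfl
  rw [h1, iteratedFDeriv_add_apply contDiff_const.contDiffAt A.contDiff.contDiffAt,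
    iteratedFDeriv_const_of_ne (by omega)]
  simp

end Density

/-! ### Comparison of jets along free and true trajectories -/

namespace Flow

variable {d N : ℕ} {E : ℝ → Sp d → Sp d} {e t D : ℝ} {X V : ℝ → ℝ → Sp d → Sp d → Sp d}
  (S : Flow N E e t D X V)

/-- The rescaled phase-space trajectory in the frame of initial data based at `c`. -/
def traj (s : Icc (0 : ℝ) t) (c : Sp d × Sp d) (ζ : Sp d) : Sp d × Sp d :=
  ((1 + s : ℝ)⁻¹ • S.path (c + frame d t ζ) s, S.vel (c + frame d t ζ) s)

/-- The rescaled free trajectory in the frame of initial data based at `c`. -/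
def freeTraj (s : Icc (0 : ℝ) t) (c : Sp d × Sp d) (ζ : Sp d) : Sp d × Sp d :=
  ((1 + s : ℝ)⁻¹ • freePath d t (c + frame d t ζ) s, (c + frame d t ζ).2)

/-- The linear part of the free trajectory. -/
def freeTrajL (s : Icc (0 : ℝ) t) : Sp d →L[ℝ] Sp d × Sp d :=
  ((1 + s : ℝ)⁻¹ • (evalL s).comp ((freePath d t).comp (frame d t))).prod
    ((ContinuousLinearMap.snd ℝ (Sp d) (Sp d)).comp (frame d t))

lemma freeTraj_eq (s : Icc (0 : ℝ) t) (c : Sp d × Sp d) :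
    freeTraj s c = fun ζ => freeTraj s c 0 + freeTrajL s ζ := by
  ext1 ζ
  simp only [freeTraj, freeTrajL, map_add, map_zero, add_zero, ContinuousMap.add_apply, smul_add]
  rfl

lemma norm_freeTrajL_le (s : Icc (0 : ℝ) t) : ‖freeTrajL (d := d) s‖ ≤ 1 := by
  have hs : (0 : ℝ) < 1 + s := by linarith [s.2.1]
  have ht : 0 ≤ t := s.2.1.trans s.2.2
  have h1 : 0 < jb t := zero_lt_one.trans_le (one_le_jb t)
  refine ContinuousLinearMap.opNorm_le_bound _ zero_le_one fun ζ => ?_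
  rw [one_mul]
  refine max_le ?_ ?_
  · change ‖(1 + s : ℝ)⁻¹ • freePath d t (frame d t ζ) s‖ ≤ ‖ζ‖
    rw [norm_smul, norm_inv, Real.norm_of_nonneg hs.le, inv_mul_le_iff₀ hs]
    exact norm_freePath_frame_le s ζ
  · change ‖(t / jb t) • ζ‖ ≤ ‖ζ‖
    rw [norm_smul, Real.norm_of_nonneg (by positivity)]
    refine mul_le_of_le_one_left (norm_nonneg _) ?_
    rw [div_le_one h1]
    exact le_jb t

lemma contDiff_freeTraj (s : Icc (0 : ℝ) t) (c : Sp d × Sp d) {n : WithTop ℕ∞} :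
    ContDiff ℝ n (freeTraj s c) := by
  rw [freeTraj_eq]
  exact contDiff_const.add (freeTrajL s).contDiff

lemma contDiff_path_frame (c : Sp d × Sp d) : ContDiff ℝ N fun ζ => S.path (c + frame d t ζ) :=
  S.contDiff_path.comp (contDiff_const.add (frame d t).contDiff)

lemma contDiff_disp_frame (c : Sp d × Sp d) : ContDiff ℝ N fun ζ => S.disp (c + frame d t ζ) :=
  S.contDiff_disp.comp (contDiff_const.add (frame d t).contDiff)

lemma contDiff_drag_frame (c : Sp d × Sp d) : ContDiff ℝ N fun ζ => S.drag (c + frame d t ζ) :=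
  S.contDiff_drag.comp (contDiff_const.add (frame d t).contDiff)

lemma contDiff_traj (s : Icc (0 : ℝ) t) (c : Sp d × Sp d) : ContDiff ℝ N (S.traj s c) := by
  refine ContDiff.prodMk ((contDiff_eval (S.contDiff_path_frame c) s).const_smul _) ?_
  exact ((contDiff_snd.comp (contDiff_const.add (frame d t).contDiff))).sub
    (contDiff_eval (S.contDiff_drag_frame c) s)

lemma norm_iteratedFDeriv_freeTraj_le (s : Icc (0 : ℝ) t) (c : Sp d × Sp d) {i : ℕ} (hi : 1 ≤ i)
    (ζ : Sp d) : ‖iteratedFDeriv ℝ i (freeTraj s c) ζ‖ ≤ 1 := by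
  rw [freeTraj_eq]
  exact (norm_iteratedFDeriv_affine_le _ _ hi ζ).trans (norm_freeTrajL_le s)

/-- The free trajectory is affine in `ζ` with linear part independent of the base point. This
matters because the linear and the nonlinear integrands are compared at different base points. -/
lemma iteratedFDeriv_freeTraj_eq (s : Icc (0 : ℝ) t) (c c' : Sp d × Sp d) {i : ℕ} (hi : 1 ≤ i)
    (ζ : Sp d) :
    iteratedFDeriv ℝ i (freeTraj s c) ζ = iteratedFDeriv ℝ i (freeTraj s c') ζ := by
  rw [freeTraj_eq s c, freeTraj_eq s c', iteratedFDeriv_affine_eq _ _ hi,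
    iteratedFDeriv_affine_eq _ _ hi]

/-- Dividing positions by `1+s` reduces the displacement, of size `(1+s) * S.dev s`, to the size of
the velocity deviation. -/
lemma norm_iteratedFDeriv_traj_sub_le (s : Icc (0 : ℝ) t) (c : Sp d × Sp d) {i : ℕ}
    (hi : i ≤ N) (ζ : Sp d) :
    ‖iteratedFDeriv ℝ i (freeTraj s c) ζ - iteratedFDeriv ℝ i (S.traj s c) ζ‖ ≤ S.dev s := by
  have hs : (0 : ℝ) < 1 + s := by linarith [s.2.1]
  have hi' : (i : WithTop ℕ∞) ≤ N := by exact_mod_cast hi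
  have h1 := S.norm_iteratedFDeriv_frame_le c hi s ζ
  have hc1 : ContDiff ℝ N fun ζ => -((1 + s : ℝ)⁻¹ • S.disp (c + frame d t ζ) s) :=
    ((contDiff_eval (S.contDiff_disp_frame c) s).const_smul _).neg
  have hc2 : ContDiff ℝ N fun ζ => S.drag (c + frame d t ζ) s :=
    contDiff_eval (S.contDiff_drag_frame c) s
  rw [← iteratedFDeriv_sub_apply (contDiff_freeTraj s c).contDiffAt
    ((S.contDiff_traj s c).of_le hi').contDiffAt]
  have h2 : freeTraj s c - S.traj s c = fun ζ => (-((1 + s : ℝ)⁻¹ • S.disp (c + frame d t ζ) s),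
      S.drag (c + frame d t ζ) s) := by
    ext1 ζ
    simp only [Pi.sub_apply, freeTraj, traj, vel, S.path_apply, freePath_apply, smul_add]
    ext1 <;> simp
  rw [h2, iteratedFDeriv_prodMk hc1.contDiffAt hc2.contDiffAt hi']
  rw [ContinuousMultilinearMap.opNorm_prod]
  refine max_le ?_ h1.1
  have h3 : iteratedFDeriv ℝ i (fun ζ => -((1 + s : ℝ)⁻¹ • S.disp (c + frame d t ζ) s)) ζ
      = (-(1 + s : ℝ)⁻¹) • iteratedFDeriv ℝ i (fun ζ => S.disp (c + frame d t ζ) s) ζ := by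
    simp only [← neg_smul]
    exact iteratedFDeriv_const_smul_apply'
      ((contDiff_eval (S.contDiff_disp_frame c) s).of_le hi').contDiffAt
  rw [h3, norm_smul, norm_neg, norm_inv, Real.norm_of_nonneg hs.le, inv_mul_le_iff₀ hs]
  exact h1.2

lemma norm_iteratedFDeriv_traj_le (s : Icc (0 : ℝ) t) (c : Sp d × Sp d) {i : ℕ} (h1 : 1 ≤ i)
    (hi : i ≤ N) (ζ : Sp d) : ‖iteratedFDeriv ℝ i (S.traj s c) ζ‖ ≤ 2 := by
  have h2 := norm_iteratedFDeriv_freeTraj_le s c h1 ζ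
  have h3 := S.norm_iteratedFDeriv_traj_sub_le s c hi ζ
  have h4 := S.dev_le_half s.2.1
  have h5 := norm_sub_norm_le (iteratedFDeriv ℝ i (S.traj s c) ζ)
    (iteratedFDeriv ℝ i (freeTraj s c) ζ)
  rw [norm_sub_rev] at h5
  linarith

/-- A constant for the Faà di Bruno estimates of order at most `N`. -/
def faaConst (N : ℕ) : ℝ :=
  ∑ k ∈ Finset.range (N + 1), Fintype.card (OrderedFinpartition k) * ((k + 1) * 2 ^ k)

lemma le_faaConst {k : ℕ} (hk : k ≤ N) :
    Fintype.card (OrderedFinpartition k) * (((k : ℝ) + 1) * 2 ^ k) ≤ faaConst N :=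
  Finset.single_le_sum (f := fun k : ℕ =>
    (Fintype.card (OrderedFinpartition k) : ℝ) * (((k : ℝ) + 1) * 2 ^ k))
    (fun i _ => by positivity) (by simp; omega)

lemma le_faaConst' {k : ℕ} (hk : k ≤ N) :
    Fintype.card (OrderedFinpartition k) * (2 : ℝ) ^ k ≤ faaConst N := by
  refine le_trans ?_ (le_faaConst hk)
  gcongr
  exact le_mul_of_one_le_left (by positivity) (by linarith [(Nat.cast_nonneg k : (0 : ℝ) ≤ k)])

lemma faaConst_nonneg (N : ℕ) : 0 ≤ faaConst N := Finset.sum_nonneg fun i _ => by positivity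

variable {g : Sp d → Sp d →L[ℝ] ℝ} {κ : ℝ}

lemma norm_sub_le_one_of_le {w v : Sp d} {s : ℝ} (hs : 0 ≤ s) (h : ‖w - v‖ ≤ S.dev s) :
    ‖w - v‖ ≤ 1 := h.trans ((S.dev_le_half hs).trans (by norm_num))

lemma norm_vel_sub_le (p : Sp d × Sp d) (s : Icc (0 : ℝ) t) : ‖S.vel p s - p.2‖ ≤ S.dev s := by
  rw [vel, sub_sub_cancel_left, norm_neg]
  exact S.norm_drag_le p s

/-- The derivatives of the nonlinear integrand are bounded by the envelope of the field. -/
lemma norm_iteratedFDeriv_density_traj_le (hg : ContDiff ℝ N g)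
    (hκ : ∀ i, i ≤ N → ∀ v, ‖iteratedFDeriv ℝ i g v‖ ≤ κ * wt d v) (hκ0 : 0 ≤ κ)
    (s : Icc (0 : ℝ) t) (c : Sp d × Sp d) {k : ℕ} (hk : k ≤ N) (ζ : Sp d) :
    ‖iteratedFDeriv ℝ k (density E g s ∘ S.traj s c) ζ‖
      ≤ faaConst N * (2 ^ N * ((κ * (2 ^ ((d : ℝ) + 1) * wt d (c + frame d t ζ).2))
        * env N E s (S.path (c + frame d t ζ) s))) := by
  have hk' : (k : WithTop ℕ∞) ≤ N := by exact_mod_cast hk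
  have hs0 : (1 + s : ℝ) ≠ 0 := by linarith [s.2.1]
  have hcd := contDiff_density S.field.regular hg s.2.1
  have h1 := iteratedFDeriv_comp (hcd.contDiffAt (x := S.traj s c ζ))
    (S.contDiff_traj s c).contDiffAt hk'
  rw [h1]
  refine (norm_taylorComp_le _ _ k (Q := 2 ^ N * ((κ * (2 ^ ((d : ℝ) + 1) *
    wt d (c + frame d t ζ).2)) * env N E s (S.path (c + frame d t ζ) s))) (fun j hj => ?_)
    fun i hi hik => S.norm_iteratedFDeriv_traj_le s c hi (hik.trans hk) ζ).trans ?_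
  · have h3 := norm_iteratedFDeriv_density_le S.field.regular hg s.2.1 (S.traj s c ζ)
      (hj.trans hk) (κ := κ * (2 ^ ((d : ℝ) + 1) * wt d (c + frame d t ζ).2)) fun i hi => by
        refine (hκ i hi _).trans ?_
        gcongr
        exact wt_le_of_norm_sub_le (S.norm_sub_le_one_of_le s.2.1 (S.norm_vel_sub_le _ s))
    simpa only [ftaylorSeries, traj, smul_smul, mul_inv_cancel₀ hs0, one_smul] using h3
  · have := wt_nonneg (c + frame d t ζ).2
    have := env_nonneg (N := N) (E := E) s.2.1 (S.path (c + frame d t ζ) s)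
    exact mul_le_mul_of_nonneg_right (le_faaConst' hk) (by positivity)

/-- The derivatives of the linear integrand are bounded by the envelope of the field. -/
lemma norm_iteratedFDeriv_density_freeTraj_le (hE : FieldRegular N E) (hg : ContDiff ℝ N g)
    (hκ : ∀ i, i ≤ N → ∀ v, ‖iteratedFDeriv ℝ i g v‖ ≤ κ * wt d v)
    (s : Icc (0 : ℝ) t) (c : Sp d × Sp d) {k : ℕ} (hk : k ≤ N) (ζ : Sp d) :
    ‖iteratedFDeriv ℝ k (density E g s ∘ freeTraj s c) ζ‖
      ≤ faaConst N * (2 ^ N * ((κ * wt d (c + frame d t ζ).2)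
        * env N E s (freePath d t (c + frame d t ζ) s))) := by
  have hk' : (k : WithTop ℕ∞) ≤ N := by exact_mod_cast hk
  have hs0 : (1 + s : ℝ) ≠ 0 := by linarith [s.2.1]
  have hcd := contDiff_density hE hg s.2.1
  have h1 := iteratedFDeriv_comp (hcd.contDiffAt (x := freeTraj s c ζ))
    (contDiff_freeTraj s c).contDiffAt hk'
  have hκw : 0 ≤ κ * wt d (c + frame d t ζ).2 :=
    (norm_nonneg _).trans (hκ 0 (Nat.zero_le _) _)
  rw [h1]
  refine (norm_taylorComp_le _ _ k (Q := 2 ^ N * ((κ * wt d (c + frame d t ζ).2)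
    * env N E s (freePath d t (c + frame d t ζ) s))) (fun j hj => ?_)
    fun i hi hik => (norm_iteratedFDeriv_freeTraj_le s c hi ζ).trans (by norm_num)).trans ?_
  · have h3 := norm_iteratedFDeriv_density_le hE hg s.2.1 (freeTraj s c ζ)
      (hj.trans hk) (κ := κ * wt d (c + frame d t ζ).2) fun i hi => hκ i hi _
    simpa only [ftaylorSeries, freeTraj, smul_smul, mul_inv_cancel₀ hs0, one_smul] using h3
  · have := env_nonneg (N := N) (E := E) s.2.1 (freePath d t (c + frame d t ζ) s)
    exact mul_le_mul_of_nonneg_right (le_faaConst' hk) (by positivity)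

/-- Jets of the linear and of the nonlinear integrands at matching positions. -/
lemma norm_density_jets_sub_le (hg : ContDiff ℝ (N + 1 : ℕ) g) {s : Icc (0 : ℝ) t}
    {c₀ c : Sp d × Sp d} {y a w ζ : Sp d} (hp₀ : freeTraj s c₀ ζ = (y, a))
    (hp : S.traj s c ζ = (y, w)) (haw : ‖a - w‖ ≤ 2 * S.dev s)
    (hb : ∀ i, i ≤ N + 1 → ∀ z ∈ segment ℝ a w, ‖iteratedFDeriv ℝ i g z‖ ≤ κ)
    {k : ℕ} (hk : k ≤ N) :
    ‖iteratedFDeriv ℝ k (density E g s ∘ freeTraj s c₀) ζ‖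
        ≤ faaConst N * (2 ^ N * (κ * env N E s ((1 + s : ℝ) • y))) ∧
      ‖iteratedFDeriv ℝ k (density E g s ∘ freeTraj s c₀) ζ
          - iteratedFDeriv ℝ k (density E g s ∘ S.traj s c) ζ‖
        ≤ faaConst N * (2 ^ N * (κ * env N E s ((1 + s : ℝ) • y)) * (2 * S.dev s)) := by
  have hs0 := s.2.1
  have hk' : (k : WithTop ℕ∞) ≤ N := by exact_mod_cast hk
  have hgN : ContDiff ℝ N g := hg.of_le (by exact_mod_cast N.le_succ)
  have hcd := contDiff_density S.field.regular hgN hs0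
  have hdev := S.dev_nonneg hs0
  have henv := env_nonneg (N := N) (E := E) hs0 ((1 + s : ℝ) • y)
  have hκ0 : 0 ≤ κ := (norm_nonneg _).trans (hb 0 (Nat.zero_le _) a (left_mem_segment ℝ a w))
  have hq : ∀ j, j ≤ k → ‖iteratedFDeriv ℝ j (density E g s) (y, a)‖
      ≤ 2 ^ N * (κ * env N E s ((1 + s : ℝ) • y)) := fun j hj =>
    norm_iteratedFDeriv_density_le S.field.regular hgN hs0 (y, a) (hj.trans hk)
      fun i hi => hb i (by omega) a (left_mem_segment ℝ a w)
  have hqq : ∀ j, j ≤ k → ‖iteratedFDeriv ℝ j (density E g s) (y, a)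
      - iteratedFDeriv ℝ j (density E g s) (y, w)‖
      ≤ 2 ^ N * (κ * env N E s ((1 + s : ℝ) • y)) * (2 * S.dev s) := by
    intro j hj
    have := norm_iteratedFDeriv_density_sub_le S.field.regular hg hs0 y a w (hj.trans hk) hb
    refine this.trans ?_
    calc _ = 2 ^ N * (κ * env N E s ((1 + s : ℝ) • y)) * ‖a - w‖ := by ring
      _ ≤ _ := mul_le_mul_of_nonneg_left haw (by positivity)
  have e₀ := iteratedFDeriv_comp (hcd.contDiffAt (x := freeTraj s c₀ ζ))
    (contDiff_freeTraj s c₀).contDiffAt hk'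
  have e₁ := iteratedFDeriv_comp (hcd.contDiffAt (x := S.traj s c ζ))
    (S.contDiff_traj s c).contDiffAt hk'
  rw [e₀, e₁, hp₀, hp]
  constructor
  · refine (norm_taylorComp_le _ _ k hq fun i hi hik =>
      (norm_iteratedFDeriv_freeTraj_le s c₀ hi ζ).trans (by norm_num)).trans ?_
    exact mul_le_mul_of_nonneg_right (le_faaConst' hk) (by positivity)
  · refine (norm_taylorComp_sub_le _ _ _ _ k (by positivity) hq hqq
      (fun i hi hik => (norm_iteratedFDeriv_freeTraj_le s c₀ hi ζ).trans (by norm_num))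
      (fun i hi hik => S.norm_iteratedFDeriv_traj_le s c hi (hik.trans hk) ζ)
      fun i hi hik => ?_).trans ?_
    · change ‖iteratedFDeriv ℝ i (freeTraj s c₀) ζ - iteratedFDeriv ℝ i (S.traj s c) ζ‖ ≤ _
      rw [iteratedFDeriv_freeTraj_eq s c₀ c hi]
      exact (S.norm_iteratedFDeriv_traj_sub_le s c (hik.trans hk) ζ).trans (by linarith)
    · exact mul_le_mul_of_nonneg_right (le_faaConst hk) (by positivity)

lemma norm_smul_sub_le_of_abs_sub_one_le {G : Type*} [NormedAddCommGroup G] [NormedSpace ℝ G]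
    {r a b c B : ℝ} {x y : G} (hr : |r - 1| ≤ a) (hx : ‖x‖ ≤ b) (hxy : ‖x - y‖ ≤ c) (ha : 0 ≤ a)
    (hB : a * b + c = B) : ‖r • x - y‖ ≤ B := by
  calc ‖r • x - y‖ = ‖(r - 1) • x + (x - y)‖ := by
        congr 1
        module
    _ ≤ a * b + c := by
        refine (norm_add_le _ _).trans (add_le_add ?_ hxy)
        rw [norm_smul, Real.norm_eq_abs]
        exact mul_le_mul hr hx (norm_nonneg _) ha
    _ = B := hB

/-- The main cancellation: after the change of variables that matches the positions, the
derivatives of the linear and of the nonlinear integrands differ by a small factor. -/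
theorem norm_jac_smul_sub_le (hD : 0 ≤ D) (hg : ContDiff ℝ (N + 1 : ℕ) g)
    (hκ : ∀ i, i ≤ N + 1 → ∀ v, ‖iteratedFDeriv ℝ i g v‖ ≤ κ * wt d v) (hκ0 : 0 ≤ κ)
    {s : Icc (0 : ℝ) t} (hs : (s : ℝ) < t) {k : ℕ} (hk : k ≤ N) (ζ v : Sp d) :
    ‖S.jac s (jb t • ζ) v • iteratedFDeriv ℝ k (density E g s ∘
        freeTraj s (0, S.avgVel s (jb t • ζ) v - (t / jb t) • ζ)) ζ
      - iteratedFDeriv ℝ k (density E g s ∘ S.traj s (0, v - (t / jb t) • ζ)) ζ‖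
    ≤ (D + 2) * (faaConst N * (2 ^ N * (κ * 2 ^ ((d : ℝ) + 1)))) *
      (S.dev s * (wt d v * env N E s (S.path (jb t • ζ, v) s))) := by
  have hs0 := s.2.1
  have hs1 : (1 + s : ℝ) ≠ 0 := by linarith
  have hdev := S.dev_nonneg hs0
  have hJ := S.abs_jac_sub_one_le hD hs (jb t • ζ) v
  have hav : ‖S.avgVel s (jb t • ζ) v - v‖ ≤ S.dev s := S.norm_avgVel_sub_le hs _ v
  have hwv : ‖S.vel (jb t • ζ, v) s - v‖ ≤ S.dev s := S.norm_vel_sub_le (jb t • ζ, v) s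
  -- The shift of the base velocity cancels that of the frame, so at `ζ` the free trajectory has
  -- exactly the average velocity and hence the same position as the flow.
  have hp₀ : freeTraj s (0, S.avgVel s (jb t • ζ) v - (t / jb t) • ζ) ζ
      = ((1 + s : ℝ)⁻¹ • S.path (jb t • ζ, v) s, S.avgVel s (jb t • ζ) v) := by
    rw [S.path_eq_avgVel hs]
    simp [freeTraj, freePath_apply]
  have hp : S.traj s (0, v - (t / jb t) • ζ) ζ
      = ((1 + s : ℝ)⁻¹ • S.path (jb t • ζ, v) s, S.vel (jb t • ζ, v) s) := by
    simp [traj]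
  have haw : ‖S.avgVel s (jb t • ζ) v - S.vel (jb t • ζ, v) s‖ ≤ 2 * S.dev s := by
    have := norm_sub_le (S.avgVel s (jb t • ζ) v - v) (S.vel (jb t • ζ, v) s - v)
    rw [sub_sub_sub_cancel_right] at this
    linarith
  -- Both velocities lie within distance one of `v`, so on the segment joining them the weight is
  -- comparable to its value at `v`.
  have hb : ∀ i, i ≤ N + 1 → ∀ z ∈ segment ℝ (S.avgVel s (jb t • ζ) v) (S.vel (jb t • ζ, v) s),
      ‖iteratedFDeriv ℝ i g z‖ ≤ κ * (2 ^ ((d : ℝ) + 1) * wt d v) := by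
    intro i hi z hz
    have h1 := (convex_closedBall v 1).segment_subset
        (mem_closedBall_iff_norm.2 (S.norm_sub_le_one_of_le hs0 hav))
        (mem_closedBall_iff_norm.2 (S.norm_sub_le_one_of_le hs0 hwv)) hz
    refine (hκ i hi z).trans ?_
    gcongr
    exact wt_le_of_norm_sub_le (mem_closedBall_iff_norm.1 h1)
  obtain ⟨h1, h2⟩ := S.norm_density_jets_sub_le hg hp₀ hp haw hb hk
  rw [smul_smul, mul_inv_cancel₀ hs1, one_smul] at h1 h2
  have h3 := norm_smul_sub_le_of_abs_sub_one_le hJ h1 h2 (by positivity) rfl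
  refine le_trans h3 (le_of_eq ?_)
  ring

end Flow

end VlasovForcing

namespace VlasovForcing

/-! ### The two integrands as smooth families of paths -/

section Evaluation

variable {d N : ℕ} {E : ℝ → Sp d → Sp d} {t : ℝ} {g : Sp d → Sp d →L[ℝ] ℝ}

/-- The pairing of a covector density along the velocities `η` with the field along `γ`. -/
def pairing (hE : FieldRegular N E) (hg : Continuous g) (γ η : C(Icc (0 : ℝ) t, Sp d)) :
    C(Icc (0 : ℝ) t, ℝ) :=
  applyFamily (nem ⟨fun p : Icc (0 : ℝ) t × Sp d => g p.2, by fun_prop⟩ η) (nem (fieldOn t hE) γ)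

lemma contDiff_pairing (hE : FieldRegular N E) (hg : ContDiff ℝ N g) {P : Type}
    [NormedAddCommGroup P] [NormedSpace ℝ P] {γ η : P → C(Icc (0 : ℝ) t, Sp d)}
    (hγ : ContDiff ℝ N γ) (hη : ContDiff ℝ N η) :
    ContDiff ℝ N fun p => pairing hE hg.continuous (γ p) (η p) := by
  have h : ContDiff ℝ N (nem (⟨fun p => g p.2, hg.continuous.comp continuous_snd⟩ :
      C(Icc (0 : ℝ) t × Sp d, Sp d →L[ℝ] ℝ))) :=
    contDiff_nem N _ (fun _ => hg) fun k hk =>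
      (hg.continuous_iteratedFDeriv (by exact_mod_cast hk)).comp continuous_snd
  exact (applyFamily.contDiff.comp (h.comp hη)).clm_apply ((contDiff_nem_fieldOn hE).comp hγ)

/-- The derivatives of a family of continuous paths along an affine frame depend continuously on
the time and on the base point of the frame. -/
lemma continuous_iteratedFDeriv_eval_frame {P Q : Type} [NormedAddCommGroup P] [NormedSpace ℝ P]
    [NormedAddCommGroup Q] [NormedSpace ℝ Q] [FiniteDimensional ℝ Q]
    {f : P → C(Icc (0 : ℝ) t, ℝ)} (hf : ContDiff ℝ N f) (L : Q →L[ℝ] P) {k : ℕ} (hk : k ≤ N)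
    (ζ : Q) :
    Continuous fun a : Icc (0 : ℝ) t × P =>
      iteratedFDeriv ℝ k (fun ζ => f (a.2 + L ζ) a.1) ζ := by
  refine continuous_multilinear_of_forall_apply fun m => ?_
  have h1 : ∀ a : Icc (0 : ℝ) t × P, iteratedFDeriv ℝ k (fun ζ => f (a.2 + L ζ) a.1) ζ m
      = iteratedFDeriv ℝ k f (a.2 + L ζ) (fun i => L (m i)) a.1 := by
    intro a
    have h2 : ContDiff ℝ N fun p => f (a.2 + p) := hf.comp (contDiff_const.add contDiff_id)
    rw [iteratedFDeriv_eval (g := fun ζ => f (a.2 + L ζ)) (h2.comp L.contDiff) hk]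
    have h3 := L.iteratedFDeriv_comp_right h2 ζ (i := k) (by exact_mod_cast hk)
    have h4 : (fun p => f (a.2 + p)) ∘ L = fun ζ => f (a.2 + L ζ) := rfl
    rw [h4, iteratedFDeriv_comp_add_left] at h3
    rw [h3]
    rfl
  simp only [h1]
  have h5 := hf.continuous_iteratedFDeriv (m := k) (by exact_mod_cast hk)
  have h6 : Continuous fun a : Icc (0 : ℝ) t × P =>
      iteratedFDeriv ℝ k f (a.2 + L ζ) (fun i => L (m i)) :=
    (ContinuousMultilinearMap.apply ℝ (fun _ : Fin k => P) _ _).continuous.comp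
      (h5.comp (continuous_snd.add continuous_const))
  exact h6.eval continuous_fst

end Evaluation

namespace Flow

variable {d N : ℕ} {E : ℝ → Sp d → Sp d} {e t D : ℝ} {X V : ℝ → ℝ → Sp d → Sp d → Sp d}
  (S : Flow N E e t D X V) {g : Sp d → Sp d →L[ℝ] ℝ}

/-- The constant velocity, as a continuous path. -/
def freeVel (d : ℕ) (t : ℝ) : Sp d × Sp d →L[ℝ] C(Icc (0 : ℝ) t, Sp d) :=
  (ContinuousLinearMap.const ℝ (Icc (0 : ℝ) t)).comp (ContinuousLinearMap.snd ℝ (Sp d) (Sp d))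

/-- The linear integrand along the free flow. -/
def freePairing (hg : ContDiff ℝ N g) (p : Sp d × Sp d) : C(Icc (0 : ℝ) t, ℝ) :=
  pairing S.field.regular hg.continuous (freePath d t p) (freeVel d t p)

/-- The nonlinear integrand along the flow. -/
def flowPairing (hg : ContDiff ℝ N g) (p : Sp d × Sp d) : C(Icc (0 : ℝ) t, ℝ) :=
  pairing S.field.regular hg.continuous (S.path p) (freeVel d t p - S.drag p)

lemma contDiff_freePairing (hg : ContDiff ℝ N g) : ContDiff ℝ N (S.freePairing hg) :=
  contDiff_pairing _ hg (freePath d t).contDiff (freeVel d t).contDiff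

lemma contDiff_flowPairing (hg : ContDiff ℝ N g) : ContDiff ℝ N (S.flowPairing hg) :=
  contDiff_pairing _ hg S.contDiff_path ((freeVel d t).contDiff.sub S.contDiff_drag)

lemma freePairing_frame (hg : ContDiff ℝ N g) (s : Icc (0 : ℝ) t) (c : Sp d × Sp d) :
    (fun ζ => S.freePairing hg (c + frame d t ζ) s) = density E g s ∘ freeTraj s c := by
  have hs1 : (1 + s : ℝ) ≠ 0 := by linarith [s.2.1]
  ext1 ζ
  simp only [Function.comp_apply, density, freeTraj, smul_smul, mul_inv_cancel₀ hs1, one_smul]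
  rfl

lemma flowPairing_frame (hg : ContDiff ℝ N g) (s : Icc (0 : ℝ) t) (c : Sp d × Sp d) :
    (fun ζ => S.flowPairing hg (c + frame d t ζ) s) = density E g s ∘ S.traj s c := by
  have hs1 : (1 + s : ℝ) ≠ 0 := by linarith [s.2.1]
  ext1 ζ
  simp only [Function.comp_apply, density, traj, smul_smul, mul_inv_cancel₀ hs1, one_smul]
  rfl

variable {κ : ℝ}

/-- A common constant for the derivatives of the two integrands. -/
def pairConst (d N : ℕ) (κ : ℝ) : ℝ := faaConst N * (2 ^ N * (κ * 2 ^ ((d : ℝ) + 1)))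

lemma pairConst_nonneg (hκ0 : 0 ≤ κ) : 0 ≤ pairConst d N κ := by
  have := faaConst_nonneg N
  unfold pairConst
  positivity

lemma norm_iteratedFDeriv_flowPairing_le (hg : ContDiff ℝ N g)
    (hκ : ∀ i, i ≤ N → ∀ v, ‖iteratedFDeriv ℝ i g v‖ ≤ κ * wt d v) (hκ0 : 0 ≤ κ)
    (s : Icc (0 : ℝ) t) (c : Sp d × Sp d) {k : ℕ} (hk : k ≤ N) (ζ : Sp d) :
    ‖iteratedFDeriv ℝ k (fun ζ => S.flowPairing hg (c + frame d t ζ) s) ζ‖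
      ≤ pairConst d N κ * ((N + 1) * e) * wt d (c + frame d t ζ).2 := by
  rw [flowPairing_frame]
  refine (S.norm_iteratedFDeriv_density_traj_le hg hκ hκ0 s c hk ζ).trans ?_
  have h1 := env_le S.field s.2.1 (S.path (c + frame d t ζ) s)
  have h2 := wt_nonneg (c + frame d t ζ).2
  have h3 := faaConst_nonneg N
  calc _ ≤ faaConst N * (2 ^ N * ((κ * (2 ^ ((d : ℝ) + 1) * wt d (c + frame d t ζ).2))
        * ((N + 1) * e))) := by gcongr
    _ = _ := by
      unfold pairConst
      ring

lemma norm_iteratedFDeriv_freePairing_le (hg : ContDiff ℝ N g)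
    (hκ : ∀ i, i ≤ N → ∀ v, ‖iteratedFDeriv ℝ i g v‖ ≤ κ * wt d v) (hκ0 : 0 ≤ κ)
    (s : Icc (0 : ℝ) t) (c : Sp d × Sp d) {k : ℕ} (hk : k ≤ N) (ζ : Sp d) :
    ‖iteratedFDeriv ℝ k (fun ζ => S.freePairing hg (c + frame d t ζ) s) ζ‖
      ≤ pairConst d N κ * ((N + 1) * e) * wt d (c + frame d t ζ).2 := by
  rw [freePairing_frame]
  refine (norm_iteratedFDeriv_density_freeTraj_le S.field.regular hg hκ s c hk ζ).trans ?_
  have h1 := env_le S.field s.2.1 (freePath d t (c + frame d t ζ) s)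
  have h2 := wt_nonneg (c + frame d t ζ).2
  have h3 := faaConst_nonneg N
  have h4 : (1 : ℝ) ≤ 2 ^ ((d : ℝ) + 1) := Real.one_le_rpow (by norm_num) (by positivity)
  calc _ ≤ faaConst N * (2 ^ N * ((κ * (1 * wt d (c + frame d t ζ).2))
        * ((N + 1) * e))) := by
          rw [one_mul]
          gcongr
    _ ≤ faaConst N * (2 ^ N * ((κ * (2 ^ ((d : ℝ) + 1) * wt d (c + frame d t ζ).2))
        * ((N + 1) * e))) := by
          have := S.e_nonneg
          gcongr
    _ = _ := by
      unfold pairConst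
      ring

end Flow

end VlasovForcing

/-! ### The reaction integrand and its velocity integrals -/

namespace VlasovForcing
namespace Flow

variable {d N : ℕ} {E : ℝ → Sp d → Sp d} {e t D : ℝ} {X V : ℝ → ℝ → Sp d → Sp d → Sp d}
  (S : Flow N E e t D X V) {g : Sp d → Sp d →L[ℝ] ℝ} {κ : ℝ}

/-- Lebesgue measure on the time interval `(0,t]` times velocity space. -/
abbrev slab (d : ℕ) (t : ℝ) : Measure (ℝ × Sp d) := (volume.restrict (Ioc 0 t)).prod volume

lemma integrable_eval_slab (S : Flow N E e t D X V) {f : Sp d × Sp d → C(Icc (0 : ℝ) t, ℝ)}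
    (hf : Continuous f) {C : ℝ} (hC : ∀ s p, ‖f p s‖ ≤ C * wt d p.2) (c : Sp d × Sp d) :
    Integrable (fun a : ℝ × Sp d => f ((0, a.2) + c) (projIcc 0 t S.time_nonneg a.1))
      (slab d t) := by
  have h1 : Integrable (fun a : ℝ × Sp d => C * wt d (a.2 + c.2)) (slab d t) :=
    ((integrable_wt.comp_add_right c.2).comp_snd _).const_mul C
  refine h1.mono' ?_ (ae_of_all _ fun a => hC _ _)
  have h2 : Continuous fun a : ℝ × Sp d => f ((0, a.2) + c) :=
    hf.comp ((continuous_const.prodMk continuous_snd).add continuous_const)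
  exact (h2.eval (continuous_projIcc.comp continuous_fst)).aestronglyMeasurable

lemma ae_slab_mem : ∀ᵐ a ∂(slab d t), a.1 ∈ Ioc 0 t := by
  have : slab d t = ((volume : Measure ℝ).prod (volume : Measure (Sp d))).restrict
      (Ioc 0 t ×ˢ univ) := by
    rw [← Measure.prod_restrict, Measure.restrict_univ]
  rw [this]
  filter_upwards [ae_restrict_mem (measurableSet_Ioc.prod MeasurableSet.univ)] with a ha
  exact ha.1

section Identify

variable {μ : Sp d → ℝ} (hg : ContDiff ℝ N (fderiv ℝ μ))

lemma integrandRL_eq {s : ℝ} (hs : s ∈ Ioc 0 t) (x v : Sp d) :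
    integrandRL E μ t x s v = S.freePairing hg (x, v) (projIcc 0 t S.time_nonneg s) := by
  rw [projIcc_of_mem _ (Ioc_subset_Icc_self hs)]
  rfl

lemma integrandRNL_eq {s : ℝ} (hs : s ∈ Ioc 0 t) (x v : Sp d) :
    integrandRNL E μ X V t x s v = S.flowPairing hg (x, v) (projIcc 0 t S.time_nonneg s) := by
  rw [projIcc_of_mem _ (Ioc_subset_Icc_self hs), integrandRNL,
    S.pos_eq ⟨s, Ioc_subset_Icc_self hs⟩, S.vel_eq ⟨s, Ioc_subset_Icc_self hs⟩]
  rfl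

/-- Velocity integration in the moving frame. -/
lemma integral_slab_frame {f : Sp d × Sp d → C(Icc (0 : ℝ) t, ℝ)}
    (hf : Continuous f) {C : ℝ} (hC : ∀ s p, ‖f p s‖ ≤ C * wt d p.2) (ζ : Sp d) :
    ∫ a, f ((0, a.2) + frame d t ζ) (projIcc 0 t S.time_nonneg a.1) ∂(slab d t)
      = ∫ s in Ioc 0 t, ∫ v, f (jb t • ζ, v) (projIcc 0 t S.time_nonneg s) := by
  rw [integral_prod _ (S.integrable_eval_slab hf hC _)]
  refine integral_congr_ae (ae_of_all _ fun s => ?_)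
  simp only [frame_apply, Prod.mk_add_mk, zero_add]
  exact integral_add_right_eq_self
    (fun v => f (jb t • ζ, v) (projIcc 0 t S.time_nonneg s)) ((t / jb t) • ζ)

end Identify

section Reaction

variable (hg : ContDiff ℝ N g)

/-- The difference of the linear and the nonlinear integrands. -/
def reaction (hg : ContDiff ℝ N g) (p : Sp d × Sp d) : C(Icc (0 : ℝ) t, ℝ) :=
  S.freePairing hg p - S.flowPairing hg p

lemma contDiff_reaction : ContDiff ℝ N (S.reaction hg) :=
  (S.contDiff_freePairing hg).sub (S.contDiff_flowPairing hg)

lemma contDiff_frame_eval {f : Sp d × Sp d → C(Icc (0 : ℝ) t, ℝ)} (hf : ContDiff ℝ N f)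
    (c : Sp d × Sp d) (s : Icc (0 : ℝ) t) :
    ContDiff ℝ N fun ζ => f (c + frame d t ζ) s :=
  contDiff_eval (g := fun ζ => f (c + frame d t ζ))
    (hf.comp (contDiff_const.add (frame d t).contDiff)) s

lemma iteratedFDeriv_reaction (s : Icc (0 : ℝ) t) (c : Sp d × Sp d) {k : ℕ} (hk : k ≤ N)
    (ζ : Sp d) :
    iteratedFDeriv ℝ k (fun ζ => S.reaction hg (c + frame d t ζ) s) ζ
      = iteratedFDeriv ℝ k (fun ζ => S.freePairing hg (c + frame d t ζ) s) ζ
        - iteratedFDeriv ℝ k (fun ζ => S.flowPairing hg (c + frame d t ζ) s) ζ := by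
  have hk' : (k : WithTop ℕ∞) ≤ N := by exact_mod_cast hk
  exact iteratedFDeriv_sub_apply
    ((contDiff_frame_eval (S.contDiff_freePairing hg) c s).of_le hk').contDiffAt
    ((contDiff_frame_eval (S.contDiff_flowPairing hg) c s).of_le hk').contDiffAt

lemma norm_iteratedFDeriv_reaction_le
    (hκ : ∀ i, i ≤ N → ∀ v, ‖iteratedFDeriv ℝ i g v‖ ≤ κ * wt d v) (hκ0 : 0 ≤ κ) (s : Icc (0 : ℝ) t) (c : Sp d × Sp d) {k : ℕ} (hk : k ≤ N)
    (ζ : Sp d) :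
    ‖iteratedFDeriv ℝ k (fun ζ => S.reaction hg (c + frame d t ζ) s) ζ‖
      ≤ 2 * (pairConst d N κ * ((N + 1) * e)) * wt d (c + frame d t ζ).2 := by
  rw [S.iteratedFDeriv_reaction hg s c hk]
  refine (norm_sub_le _ _).trans ?_
  have h1 := S.norm_iteratedFDeriv_freePairing_le hg hκ hκ0 s c hk ζ
  have h2 := S.norm_iteratedFDeriv_flowPairing_le hg hκ hκ0 s c hk ζ
  linarith

lemma wt_frame_le (S : Flow N E e t D X V) (v ζ : Sp d) :
    wt d (((0, v) : Sp d × Sp d) + frame d t ζ).2 ≤ (1 + ‖ζ‖) ^ ((d : ℝ) + 1) * wt d v := by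
  have ht := S.time_nonneg
  have h1 : 0 < jb t := zero_lt_one.trans_le (one_le_jb t)
  have h2 : ‖(t / jb t) • ζ‖ ≤ ‖ζ‖ := by
    rw [norm_smul, Real.norm_of_nonneg (by positivity)]
    refine mul_le_of_le_one_left (norm_nonneg _) ?_
    rw [div_le_one h1]
    exact le_jb t
  refine (wt_add_le v _).trans ?_
  have := wt_nonneg v
  gcongr
  exact h2

theorem contDiff_integral_reaction
    (hκ : ∀ i, i ≤ N → ∀ v, ‖iteratedFDeriv ℝ i g v‖ ≤ κ * wt d v) (hκ0 : 0 ≤ κ) :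
    ContDiff ℝ N (fun ζ => ∫ a, S.reaction hg ((0, a.2) + frame d t ζ)
        (projIcc 0 t S.time_nonneg a.1) ∂(slab d t)) ∧
      ∀ k, k ≤ N → ∀ ζ, iteratedFDeriv ℝ k (fun ζ => ∫ a, S.reaction hg ((0, a.2) + frame d t ζ)
        (projIcc 0 t S.time_nonneg a.1) ∂(slab d t)) ζ
        = ∫ a, iteratedFDeriv ℝ k (fun ζ => S.reaction hg ((0, a.2) + frame d t ζ)
          (projIcc 0 t S.time_nonneg a.1)) ζ ∂(slab d t) := by
  refine contDiff_integral_of_dominated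
    (F := fun (a : ℝ × Sp d) ζ => S.reaction hg ((0, a.2) + frame d t ζ)
      (projIcc 0 t S.time_nonneg a.1))
    (fun a => contDiff_frame_eval (S.contDiff_reaction hg) _ _) (fun k hk ζ => ?_)
    fun k hk ζ₀ => ?_
  · have h1 := continuous_iteratedFDeriv_eval_frame (S.contDiff_reaction hg) (frame d t) hk ζ
    have h2 : Continuous fun a : ℝ × Sp d =>
        (projIcc 0 t S.time_nonneg a.1, ((0, a.2) : Sp d × Sp d)) :=
      (continuous_projIcc.comp continuous_fst).prodMk (continuous_const.prodMk continuous_snd)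
    exact (h1.comp h2).aestronglyMeasurable
  -- On the unit ball around `ζ₀` the frame moves the velocity by at most `1+‖ζ₀‖`, so a fixed
  -- multiple of the weight at the unshifted velocity dominates. It is integrable because the time
  -- interval has finite length.
  · refine ⟨fun a => 2 * (pairConst d N κ * ((N + 1) * e)) *
      ((1 + (1 + ‖ζ₀‖)) ^ ((d : ℝ) + 1) * wt d a.2),
      ((integrable_wt.comp_snd _).const_mul _).const_mul _, ae_of_all _ fun a ζ hζ => ?_⟩
    refine (S.norm_iteratedFDeriv_reaction_le hg hκ hκ0 _ _ hk ζ).trans ?_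
    have h1 : ‖ζ‖ ≤ 1 + ‖ζ₀‖ := by
      have := norm_sub_norm_le ζ ζ₀
      have h2 := mem_ball_iff_norm.1 hζ
      linarith
    have h2 := S.wt_frame_le a.2 ζ
    have h3 := pairConst_nonneg (d := d) (N := N) hκ0
    have h4 := S.e_nonneg
    have h5 := wt_nonneg a.2
    refine mul_le_mul_of_nonneg_left (h2.trans ?_) (by positivity)
    gcongr

/-- Velocity integrals of the derivatives of the reaction at a fixed time. -/
theorem enorm_integral_reaction_le (hD : 0 ≤ D) (hg' : ContDiff ℝ (N + 1 : ℕ) g)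
    (hκ : ∀ i, i ≤ N + 1 → ∀ v, ‖iteratedFDeriv ℝ i g v‖ ≤ κ * wt d v) (hκ0 : 0 ≤ κ)
    {s : Icc (0 : ℝ) t} (hs : (s : ℝ) < t) {k : ℕ} (hk : k ≤ N) (ζ : Sp d) :
    ‖∫ v, iteratedFDeriv ℝ k (fun ζ => S.reaction hg ((0, v) + frame d t ζ) s) ζ‖ₑ
      ≤ ENNReal.ofReal (2 * ((D + 2) * pairConst d N κ * 2 ^ ((d : ℝ) + 1)) * S.dev s) *
        ∫⁻ u, ENNReal.ofReal (wt d u * env N E s (jb t • ζ - (t - s) • u)) := by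
  have hκ' : ∀ i, i ≤ N → ∀ v, ‖iteratedFDeriv ℝ i g v‖ ≤ κ * wt d v :=
    fun i hi => hκ i (by omega)
  let Φ₀ : Sp d → ContinuousMultilinearMap ℝ (fun _ : Fin k => Sp d) ℝ := fun v =>
    iteratedFDeriv ℝ k (fun ζ => S.freePairing hg ((0, v) + frame d t ζ) s) ζ
  let Φ : Sp d → ContinuousMultilinearMap ℝ (fun _ : Fin k => Sp d) ℝ := fun v =>
    iteratedFDeriv ℝ k (fun ζ => S.flowPairing hg ((0, v) + frame d t ζ) s) ζ
  set x := jb t • ζ with hx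
  set h := (t / jb t) • ζ with hh
  have hbase : Continuous fun v : Sp d => (s, ((0, v) : Sp d × Sp d)) := by fun_prop
  have hdom : Integrable fun v : Sp d => pairConst d N κ * ((N + 1) * e) * wt d (v + h) :=
    (integrable_wt.comp_add_right h).const_mul _
  have hΦ₀ : Integrable Φ₀ := by
    refine hdom.mono' ((continuous_iteratedFDeriv_eval_frame (S.contDiff_freePairing hg)
      (frame d t) hk ζ).comp hbase).aestronglyMeasurable (ae_of_all _ fun v => ?_)
    exact S.norm_iteratedFDeriv_freePairing_le hg hκ' hκ0 s (0, v) hk ζ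
  have hΦ : Integrable Φ := by
    refine hdom.mono' ((continuous_iteratedFDeriv_eval_frame (S.contDiff_flowPairing hg)
      (frame d t) hk ζ).comp hbase).aestronglyMeasurable (ae_of_all _ fun v => ?_)
    exact S.norm_iteratedFDeriv_flowPairing_le hg hκ' hκ0 s (0, v) hk ζ
  have hint₀ : Integrable fun v => S.jac s x v • Φ₀ (S.avgVel s x v - h) :=
    S.integrable_avgVel hs x (hΦ₀.comp_sub_right h)
  -- Translation by `h` undoes the frame shift in both integrals. The average velocity is then
  -- substituted in the linear integral only, which matches the positions pointwise in `v`.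
  have key : ∫ v, iteratedFDeriv ℝ k (fun ζ => S.reaction hg ((0, v) + frame d t ζ) s) ζ
      = ∫ v, (S.jac s x v • Φ₀ (S.avgVel s x v - h) - Φ (v - h)) := by
    rw [integral_sub hint₀ (hΦ.comp_sub_right h), S.integral_avgVel hs x fun u => Φ₀ (u - h),
      integral_sub_right_eq_self Φ₀ h, integral_sub_right_eq_self Φ h, ← integral_sub hΦ₀ hΦ]
    exact integral_congr_ae (ae_of_all _ fun v => S.iteratedFDeriv_reaction hg s (0, v) hk ζ)
  have hpt : ∀ v, ‖S.jac s x v • Φ₀ (S.avgVel s x v - h) - Φ (v - h)‖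
      ≤ (D + 2) * pairConst d N κ * (S.dev s * (wt d v * env N E s (S.path (x, v) s))) := by
    intro v
    have := S.norm_jac_smul_sub_le hD hg' hκ hκ0 hs hk ζ v
    rw [← S.freePairing_frame hg, ← S.flowPairing_frame hg] at this
    exact this
  have hpc := pairConst_nonneg (d := d) (N := N) hκ0
  have hdev := S.dev_nonneg s.2.1
  rw [key]
  refine (enorm_integral_le_lintegral_enorm _).trans ?_
  calc ∫⁻ v, ‖S.jac s x v • Φ₀ (S.avgVel s x v - h) - Φ (v - h)‖ₑ
      ≤ ∫⁻ v, ENNReal.ofReal ((D + 2) * pairConst d N κ * 2 ^ ((d : ℝ) + 1) * S.dev s) *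
          ENNReal.ofReal (wt d (S.avgVel s x v) *
            env N E s (x - (t - s) • S.avgVel s x v)) := by
        refine lintegral_mono fun v => ?_
        rw [← ofReal_norm, ← ENNReal.ofReal_mul (by positivity)]
        refine ENNReal.ofReal_le_ofReal ((hpt v).trans ?_)
        rw [← S.path_eq_avgVel hs]
        -- Moving the weight from `v` to the average velocity makes the whole bound a function of
        -- that variable; substituting it then costs the factor `2`.
        have h1 : wt d v ≤ 2 ^ ((d : ℝ) + 1) * wt d (S.avgVel s x v) := by
          refine wt_le_of_norm_sub_le ?_
          rw [norm_sub_rev]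
          exact S.norm_sub_le_one_of_le s.2.1 (S.norm_avgVel_sub_le hs x v)
        have h2 := env_nonneg (N := N) (E := E) s.2.1 (S.path (x, v) s)
        calc _ ≤ (D + 2) * pairConst d N κ * (S.dev s *
              (2 ^ ((d : ℝ) + 1) * wt d (S.avgVel s x v) * env N E s (S.path (x, v) s))) := by
              gcongr
          _ = _ := by ring
    _ ≤ 2 * ∫⁻ u, ENNReal.ofReal ((D + 2) * pairConst d N κ * 2 ^ ((d : ℝ) + 1) * S.dev s) *
          ENNReal.ofReal (wt d u * env N E s (x - (t - s) • u)) :=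
        S.lintegral_avgVel_le hs x _
    _ = _ := by
        rw [lintegral_const_mul' _ _ ENNReal.ofReal_ne_top, ← mul_assoc, mul_assoc 2 (_ * _),
          ENNReal.ofReal_mul (p := 2) (by norm_num), ENNReal.ofReal_ofNat]

end Reaction

end Flow

end VlasovForcing

/-! ### The reaction term and its pointwise derivative bound -/

namespace VlasovForcing
namespace Flow

variable {d N : ℕ} {E : ℝ → Sp d → Sp d} {e t D : ℝ} {X V : ℝ → ℝ → Sp d → Sp d → Sp d}
  (S : Flow N E e t D X V) {g : Sp d → Sp d →L[ℝ] ℝ} {κ : ℝ} {μ : Sp d → ℝ}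

lemma norm_freePairing_le (hg : ContDiff ℝ N g)
    (hκ : ∀ i, i ≤ N → ∀ v, ‖iteratedFDeriv ℝ i g v‖ ≤ κ * wt d v) (hκ0 : 0 ≤ κ)
    (s : Icc (0 : ℝ) t) (p : Sp d × Sp d) :
    ‖S.freePairing hg p s‖ ≤ pairConst d N κ * ((N + 1) * e) * wt d p.2 := by
  have := S.norm_iteratedFDeriv_freePairing_le hg hκ hκ0 s p (Nat.zero_le _) 0
  rwa [norm_iteratedFDeriv_zero, map_zero, add_zero] at this

lemma norm_flowPairing_le (hg : ContDiff ℝ N g)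
    (hκ : ∀ i, i ≤ N → ∀ v, ‖iteratedFDeriv ℝ i g v‖ ≤ κ * wt d v) (hκ0 : 0 ≤ κ)
    (s : Icc (0 : ℝ) t) (p : Sp d × Sp d) :
    ‖S.flowPairing hg p s‖ ≤ pairConst d N κ * ((N + 1) * e) * wt d p.2 := by
  have := S.norm_iteratedFDeriv_flowPairing_le hg hκ hκ0 s p (Nat.zero_le _) 0
  rwa [norm_iteratedFDeriv_zero, map_zero, add_zero] at this

theorem integrable_integrand (S : Flow N E e t D X V) (hg : ContDiff ℝ N (fderiv ℝ μ))
    (hκ : ∀ i, i ≤ N → ∀ v, ‖iteratedFDeriv ℝ i (fderiv ℝ μ) v‖ ≤ κ * wt d v) (hκ0 : 0 ≤ κ)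
    (x : Sp d) :
    Integrable (Function.uncurry (integrandRL E μ t x)) (slab d t) ∧
      Integrable (Function.uncurry (integrandRNL E μ X V t x)) (slab d t) := by
  constructor
  · refine (S.integrable_eval_slab (S.contDiff_freePairing hg).continuous
      (S.norm_freePairing_le hg hκ hκ0) (x, 0)).congr ?_
    filter_upwards [ae_slab_mem] with a ha
    rw [Function.uncurry, S.integrandRL_eq hg ha]
    simp
  · refine (S.integrable_eval_slab (S.contDiff_flowPairing hg).continuous
      (S.norm_flowPairing_le hg hκ hκ0) (x, 0)).congr ?_
    filter_upwards [ae_slab_mem] with a ha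
    rw [Function.uncurry, S.integrandRNL_eq hg ha]
    simp

/-- The reaction term as an integral in the moving frame. -/
theorem termR_eq (hg : ContDiff ℝ N (fderiv ℝ μ))
    (hκ : ∀ i, i ≤ N → ∀ v, ‖iteratedFDeriv ℝ i (fderiv ℝ μ) v‖ ≤ κ * wt d v) (hκ0 : 0 ≤ κ)
    (ζ : Sp d) :
    termR E μ X V t (jb t • ζ) = ∫ a, S.reaction hg ((0, a.2) + frame d t ζ)
        (projIcc 0 t S.time_nonneg a.1) ∂(slab d t) := by
  have h1 := (S.contDiff_freePairing hg).continuous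
  have h2 := (S.contDiff_flowPairing hg).continuous
  have h3 := S.norm_freePairing_le hg hκ hκ0
  have h4 := S.norm_flowPairing_le hg hκ hκ0
  have h5 := integral_sub (S.integrable_eval_slab h1 h3 (frame d t ζ))
    (S.integrable_eval_slab h2 h4 (frame d t ζ))
  rw [S.integral_slab_frame h1 h3, S.integral_slab_frame h2 h4] at h5
  refine Eq.trans ?_ h5.symm
  rw [termR, intervalIntegral.integral_of_le S.time_nonneg,
    intervalIntegral.integral_of_le S.time_nonneg]
  congr 1
  · refine setIntegral_congr_fun measurableSet_Ioc fun s hs => ?_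
    simp only [S.integrandRL_eq hg hs]
  · refine setIntegral_congr_fun measurableSet_Ioc fun s hs => ?_
    simp only [S.integrandRNL_eq hg hs]

lemma jb_pos (r : ℝ) : 0 < jb r := zero_lt_one.trans_le (one_le_jb r)

lemma termR_eq_comp (hg : ContDiff ℝ N (fderiv ℝ μ))
    (hκ : ∀ i, i ≤ N → ∀ v, ‖iteratedFDeriv ℝ i (fderiv ℝ μ) v‖ ≤ κ * wt d v) (hκ0 : 0 ≤ κ) :
    termR E μ X V t = fun x => (fun ζ => ∫ a, S.reaction hg ((0, a.2) + frame d t ζ)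
        (projIcc 0 t S.time_nonneg a.1) ∂(slab d t)) ((jb t)⁻¹ • x) := by
  ext1 x
  simp only
  rw [← S.termR_eq hg hκ hκ0, smul_smul, mul_inv_cancel₀ (jb_pos t).ne', one_smul]

theorem contDiff_termR (S : Flow N E e t D X V) (hg : ContDiff ℝ N (fderiv ℝ μ))
    (hκ : ∀ i, i ≤ N → ∀ v, ‖iteratedFDeriv ℝ i (fderiv ℝ μ) v‖ ≤ κ * wt d v) (hκ0 : 0 ≤ κ) :
    ContDiff ℝ N (termR E μ X V t) := by
  rw [S.termR_eq_comp hg hκ hκ0]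
  exact (S.contDiff_integral_reaction hg hκ hκ0).1.comp (contDiff_const_smul _)

/-- The pointwise bound for the derivatives of the reaction term. -/
theorem enorm_iteratedFDeriv_termR_le (hD : 0 ≤ D) (hg : ContDiff ℝ (N + 1 : ℕ) (fderiv ℝ μ))
    (hκ : ∀ i, i ≤ N + 1 → ∀ v, ‖iteratedFDeriv ℝ i (fderiv ℝ μ) v‖ ≤ κ * wt d v) (hκ0 : 0 ≤ κ)
    {k : ℕ} (hk : k ≤ N) (x : Sp d) :
    ENNReal.ofReal (jb t ^ k) * ‖iteratedFDeriv ℝ k (termR E μ X V t) x‖ₑ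
      ≤ ∫⁻ s in Ioc 0 t,
        ENNReal.ofReal (2 * ((D + 2) * pairConst d N κ * 2 ^ ((d : ℝ) + 1)) * S.dev s) *
        ∫⁻ u, ENNReal.ofReal (wt d u * env N E s (x - (t - s) • u)) := by
  have hgN : ContDiff ℝ N (fderiv ℝ μ) := hg.of_le (by exact_mod_cast N.le_succ)
  have hκN : ∀ i, i ≤ N → ∀ v, ‖iteratedFDeriv ℝ i (fderiv ℝ μ) v‖ ≤ κ * wt d v :=
    fun i hi => hκ i (by omega)
  obtain ⟨h1, h2⟩ := S.contDiff_integral_reaction hgN hκN hκ0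
  have hj := jb_pos t
  have h3 : ENNReal.ofReal (jb t ^ k) * ‖iteratedFDeriv ℝ k (termR E μ X V t) x‖ₑ
      = ‖∫ a, iteratedFDeriv ℝ k (fun ζ => S.reaction hgN ((0, a.2) + frame d t ζ)
          (projIcc 0 t S.time_nonneg a.1)) ((jb t)⁻¹ • x) ∂(slab d t)‖ₑ := by
    rw [← h2 k hk, S.termR_eq_comp hgN hκN hκ0, iteratedFDeriv_comp_const_smul _
      (h1.of_le (by exact_mod_cast hk)), ← ofReal_norm, ← ofReal_norm,
      ← ENNReal.ofReal_mul (by positivity), norm_smul, norm_pow, norm_inv,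
      Real.norm_of_nonneg hj.le, ← mul_assoc, ← mul_pow, mul_inv_cancel₀ hj.ne', one_pow, one_mul]
  have hint : Integrable (fun a : ℝ × Sp d => iteratedFDeriv ℝ k
      (fun ζ => S.reaction hgN ((0, a.2) + frame d t ζ)
          (projIcc 0 t S.time_nonneg a.1)) ((jb t)⁻¹ • x)) (slab d t) := by
    refine Integrable.mono' (((integrable_wt.comp_snd _).const_mul _).const_mul _) ?_
      (ae_of_all _ fun a => (S.norm_iteratedFDeriv_reaction_le hgN hκN hκ0 _ _ hk _).trans
        (mul_le_mul_of_nonneg_left (S.wt_frame_le a.2 _) ?_))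
    · have h1 := continuous_iteratedFDeriv_eval_frame (S.contDiff_reaction hgN) (frame d t) hk
        ((jb t)⁻¹ • x)
      have h2 : Continuous fun a : ℝ × Sp d =>
          (projIcc 0 t S.time_nonneg a.1, ((0, a.2) : Sp d × Sp d)) :=
        (continuous_projIcc.comp continuous_fst).prodMk (continuous_const.prodMk continuous_snd)
      exact (h1.comp h2).aestronglyMeasurable
    · have h3 := pairConst_nonneg (d := d) (N := N) hκ0
      have h4 := S.e_nonneg
      positivity
  rw [h3, integral_prod _ hint]
  refine (enorm_integral_le_lintegral_enorm _).trans (lintegral_mono_ae ?_)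
  -- The time `s = t` is discarded as a null set, since the average velocity requires `s < t`.
  filter_upwards [ae_restrict_mem measurableSet_Ioc, (Measure.ae_ne volume t).filter_mono
    (ae_mono Measure.restrict_le_self)] with s hs hst
  have := S.enorm_integral_reaction_le hgN hD hg hκ hκ0
    (s := projIcc 0 t S.time_nonneg s) ?_ hk ((jb t)⁻¹ • x)
  · rw [projIcc_of_mem _ (Ioc_subset_Icc_self hs), smul_smul, mul_inv_cancel₀ hj.ne',
      one_smul] at this
    rw [projIcc_of_mem _ (Ioc_subset_Icc_self hs)]
    exact this
  · rw [projIcc_of_mem _ (Ioc_subset_Icc_self hs)]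
    exact lt_of_le_of_ne hs.2 hst

end Flow

end VlasovForcing

namespace VlasovForcing

/-! ### Consequences of the decay of the field -/

section Fields

variable {d N : ℕ} {E : ℝ → Sp d → Sp d} {B : ℝ}

/-- From `log y ≤ 4 y^(1/4)` and `2+s ≤ 2(1+s)`. A quarter power is small enough to leave integrable
weights throughout. -/
lemma log_two_add_le {s : ℝ} (hs : 0 ≤ s) : Real.log (2 + s) ≤ 8 * (1 + s) ^ (1 / 4 : ℝ) := by
  refine (Real.log_le_rpow_div (by linarith) (ε := 1 / 4) (by norm_num)).trans ?_
  have h1 : (2 + s) ^ (1 / 4 : ℝ) ≤ 2 * (1 + s) ^ (1 / 4 : ℝ) := by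
    calc (2 + s) ^ (1 / 4 : ℝ) ≤ (2 * (1 + s)) ^ (1 / 4 : ℝ) :=
          Real.rpow_le_rpow (by linarith) (by linarith) (by norm_num)
      _ = 2 ^ (1 / 4 : ℝ) * (1 + s) ^ (1 / 4 : ℝ) :=
          Real.mul_rpow (by norm_num) (by linarith)
      _ ≤ 2 * (1 + s) ^ (1 / 4 : ℝ) := by
          have h2 : (2 : ℝ) ^ (1 / 4 : ℝ) ≤ 2 ^ (1 : ℝ) :=
            Real.rpow_le_rpow_of_exponent_le (by norm_num) (by norm_num)
          rw [Real.rpow_one] at h2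
          have : 0 ≤ (1 + s) ^ (1 / 4 : ℝ) := Real.rpow_nonneg (by linarith) _
          gcongr
  linarith

lemma FieldDecay.pointwise_le (h : FieldDecay N B E) (hB : 0 ≤ B) {s : ℝ} (hs : 0 ≤ s) {k : ℕ}
    (hk : k ≤ N) (x : Sp d) :
    (1 + s) ^ d * ((1 + s) ^ k * ‖iteratedFDeriv ℝ k (E s) x‖)
      ≤ 8 * 2 ^ (d + N) * B * (1 + s) ^ (1 / 4 : ℝ) := by
  have h1 := ((h s hs k hk).1 x).trans (mul_le_mul_of_nonneg_left (log_two_add_le hs) hB)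
  have h2 : (1 + s) ^ (d + k) ≤ 2 ^ (d + N) * jb s ^ (d + k) := by
    calc (1 + s) ^ (d + k) ≤ (2 * jb s) ^ (d + k) :=
          pow_le_pow_left₀ (by linarith) (le_two_mul_jb s) _
      _ = 2 ^ (d + k) * jb s ^ (d + k) := mul_pow _ _ _
      _ ≤ 2 ^ (d + N) * jb s ^ (d + k) := by
          have := Flow.jb_pos s
          gcongr
          norm_num
  calc (1 + s) ^ d * ((1 + s) ^ k * ‖iteratedFDeriv ℝ k (E s) x‖)
      = (1 + s) ^ (d + k) * ‖iteratedFDeriv ℝ k (E s) x‖ := by ring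
    _ ≤ 2 ^ (d + N) * jb s ^ (d + k) * ‖iteratedFDeriv ℝ k (E s) x‖ := by gcongr
    _ = 2 ^ (d + N) * (jb s ^ (d + k) * ‖iteratedFDeriv ℝ k (E s) x‖) := by ring
    _ ≤ 2 ^ (d + N) * (B * (8 * (1 + s) ^ (1 / 4 : ℝ))) := by gcongr
    _ = _ := by ring

/-- Dimension three enters here, through `1/4 ≤ d - 11/4`. The factor `8` comes from the logarithm
and `2^(d+N)` from replacing `⟨s⟩` by `1+s`. -/
lemma FieldDecay.fieldBound (hd : 3 ≤ d) (hE : FieldRegular N E) (h : FieldDecay N B E)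
    (hB : 0 ≤ B) : FieldBound N (8 * 2 ^ (d + N) * B) E := by
  refine ⟨hE, fun s hs k hk x => ?_⟩
  have h1 := h.pointwise_le hB hs hk x
  have hs1 : (1 : ℝ) ≤ 1 + s := by linarith
  have h2 : (1 + s) ^ (1 / 4 : ℝ) ≤ (1 + s) ^ d * (1 + s) ^ (-(11 / 4) : ℝ) := by
    rw [← Real.rpow_natCast, ← Real.rpow_add (by linarith)]
    refine Real.rpow_le_rpow_of_exponent_le hs1 ?_
    have : (3 : ℝ) ≤ d := by exact_mod_cast hd
    linarith
  have h3 : 0 < (1 + s) ^ d := by positivity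
  refine le_of_mul_le_mul_left (h1.trans ?_) h3
  calc _ ≤ 8 * 2 ^ (d + N) * B * ((1 + s) ^ d * (1 + s) ^ (-(11 / 4) : ℝ)) := by gcongr
    _ = _ := by ring

lemma FieldDecay.pow_mul_env_le (h : FieldDecay N B E) (hB : 0 ≤ B) {s : ℝ} (hs : 0 ≤ s)
    (x : Sp d) :
    (1 + s) ^ d * env N E s x ≤ (N + 1) * (8 * 2 ^ (d + N) * B) * (1 + s) ^ (1 / 4 : ℝ) := by
  rw [env, Finset.mul_sum]
  refine (Finset.sum_le_card_nsmul _ _ _ fun i hi =>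
    h.pointwise_le hB hs (by simpa [Nat.lt_succ_iff] using hi) x).trans_eq ?_
  simp only [Finset.card_range, nsmul_eq_mul]
  push_cast
  ring

lemma FieldDecay.lintegral_env_le (hE : FieldRegular N E) (h : FieldDecay N B E) (hB : 0 ≤ B)
    {s : ℝ} (hs : 0 ≤ s) :
    ∫⁻ x, ENNReal.ofReal (env N E s x)
      ≤ ENNReal.ofReal ((N + 1) * (8 * 2 ^ (d + N) * B) * (1 + s) ^ (1 / 4 : ℝ)) := by
  have hs1 : 0 ≤ (1 + s) ^ (1 / 4 : ℝ) := Real.rpow_nonneg (by linarith) _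
  have hj := Flow.jb_pos s
  have h1 : ∀ x : Sp d, ENNReal.ofReal (env N E s x)
      = ∑ i ∈ Finset.range (N + 1), ENNReal.ofReal ((1 + s) ^ i) *
          ‖iteratedFDeriv ℝ i (E s) x‖ₑ := by
    intro x
    rw [env, ENNReal.ofReal_sum_of_nonneg (fun i _ => by positivity)]
    refine Finset.sum_congr rfl fun i _ => ?_
    rw [ENNReal.ofReal_mul (by positivity), ofReal_norm]
  simp only [h1]
  rw [lintegral_finsetSum' _ fun i hi => ?_]
  · calc ∑ i ∈ Finset.range (N + 1), ∫⁻ x, ENNReal.ofReal ((1 + s) ^ i) *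
          ‖iteratedFDeriv ℝ i (E s) x‖ₑ
        ≤ ∑ i ∈ Finset.range (N + 1),
          ENNReal.ofReal (8 * 2 ^ (d + N) * B * (1 + s) ^ (1 / 4 : ℝ)) := by
          refine Finset.sum_le_sum fun i hi => ?_
          have hi' : i ≤ N := by simpa [Nat.lt_succ_iff] using hi
          have h2 := (h s hs i hi').2
          rw [eLpNorm_one_eq_lintegral_enorm] at h2
          rw [lintegral_const_mul' _ _ ENNReal.ofReal_ne_top]
          calc _ ≤ ENNReal.ofReal (2 ^ (d + N)) * (ENNReal.ofReal (jb s ^ i) *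
                ∫⁻ x, ‖iteratedFDeriv ℝ i (E s) x‖ₑ) := by
                rw [← mul_assoc, ← ENNReal.ofReal_mul (by positivity)]
                gcongr
                calc (1 + s) ^ i ≤ (2 * jb s) ^ i :=
                      pow_le_pow_left₀ (by linarith) (le_two_mul_jb s) _
                  _ = 2 ^ i * jb s ^ i := mul_pow _ _ _
                  _ ≤ 2 ^ (d + N) * jb s ^ i := by
                      gcongr
                      · norm_num
                      · omega
            _ ≤ ENNReal.ofReal (2 ^ (d + N)) *
                ENNReal.ofReal (B * (8 * (1 + s) ^ (1 / 4 : ℝ))) := by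
                refine mul_le_mul_right (h2.trans (ENNReal.ofReal_le_ofReal ?_)) _
                exact mul_le_mul_of_nonneg_left (log_two_add_le hs) hB
            _ = _ := by
                rw [← ENNReal.ofReal_mul (by positivity)]
                congr 1
                ring
      _ = _ := by
          rw [Finset.sum_const, Finset.card_range, ← ENNReal.ofReal_nsmul, nsmul_eq_mul]
          congr 1
          push_cast
          ring
  · have hi' : i ≤ N := by simpa [Nat.lt_succ_iff] using hi
    have := ((hE.1 s hs).continuous_iteratedFDeriv (m := i) (by exact_mod_cast hi'))
    exact (measurable_const.mul this.enorm.measurable).aemeasurable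

lemma lintegral_comp_sub_smul (f : Sp d → ℝ≥0∞) (x : Sp d) {r : ℝ} (hr : 0 < r) :
    ENNReal.ofReal (r ^ d) * ∫⁻ u, f (x - r • u) = ∫⁻ u, f u := by
  have h1 : MeasurableEmbedding fun u : Sp d => r • u :=
    (Homeomorph.smulOfNeZero r hr.ne').measurableEmbedding
  have h2 := h1.lintegral_map (μ := volume) (f := fun u => f (x - u))
  rw [Measure.map_addHaar_smul _ hr.ne', lintegral_smul_measure,
    lintegral_sub_left_eq_self f x, finrank_euclideanSpace_fin, smul_eq_mul,
    abs_of_nonneg (by positivity)] at h2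
  rw [← h2, ← mul_assoc, ← ENNReal.ofReal_mul (by positivity),
    mul_inv_cancel₀ (by positivity), ENNReal.ofReal_one, one_mul]

end Fields

end VlasovForcing

namespace VlasovForcing

/-! ### Dispersive estimates at a fixed source time -/

section Kernel

variable {d N : ℕ} {E : ℝ → Sp d → Sp d} {B s t : ℝ}

lemma wt_le_one (v : Sp d) : wt d v ≤ 1 :=
  Real.rpow_le_one_of_one_le_of_nonpos (by linarith [norm_nonneg v])
    (by linarith [(Nat.cast_nonneg d : (0 : ℝ) ≤ d)])

/-- The mass of the weight. -/
def wtMass (d : ℕ) : ℝ := ∫ v, wt d v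

lemma wtMass_nonneg : 0 ≤ wtMass d := integral_nonneg fun v => wt_nonneg v

lemma lintegral_wt : ∫⁻ v, ENNReal.ofReal (wt d v) = ENNReal.ofReal (wtMass d) :=
  (ofReal_integral_eq_lintegral_ofReal integrable_wt (ae_of_all _ fun v => wt_nonneg v)).symm

/-- Two regimes. If `t-s ≤ 1+s`, then `⟨t⟩ ≤ 2(1+s)`, so the pointwise decay of the field suffices
and the weight is integrated. Otherwise `⟨t⟩ ≤ 2(t-s)`, the weight is bounded by one, and the
substitution `y = x-(t-s)u` leads to the `L^1` norm of the field. -/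
lemma lintegral_wt_mul_env_le (hs : 0 ≤ s) (hst : s < t) (hB : 0 ≤ B)
    (h1 : ∀ x, (1 + s) ^ d * env N E s x ≤ B) (h2 : ∫⁻ x, ENNReal.ofReal (env N E s x) ≤
      ENNReal.ofReal B) (x : Sp d) :
    ENNReal.ofReal (jb t ^ d) * ∫⁻ u, ENNReal.ofReal (wt d u * env N E s (x - (t - s) • u))
      ≤ ENNReal.ofReal (2 ^ d * (wtMass d + 1) * B) := by
  have hj := Flow.jb_pos t
  have hjt := jb_le (hs.trans hst.le)
  have hW := wtMass_nonneg (d := d)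
  rcases le_total (t - s) (1 + s) with hts | hts
  · rw [← lintegral_const_mul' _ _ ENNReal.ofReal_ne_top]
    calc _ ≤ ∫⁻ u, ENNReal.ofReal (2 ^ d * B) * ENNReal.ofReal (wt d u) := by
          refine lintegral_mono fun u => ?_
          rw [← ENNReal.ofReal_mul (by positivity), ← ENNReal.ofReal_mul (by positivity)]
          refine ENNReal.ofReal_le_ofReal ?_
          have h3 := env_nonneg (N := N) (E := E) hs (x - (t - s) • u)
          have h4 := wt_nonneg u
          calc _ ≤ (2 * (1 + s)) ^ d * (wt d u * env N E s (x - (t - s) • u)) := by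
                gcongr
                linarith
            _ = 2 ^ d * wt d u * ((1 + s) ^ d * env N E s (x - (t - s) • u)) := by
                rw [mul_pow]
                ring
            _ ≤ 2 ^ d * wt d u * B := by gcongr; exact h1 _
            _ = _ := by ring
      _ = ENNReal.ofReal (2 ^ d * B * wtMass d) := by
          rw [lintegral_const_mul' _ _ ENNReal.ofReal_ne_top, lintegral_wt,
            ← ENNReal.ofReal_mul (by positivity)]
      _ ≤ _ := by
          refine ENNReal.ofReal_le_ofReal ?_
          have : 0 ≤ 2 ^ d * B := by positivity
          nlinarith
  · have hts0 : 0 < t - s := by linarith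
    calc _ ≤ ENNReal.ofReal (2 ^ d) * (ENNReal.ofReal ((t - s) ^ d) *
          ∫⁻ u, ENNReal.ofReal (env N E s (x - (t - s) • u))) := by
          rw [← mul_assoc, ← ENNReal.ofReal_mul (by positivity), ← mul_pow]
          gcongr with u
          · linarith
          · exact mul_le_of_le_one_left (env_nonneg hs _) (wt_le_one u)
      _ ≤ ENNReal.ofReal (2 ^ d) * ENNReal.ofReal B := by
          rw [lintegral_comp_sub_smul (fun y => ENNReal.ofReal (env N E s y)) x hts0]
          gcongr
      _ ≤ _ := by
          rw [← ENNReal.ofReal_mul (by positivity)]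
          refine ENNReal.ofReal_le_ofReal ?_
          have : 0 ≤ 2 ^ d * B := by positivity
          nlinarith

/-- Freezing the field at negative times yields joint continuity on all of `ℝ × Sp d`, hence the
joint measurability needed to exchange integrals; on `(0,t]` nothing changes. -/
lemma continuous_env (hE : FieldRegular N E) :
    Continuous fun p : ℝ × Sp d => env N E (max p.1 0) p.2 :=
  (continuousOn_env hE).comp_continuous (f := fun p : ℝ × Sp d => (max p.1 0, p.2))
    (by fun_prop) fun p => ⟨mem_Ici.2 (le_max_right _ _), mem_univ _⟩

lemma lintegral_lintegral_wt_mul_env_le (hE : FieldRegular N E) (hs : 0 ≤ s)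
    (h2 : ∫⁻ x, ENNReal.ofReal (env N E s x) ≤ ENNReal.ofReal B) :
    ∫⁻ x, ∫⁻ u, ENNReal.ofReal (wt d u * env N E s (x - (t - s) • u))
      ≤ ENNReal.ofReal (wtMass d * B) := by
  have hc : Continuous (env N E s) := by
    have := (continuous_env hE).comp (f := fun y : Sp d => (s, y)) (by fun_prop)
    simpa [Function.comp_def, max_eq_left hs] using this
  have hcw := continuous_wt (d := d)
  have hm : Measurable fun p : Sp d × Sp d => wt d p.2 * env N E s (p.1 - (t - s) • p.2) :=
    Continuous.measurable (by fun_prop)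
  rw [lintegral_lintegral_swap hm.ennreal_ofReal.aemeasurable]
  calc ∫⁻ u, ∫⁻ x, ENNReal.ofReal (wt d u * env N E s (x - (t - s) • u))
      = ∫⁻ u, ENNReal.ofReal (wt d u) * ∫⁻ x, ENNReal.ofReal (env N E s x) := by
        refine lintegral_congr fun u => ?_
        simp only [ENNReal.ofReal_mul (wt_nonneg u)]
        rw [lintegral_const_mul' _ _ ENNReal.ofReal_ne_top,
          lintegral_sub_right_eq_self (fun y => ENNReal.ofReal (env N E s y))]
    _ ≤ ∫⁻ u, ENNReal.ofReal (wt d u) * ENNReal.ofReal B := by gcongr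
    _ = _ := by
        rw [lintegral_mul_const' _ _ ENNReal.ofReal_ne_top, lintegral_wt,
          ← ENNReal.ofReal_mul wtMass_nonneg]

lemma lintegral_rpow_weight_le (ht : 0 ≤ t) {c : ℝ} (hc : 0 ≤ c) :
    ∫⁻ s in Ioc 0 t, ENNReal.ofReal (c * (1 + s) ^ (-(3 / 2) : ℝ)) ≤ ENNReal.ofReal (2 * c) := by
  have h1 : IntegrableOn (fun s : ℝ => c * (1 + s) ^ (-(3 / 2) : ℝ)) (Ioc 0 t) :=
    (((continuousOn_rpow_weight le_rfl).const_mul c).integrableOn_Icc).mono_set Ioc_subset_Icc_self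
  rw [← ofReal_integral_eq_lintegral_ofReal h1]
  · refine ENNReal.ofReal_le_ofReal ?_
    rw [integral_const_mul, ← intervalIntegral.integral_of_le ht]
    have := integral_rpow_tail le_rfl ht (r := 3 / 2) (by norm_num)
    norm_num at this
    rw [mul_comm 2]
    gcongr
  · filter_upwards [ae_restrict_mem measurableSet_Ioc] with s hs
    exact mul_nonneg hc (Real.rpow_nonneg (by linarith [hs.1]) _)

lemma mul_eLpNorm_top_le {G : Type*} [NormedAddCommGroup G] {f : Sp d → G} {c : ℝ} (hc : 0 < c)
    {M : ℝ≥0∞} (h : ∀ᵐ x, ENNReal.ofReal c * ‖f x‖ₑ ≤ M) :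
    ENNReal.ofReal c * eLpNorm f ∞ volume ≤ M := by
  have hc0 : ENNReal.ofReal c ≠ 0 := by simpa using hc
  rw [mul_comm, ← ENNReal.le_div_iff_mul_le (Or.inl hc0) (Or.inl ENNReal.ofReal_ne_top),
    eLpNorm_exponent_top]
  refine eLpNormEssSup_le_of_ae_enorm_bound (h.mono fun x hx => ?_)
  rw [ENNReal.le_div_iff_mul_le (Or.inl hc0) (Or.inl ENNReal.ofReal_ne_top), mul_comm]
  exact hx

end Kernel

/-! ### The quadratic bound for the reaction term -/

namespace Flow

variable {d N : ℕ} {E : ℝ → Sp d → Sp d} {e t D B κ : ℝ} {X V : ℝ → ℝ → Sp d → Sp d → Sp d}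
  (S : Flow N E e t D X V) {μ : Sp d → ℝ}

/-- The deviation decays with exponent `-7/4` and the field envelope grows with exponent at most
`1/4`; their product has the integrable exponent `-3/2`. -/
lemma ofReal_mul_dev_mul {K M s : ℝ} (hs : 0 ≤ s) (hK : 0 ≤ K) :
    ENNReal.ofReal (K * S.dev s) * ENNReal.ofReal (M * (B * (1 + s) ^ (1 / 4 : ℝ)))
      = ENNReal.ofReal (K * (e * flowConst N) * M * B * (1 + s) ^ (-(3 / 2) : ℝ)) := by
  have := S.dev_nonneg hs
  rw [← ENNReal.ofReal_mul (by positivity)]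
  congr 1
  have h1 : (1 + s) ^ (-(3 / 2) : ℝ) = (1 + s) ^ (-(7 / 4) : ℝ) * (1 + s) ^ (1 / 4 : ℝ) := by
    rw [← Real.rpow_add (by linarith)]
    norm_num
  rw [h1, dev]
  ring

/-- The bounds for the derivatives of the reaction term. -/
theorem eLpNorm_iteratedFDeriv_termR_le (S : Flow N E e t D X V) (hD : 0 ≤ D)
    (hg : ContDiff ℝ (N + 1 : ℕ) (fderiv ℝ μ))
    (hκ : ∀ i, i ≤ N + 1 → ∀ v, ‖iteratedFDeriv ℝ i (fderiv ℝ μ) v‖ ≤ κ * wt d v) (hκ0 : 0 ≤ κ)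
    (hB : 0 ≤ B) (h1 : ∀ s, 0 ≤ s → ∀ x, (1 + s) ^ d * env N E s x ≤ B * (1 + s) ^ (1 / 4 : ℝ))
    (h2 : ∀ s, 0 ≤ s → ∫⁻ x, ENNReal.ofReal (env N E s x)
      ≤ ENNReal.ofReal (B * (1 + s) ^ (1 / 4 : ℝ))) {k : ℕ} (hk : k ≤ N) :
    ENNReal.ofReal (jb t ^ k) * eLpNorm (iteratedFDeriv ℝ k (termR E μ X V t)) 1 volume
      + ENNReal.ofReal (jb t ^ (d + k)) * eLpNorm (iteratedFDeriv ℝ k (termR E μ X V t)) ∞ volume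
      ≤ ENNReal.ofReal (4 * (2 * ((D + 2) * pairConst d N κ * 2 ^ ((d : ℝ) + 1)) *
        (e * flowConst N) * (2 ^ d * (wtMass d + 1)) * B)) := by
  have hpc := pairConst_nonneg (d := d) (N := N) hκ0
  have hsm := S.small_nonneg
  have hW := wtMass_nonneg (d := d)
  have hj := jb_pos t
  have hpt := S.enorm_iteratedFDeriv_termR_le hD hg hκ hκ0 hk
  set K := 2 * ((D + 2) * pairConst d N κ * 2 ^ ((d : ℝ) + 1)) with hK
  have hK0 : 0 ≤ K := by positivity
  have hpos : ∀ s, 0 ≤ s → 0 ≤ B * (1 + s) ^ (1 / 4 : ℝ) := fun s hs =>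
    mul_nonneg hB (Real.rpow_nonneg (by linarith) _)
  have hsup : ENNReal.ofReal (jb t ^ (d + k)) *
      eLpNorm (iteratedFDeriv ℝ k (termR E μ X V t)) ∞ volume
      ≤ ENNReal.ofReal (2 * (K * (e * flowConst N) * (2 ^ d * (wtMass d + 1)) * B)) := by
    refine mul_eLpNorm_top_le (by positivity) (ae_of_all _ fun x => ?_)
    rw [pow_add, ENNReal.ofReal_mul (by positivity), mul_assoc]
    refine (mul_le_mul_right (hpt x) _).trans ?_
    rw [← lintegral_const_mul' _ _ ENNReal.ofReal_ne_top]
    refine le_trans (lintegral_mono_ae ?_) (lintegral_rpow_weight_le S.time_nonneg (by positivity))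
    filter_upwards [ae_restrict_mem measurableSet_Ioc, (Measure.ae_ne volume t).filter_mono
      (ae_mono Measure.restrict_le_self)] with s hs hst
    rw [mul_left_comm, ← S.ofReal_mul_dev_mul hs.1.le hK0]
    exact mul_le_mul_right (lintegral_wt_mul_env_le hs.1.le (lt_of_le_of_ne hs.2 hst)
      (hpos s hs.1.le) (h1 s hs.1.le) (h2 s hs.1.le) x) _
  have hone : ENNReal.ofReal (jb t ^ k) *
      eLpNorm (iteratedFDeriv ℝ k (termR E μ X V t)) 1 volume
      ≤ ENNReal.ofReal (2 * (K * (e * flowConst N) * (2 ^ d * (wtMass d + 1)) * B)) := by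
    rw [eLpNorm_one_eq_lintegral_enorm, ← lintegral_const_mul' _ _ ENNReal.ofReal_ne_top]
    refine (lintegral_mono hpt).trans ?_
    have hcw := continuous_wt (d := d)
    have hce := continuous_env S.field.regular
    have hdev : Measurable S.dev := by
      unfold dev
      fun_prop
    have hmeas : Measurable fun p : Sp d × ℝ => ENNReal.ofReal (K * S.dev p.2) *
        ∫⁻ u, ENNReal.ofReal (wt d u * env N E (max p.2 0) (p.1 - (t - p.2) • u)) := by
      refine Measurable.mul (by fun_prop) ?_
      refine Measurable.lintegral_prod_right'
        (f := fun q : (Sp d × ℝ) × Sp d => ENNReal.ofReal (wt d q.2 *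
          env N E (max q.1.2 0) (q.1.1 - (t - q.1.2) • q.2))) ?_
      have h3 : Continuous fun q : (Sp d × ℝ) × Sp d =>
          env N E (max q.1.2 0) (q.1.1 - (t - q.1.2) • q.2) :=
        hce.comp (f := fun q : (Sp d × ℝ) × Sp d => (q.1.2, q.1.1 - (t - q.1.2) • q.2))
          (by fun_prop)
      exact (Continuous.measurable (by fun_prop)).ennreal_ofReal
    have hcongr : ∀ x : Sp d, ∫⁻ s in Ioc 0 t, ENNReal.ofReal (K * S.dev s) *
          ∫⁻ u, ENNReal.ofReal (wt d u * env N E s (x - (t - s) • u))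
        = ∫⁻ s in Ioc 0 t, ENNReal.ofReal (K * S.dev s) *
          ∫⁻ u, ENNReal.ofReal (wt d u * env N E (max s 0) (x - (t - s) • u)) := by
      intro x
      refine setLIntegral_congr_fun measurableSet_Ioc fun s hs => ?_
      simp only [max_eq_left hs.1.le]
    simp only [hcongr]
    rw [lintegral_lintegral_swap hmeas.aemeasurable]
    refine le_trans (lintegral_mono_ae ?_) (lintegral_rpow_weight_le S.time_nonneg (by positivity))
    filter_upwards [ae_restrict_mem measurableSet_Ioc] with s hs
    rw [lintegral_const_mul' _ _ ENNReal.ofReal_ne_top, ← S.ofReal_mul_dev_mul hs.1.le hK0,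
      max_eq_left hs.1.le]
    refine mul_le_mul_right ((lintegral_lintegral_wt_mul_env_le S.field.regular hs.1.le
      (h2 s hs.1.le)).trans (ENNReal.ofReal_le_ofReal ?_)) _
    refine mul_le_mul_of_nonneg_right ?_ (hpos s hs.1.le)
    have : (1 : ℝ) ≤ 2 ^ d := one_le_pow₀ (by norm_num)
    nlinarith
  refine (add_le_add hone hsup).trans_eq ?_
  rw [← ENNReal.ofReal_add (by positivity) (by positivity)]
  congr 1
  ring

end Flow

end VlasovForcing

namespace VlasovForcing

/-! ### Smooth approximation of weakly differentiable functions -/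

section Mollification

variable {F : Type*} [NormedAddCommGroup F] [NormedSpace ℝ F] [FiniteDimensional ℝ F]
  [MeasureSpace F] [BorelSpace F] [(volume : Measure F).IsAddHaarMeasure]
  {G : Type*} [NormedAddCommGroup G] [NormedSpace ℝ G]

/-- Continuity of translations in `L^1`. -/
lemma exists_translation_le {g : F → G} (hg : Integrable g) {δ : ℝ≥0∞} (hδ : δ ≠ 0) :
    ∃ r : ℝ, 0 < r ∧ ∀ w, ‖w‖ < r → ∫⁻ z, ‖g (z - w) - g z‖ₑ ≤ δ := by
  have hg1 : MemLp g 1 := memLp_one_iff_integrable.2 hg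
  let T : F → C(F, F) := fun w => ⟨fun z => z - w, by fun_prop⟩
  have hT : Continuous T := ContinuousMap.continuous_of_continuous_uncurry _ (by
    change Continuous fun p : F × F => p.2 - p.1
    fun_prop)
  have hmp : ∀ w, MeasurePreserving (T w) (volume : Measure F) volume :=
    fun w => measurePreserving_sub_right volume w
  have hc : Continuous fun w => Lp.compMeasurePreserving (T w) (hmp w) (hg1.toLp g) :=
    continuous_const.compMeasurePreservingLp hT hmp ENNReal.one_ne_top
  obtain ⟨r, hr, hball⟩ := EMetric.continuousAt_iff.1 (hc.continuousAt (x := 0)) δ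
    (pos_iff_ne_zero.2 hδ)
  obtain ⟨r', hr', hle⟩ := ENNReal.lt_iff_exists_real_btwn.1 hr
  have hr0 : 0 < r' := ENNReal.ofReal_pos.1 hle.1
  refine ⟨r', hr0, fun w hw => ?_⟩
  have h1 := hball (x := w) (by
    rw [edist_zero_right, ← ofReal_norm]
    exact lt_trans ((ENNReal.ofReal_lt_ofReal_iff hr0).2 hw) hle.2)
  simp only [Lp.toLp_compMeasurePreserving] at h1
  rw [Lp.edist_toLp_toLp, eLpNorm_one_eq_lintegral_enorm] at h1
  have h2 : ∀ z, (g ∘ T w - g ∘ T 0) z = g (z - w) - g z := fun z => by simp [T]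
  simp only [h2] at h1
  exact h1.le

lemma iteratedFDeriv_comp_const_sub {f : F → G} {k : ℕ} (hf : ContDiff ℝ k f) (a z : F) :
    iteratedFDeriv ℝ k (fun z => f (a - z)) z = (-1 : ℝ) ^ k • iteratedFDeriv ℝ k f (a - z) := by
  have h1 := iteratedFDeriv_comp_const_smul (f := fun z => f (a + z)) (-1 : ℝ)
    (hf.comp (contDiff_const.add contDiff_id))
  have h2 := congrFun h1 z
  simp only [iteratedFDeriv_comp_add_left, neg_smul, one_smul, ← sub_eq_add_neg] at h2
  exact h2

lemma exists_bound_iteratedFDeriv {φ : F → ℝ} {k : ℕ} (hφ : ContDiff ℝ k φ)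
    (hc : HasCompactSupport φ) : ∃ C, ∀ z, ‖iteratedFDeriv ℝ k φ z‖ ≤ C := by
  obtain ⟨C, hC⟩ := (hc.iteratedFDeriv k).exists_bound_of_continuous
    (hφ.continuous_iteratedFDeriv le_rfl)
  exact ⟨C, hC⟩

/-- Convolution with a smooth kernel. -/
def mollify (ρ : F → ℝ) (g : F → G) (z : F) : G := ∫ y, ρ (z - y) • g y

variable {N : ℕ} {ρ : F → ℝ}

lemma integrable_mollify (hρ : Continuous ρ) (hρc : HasCompactSupport ρ) {g : F → G}
    (hg : Integrable g) (z : F) : Integrable fun y => ρ (z - y) • g y := by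
  obtain ⟨C, hC⟩ := hρc.exists_bound_of_continuous hρ
  exact hg.bdd_smul C (hρ.comp (continuous_const.sub continuous_id)).aestronglyMeasurable
    (ae_of_all _ fun y => hC _)

lemma iteratedFDeriv_mollify_aux (hρ : ContDiff ℝ ∞ ρ) (hρc : HasCompactSupport ρ) {f : F → ℝ}
    (hf : Integrable f) :
    ContDiff ℝ N (mollify ρ f) ∧ ∀ k, k ≤ N → ∀ z,
      iteratedFDeriv ℝ k (mollify ρ f) z = ∫ y, f y • iteratedFDeriv ℝ k ρ (z - y) := by
  have hsm : ∀ k : ℕ, ContDiff ℝ k ρ := fun k => hρ.of_le (by exact_mod_cast le_top)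
  have hder : ∀ k : ℕ, ∀ y z : F, iteratedFDeriv ℝ k (fun z => ρ (z - y) • f y) z
      = f y • iteratedFDeriv ℝ k ρ (z - y) := by
    intro k y z
    have h1 : (fun z => ρ (z - y) • f y) = fun z => f y • ρ (z - y) := by
      ext1 z
      simp [mul_comm]
    have h2 : ContDiff ℝ k fun z => ρ (z - y) := (hsm k).comp (contDiff_id.sub contDiff_const)
    rw [h1, iteratedFDeriv_const_smul_apply' h2.contDiffAt]
    congr 1
    exact iteratedFDeriv_comp_sub k y z
  have := contDiff_integral_of_dominated (m := volume) (N := N)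
    (F := fun y z => ρ (z - y) • f y)
    (fun y => ((hsm N).comp (contDiff_id.sub contDiff_const)).smul contDiff_const)
    (fun k hk z => ?_) fun k hk z₀ => ?_
  · simp only [hder] at this
    exact this
  · simp only [hder]
    refine hf.aestronglyMeasurable.smul (Continuous.aestronglyMeasurable ?_)
    exact ((hsm k).continuous_iteratedFDeriv le_rfl).comp (continuous_const.sub continuous_id)
  · obtain ⟨C, hC⟩ := exists_bound_iteratedFDeriv (hsm k) hρc
    refine ⟨fun y => ‖f y‖ * C, hf.norm.mul_const C, ae_of_all _ fun y z _ => ?_⟩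
    rw [hder, norm_smul]
    exact mul_le_mul_of_nonneg_left (hC _) (norm_nonneg _)

/-- The derivatives of a mollified function are the mollified weak derivatives. -/
lemma iteratedFDeriv_mollify (hρ : ContDiff ℝ ∞ ρ) (hρc : HasCompactSupport ρ) {f : F → ℝ}
    (hf : Integrable f) {k : ℕ} {g : F → ContinuousMultilinearMap ℝ (fun _ : Fin k => F) ℝ}
    (hg : Integrable g) (hfg : IsWeakDeriv k f g) (z : F) :
    iteratedFDeriv ℝ k (mollify ρ f) z = mollify ρ g z := by
  have hsm : ContDiff ℝ k ρ := hρ.of_le (by exact_mod_cast le_top)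
  rw [(iteratedFDeriv_mollify_aux hρ hρc hf).2 k le_rfl z, mollify]
  obtain ⟨C, hC⟩ := exists_bound_iteratedFDeriv hsm hρc
  ext m
  have h1 : Integrable fun y => f y • iteratedFDeriv ℝ k ρ (z - y) :=
    hf.smul_bdd C (((hsm.continuous_iteratedFDeriv le_rfl).comp
      (continuous_const.sub continuous_id)).aestronglyMeasurable) (ae_of_all _ fun y => hC _)
  rw [ContinuousMultilinearMap.integral_apply h1,
    ContinuousMultilinearMap.integral_apply (integrable_mollify hρ.continuous hρc hg z)]
  have h2 := hfg.2.2 (fun y => ρ (z - y)) (hρ.comp (contDiff_const.sub contDiff_id))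
    (hρc.comp_homeomorph (Homeomorph.subLeft z)) m
  simp only [iteratedFDeriv_comp_const_sub hsm] at h2
  simp only [FunLike.coe_smul, Pi.smul_apply, smul_eq_mul] at h2 ⊢
  -- One sign comes from the definition of the weak derivative, the other from the reflection `y ↦ z
  -- - y` in the kernel.
  have h3 : ((-1 : ℝ) ^ k) * (-1) ^ k = 1 := by rw [← mul_pow]; simp
  calc ∫ y, f y * iteratedFDeriv ℝ k ρ (z - y) m
      = ((-1 : ℝ) ^ k) * ∫ y, f y * ((-1) ^ k * iteratedFDeriv ℝ k ρ (z - y) m) := by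
        rw [← integral_const_mul]
        refine integral_congr_ae (ae_of_all _ fun y => ?_)
        linear_combination (-(f y * iteratedFDeriv ℝ k ρ (z - y) m)) * h3
    _ = ∫ y, g y m * ρ (z - y) := by rw [h2, ← mul_assoc, h3, one_mul]
    _ = _ := integral_congr_ae (ae_of_all _ fun y => mul_comm _ _)

/-- Mollification with a kernel supported near the origin is close to the identity in `L^1`. -/
lemma lintegral_mollify_sub_le [CompleteSpace G] (hρ : Continuous ρ) (hρc : HasCompactSupport ρ)
    (hρ0 : ∀ z, 0 ≤ ρ z) (hρ1 : ∫ z, ρ z = 1) {r : ℝ} (hr : ∀ w, r ≤ ‖w‖ → ρ w = 0) {g : F → G}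
    (hg : Integrable g) {δ : ℝ≥0∞} (hδ : ∀ w, ‖w‖ < r → ∫⁻ z, ‖g (z - w) - g z‖ₑ ≤ δ) :
    ∫⁻ z, ‖mollify ρ g z - g z‖ₑ ≤ δ := by
  have hρi : Integrable ρ := hρ.integrable_of_hasCompactSupport hρc
  have h1 : ∀ z, mollify ρ g z - g z = ∫ w, ρ w • (g (z - w) - g z) := by
    intro z
    have h2 : mollify ρ g z = ∫ w, ρ w • g (z - w) := by
      rw [mollify, ← integral_sub_left_eq_self _ _ z]
      simp
    have h3 : Integrable fun w => ρ w • g (z - w) := by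
      have := (integrable_mollify hρ hρc hg z).comp_sub_left z
      simpa using this
    simp only [smul_sub]
    rw [integral_sub h3 (hρi.smul_const _), integral_smul_const, hρ1, one_smul, h2]
  have hmeas : AEMeasurable (Function.uncurry fun z w : F => ‖ρ w • (g (z - w) - g z)‖ₑ)
      ((volume : Measure F).prod volume) := by
    have h4 : AEStronglyMeasurable (fun p : F × F => g (p.1 - p.2))
        ((volume : Measure F).prod volume) :=
      hg.aestronglyMeasurable.comp_quasiMeasurePreserving
        (quasiMeasurePreserving_sub_of_right_invariant volume volume)
    have h5 : AEStronglyMeasurable (fun p : F × F => g p.1) ((volume : Measure F).prod volume) :=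
      hg.aestronglyMeasurable.comp_fst
    exact ((hρ.comp continuous_snd).aestronglyMeasurable.smul (h4.sub h5)).enorm
  calc ∫⁻ z, ‖mollify ρ g z - g z‖ₑ
      ≤ ∫⁻ z, ∫⁻ w, ‖ρ w • (g (z - w) - g z)‖ₑ := by
        refine lintegral_mono fun z => ?_
        rw [h1]
        exact enorm_integral_le_lintegral_enorm _
    _ = ∫⁻ w, ∫⁻ z, ‖ρ w • (g (z - w) - g z)‖ₑ := lintegral_lintegral_swap hmeas
    _ ≤ ∫⁻ w, ENNReal.ofReal (ρ w) * δ := by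
        refine lintegral_mono fun w => ?_
        simp only [enorm_smul]
        rw [lintegral_const_mul' _ _ enorm_ne_top, Real.enorm_of_nonneg (hρ0 w)]
        rcases lt_or_ge ‖w‖ r with hw | hw
        · exact mul_le_mul_right (hδ w hw) _
        · simp [hr w hw]
    _ = δ := by
        rw [lintegral_mul_const'' _ hρ.measurable.ennreal_ofReal.aemeasurable,
          ← ofReal_integral_eq_lintegral_ofReal hρi (ae_of_all _ hρ0), hρ1, ENNReal.ofReal_one,
          one_mul]

/-- Functions with integrable weak derivatives are limits of smooth functions. -/
theorem exists_contDiff_approx {f : F → ℝ} (hf : Integrable f)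
    {g : (k : ℕ) → F → ContinuousMultilinearMap ℝ (fun _ : Fin k => F) ℝ}
    (hg : ∀ k, k ≤ N → Integrable (g k) ∧ IsWeakDeriv k f (g k)) {δ : ℝ≥0∞} (hδ : δ ≠ 0) :
    ∃ h : F → ℝ, ContDiff ℝ N h ∧ ∀ k, k ≤ N → ∫⁻ z, ‖iteratedFDeriv ℝ k h z - g k z‖ₑ ≤ δ := by
  have h1 : ∀ k, ∃ r : ℝ, 0 < r ∧ (k ≤ N → ∀ w, ‖w‖ < r → ∫⁻ z, ‖g k (z - w) - g k z‖ₑ ≤ δ) := by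
    intro k
    by_cases hk : k ≤ N
    · obtain ⟨r, hr, h⟩ := exists_translation_le (hg k hk).1 hδ
      exact ⟨r, hr, fun _ => h⟩
    · exact ⟨1, one_pos, fun h => absurd h hk⟩
  choose r hr hle using h1
  -- A single radius for the finitely many orders lets one mollification approximate all derivatives
  -- at once.
  obtain ⟨r₀, hr₀, hmin⟩ : ∃ r₀ : ℝ, 0 < r₀ ∧ ∀ k, k ≤ N → r₀ ≤ r k := by
    refine ⟨(Finset.range (N + 1)).inf' Finset.nonempty_range_add_one r, ?_, fun k hk => ?_⟩
    · exact (Finset.lt_inf'_iff _).2 fun k _ => hr k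
    · exact Finset.inf'_le _ (by simp; omega)
  let b : ContDiffBump (0 : F) := ⟨r₀ / 2, r₀, by positivity, by linarith⟩
  have hρ : ContDiff ℝ ∞ (b.normed volume) := b.contDiff_normed
  have hρc := b.hasCompactSupport_normed (μ := (volume : Measure F))
  refine ⟨mollify (b.normed volume) f, (iteratedFDeriv_mollify_aux hρ hρc hf).1, fun k hk => ?_⟩
  simp only [iteratedFDeriv_mollify hρ hρc hf (hg k hk).1 (hg k hk).2]
  refine lintegral_mollify_sub_le hρ.continuous hρc b.nonneg_normed b.integral_normed
    (r := r₀) (fun w hw => ?_) (hg k hk).1 fun w hw => hle k hk w (hw.trans_le (hmin k hk))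
  have : w ∉ Function.support (b.normed (volume : Measure F)) := by
    rw [b.support_normed_eq, mem_ball_zero_iff, not_lt]
    exact hw
  simpa using this

end Mollification

end VlasovForcing

namespace VlasovForcing

/-! ### Integration by parts of arbitrary order -/

section IntegrationByParts

variable {F : Type*} [NormedAddCommGroup F] [NormedSpace ℝ F] [FiniteDimensional ℝ F]
  [MeasureSpace F] [BorelSpace F] [(volume : Measure F).IsAddHaarMeasure]

open Pointwise

lemma isCompact_tsupport_add_closedBall {φ : F → ℝ} (hc : HasCompactSupport φ) (h₀ : F) :
    IsCompact (tsupport φ + Metric.closedBall h₀ 1) :=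
  hc.isCompact.add (isCompact_closedBall h₀ 1)

/-- This and the primed version differentiate the same correlation `∫ φ(x) u(x+h) dx` at `h = 0`,
once through `u` and once, after translating, through `φ`. Equating the results is integration by
parts of order `k`, without induction on boundary terms. -/
lemma iteratedFDeriv_integral_mul_translate {k : ℕ} {u φ : F → ℝ} (hu : ContDiff ℝ k u)
    (hφ : Continuous φ) (hc : HasCompactSupport φ) :
    iteratedFDeriv ℝ k (fun h => ∫ x, φ x • u (x + h)) 0
      = ∫ x, φ x • iteratedFDeriv ℝ k u x := by
  have hd : ∀ j : ℕ, j ≤ k → ∀ x h : F, iteratedFDeriv ℝ j (fun h => φ x • u (x + h)) h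
      = φ x • iteratedFDeriv ℝ j u (x + h) := by
    intro j hj x h
    have h1 : ContDiff ℝ k fun h => u (x + h) := hu.comp (contDiff_const.add contDiff_id)
    rw [iteratedFDeriv_const_smul_apply' (h1.of_le (by exact_mod_cast hj)).contDiffAt,
      iteratedFDeriv_comp_add_left]
  have hcont : ∀ j, j ≤ k → Continuous (iteratedFDeriv ℝ j u) :=
    fun j hj => hu.continuous_iteratedFDeriv (by exact_mod_cast hj)
  have := contDiff_integral_of_dominated (m := volume) (N := k)
    (F := fun x h => φ x • u (x + h))
    (fun x => (hu.comp (contDiff_const.add contDiff_id)).const_smul _)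
    (fun j hj h => ?_) fun j hj h₀ => ?_
  · rw [this.2 k le_rfl 0]
    simp only [hd k le_rfl, add_zero]
  · simp only [hd j hj]
    exact (hφ.smul ((hcont j hj).comp (continuous_id.add continuous_const))).aestronglyMeasurable
  · obtain ⟨M, hM⟩ := (isCompact_tsupport_add_closedBall hc h₀).exists_bound_of_continuousOn
      (hcont j hj).continuousOn
    refine ⟨fun x => ‖φ x‖ * M, (hφ.integrable_of_hasCompactSupport hc).norm.mul_const M,
      ae_of_all _ fun x h hh => ?_⟩
    rw [hd j hj, norm_smul]
    by_cases hx : φ x = 0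
    · simp [hx]
    · exact mul_le_mul_of_nonneg_left (hM _ (add_mem_add (subset_tsupport φ hx)
        (Metric.ball_subset_closedBall hh))) (norm_nonneg _)

lemma iteratedFDeriv_integral_mul_translate' {k : ℕ} {u φ : F → ℝ} (hu : Continuous u)
    (hφ : ContDiff ℝ ∞ φ) (hc : HasCompactSupport φ) :
    iteratedFDeriv ℝ k (fun h => ∫ x, u x • φ (x - h)) 0
      = ∫ x, ((-1 : ℝ) ^ k * u x) • iteratedFDeriv ℝ k φ x := by
  have hsm : ∀ j : ℕ, ContDiff ℝ j φ := fun j => hφ.of_le (by exact_mod_cast le_top)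
  have hd : ∀ j : ℕ, ∀ x h : F, iteratedFDeriv ℝ j (fun h => u x • φ (x - h)) h
      = ((-1 : ℝ) ^ j * u x) • iteratedFDeriv ℝ j φ (x - h) := by
    intro j x h
    have h1 : ContDiff ℝ j fun h => φ (x - h) := (hsm j).comp (contDiff_const.sub contDiff_id)
    rw [iteratedFDeriv_const_smul_apply' h1.contDiffAt, iteratedFDeriv_comp_const_sub (hsm j),
      smul_smul, mul_comm]
  have := contDiff_integral_of_dominated (m := volume) (N := k)
    (F := fun x h => u x • φ (x - h))
    (fun x => ((hsm k).comp (contDiff_const.sub contDiff_id)).const_smul _)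
    (fun j hj h => ?_) fun j hj h₀ => ?_
  · rw [this.2 k le_rfl 0]
    simp only [hd k, sub_zero]
  · simp only [hd j]
    exact ((continuous_const.mul hu).smul (((hsm j).continuous_iteratedFDeriv le_rfl).comp
      (continuous_id.sub continuous_const))).aestronglyMeasurable
  · obtain ⟨M, hM⟩ := exists_bound_iteratedFDeriv (hsm j) hc
    have hcpt := isCompact_tsupport_add_closedBall hc h₀
    -- `u` is only continuous, so domination must be restricted to the compact set swept by the
    -- support of `φ` as `h` ranges over the unit ball.
    refine ⟨(tsupport φ + Metric.closedBall h₀ 1).indicator fun x => ‖u x‖ * M,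
      ((hu.norm.mul continuous_const).continuousOn.integrableOn_compact
        hcpt).integrable_indicator hcpt.measurableSet, ae_of_all _ fun x h hh => ?_⟩
    rw [hd j, norm_smul, norm_mul, norm_pow, norm_neg, norm_one, one_pow, one_mul]
    by_cases hx : x ∈ tsupport φ + Metric.closedBall h₀ 1
    · rw [indicator_of_mem hx]
      exact mul_le_mul_of_nonneg_left (hM _) (norm_nonneg _)
    · rw [indicator_of_notMem hx]
      have h3 : x - h ∉ tsupport (iteratedFDeriv ℝ j φ) := fun h4 =>
        hx ⟨x - h, tsupport_iteratedFDeriv_subset (𝕜 := ℝ) j h4, h,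
          Metric.ball_subset_closedBall hh, sub_add_cancel x h⟩
      rw [image_eq_zero_of_notMem_tsupport h3, norm_zero, mul_zero]

/-- Integration by parts against a test function, to any order. -/
theorem integral_mul_iteratedFDeriv {k : ℕ} {u φ : F → ℝ} (hu : ContDiff ℝ k u)
    (hφ : ContDiff ℝ ∞ φ) (hc : HasCompactSupport φ) (m : Fin k → F) :
    ∫ x, u x * iteratedFDeriv ℝ k φ x m = (-1) ^ k * ∫ x, iteratedFDeriv ℝ k u x m * φ x := by
  have hsm : ContDiff ℝ k φ := hφ.of_le (by exact_mod_cast le_top)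
  have heq : (fun h => ∫ x, φ x • u (x + h)) = fun h => ∫ x, u x • φ (x - h) := by
    ext1 h
    rw [← integral_add_right_eq_self (fun x => u x • φ (x - h)) h]
    simp [mul_comm]
  have h3 := iteratedFDeriv_integral_mul_translate hu hφ.continuous hc
  rw [heq, iteratedFDeriv_integral_mul_translate' hu.continuous hφ hc] at h3
  have hi₁ : Integrable fun x => φ x • iteratedFDeriv ℝ k u x :=
    (hφ.continuous.smul (hu.continuous_iteratedFDeriv
      le_rfl)).integrable_of_hasCompactSupport hc.smul_right
  have hi₂ : Integrable fun x => ((-1 : ℝ) ^ k * u x) • iteratedFDeriv ℝ k φ x :=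
    ((continuous_const.mul hu.continuous).smul (hsm.continuous_iteratedFDeriv
      le_rfl)).integrable_of_hasCompactSupport (hc.iteratedFDeriv k).smul_left
  have h4 := congrArg (fun M => M m) h3
  rw [ContinuousMultilinearMap.integral_apply hi₁,
    ContinuousMultilinearMap.integral_apply hi₂] at h4
  simp only [FunLike.coe_smul, Pi.smul_apply, smul_eq_mul, mul_assoc] at h4
  rw [integral_const_mul] at h4
  have h5 : ((-1 : ℝ) ^ k) * (-1) ^ k = 1 := by rw [← mul_pow]; simp
  simp only [mul_comm _ (φ _)]
  rw [← h4, ← mul_assoc, h5, one_mul]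

end IntegrationByParts

/-! ### Linearity and measurability of the Faà di Bruno expression -/

section TaylorComp

variable {E F G : Type*} [NormedAddCommGroup E] [NormedSpace ℝ E]
  [NormedAddCommGroup F] [NormedSpace ℝ F] [NormedAddCommGroup G] [NormedSpace ℝ G]

lemma taylorComp_sub (q₁ q₂ : FormalMultilinearSeries ℝ F G) (p : FormalMultilinearSeries ℝ E F)
    (k : ℕ) :
    (q₁ - q₂).taylorComp p k = q₁.taylorComp p k - q₂.taylorComp p k := by
  simp only [FormalMultilinearSeries.taylorComp, ← Finset.sum_sub_distrib]
  rfl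

/-- Each term is linear in the outer jet and multilinear in the inner jets, hence jointly
continuous. The outer jets may then be merely measurable, as weak derivatives are. -/
lemma aestronglyMeasurable_taylorComp (k : ℕ) {Z : Type*} [TopologicalSpace Z]
    [MeasurableSpace Z] [OpensMeasurableSpace Z] [SecondCountableTopology Z] {ν : Measure Z}
    {q : Z → FormalMultilinearSeries ℝ F G} {p : Z → FormalMultilinearSeries ℝ E F}
    (hq : ∀ j, j ≤ k → AEStronglyMeasurable (fun z => q z j) ν)
    (hp : ∀ i, i ≤ k → Continuous fun z => p z i) :
    AEStronglyMeasurable (fun z => (q z).taylorComp (p z) k) ν := by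
  refine Finset.aestronglyMeasurable_fun_sum _ fun c _ => ?_
  let B := c.compAlongOrderedFinpartitionL ℝ E F G
  have hB : Continuous fun x : (ContinuousMultilinearMap ℝ (fun _ : Fin c.length => F) G) ×
      (∀ i, ContinuousMultilinearMap ℝ (fun _ : Fin (c.partSize i) => E) F) => B x.1 x.2 :=
    continuous_iff_continuousAt.2 fun x =>
      (B.analyticOnNhd_uncurry_of_multilinear x (mem_univ x)).continuousAt
  have h2 : Continuous fun z i => p z (c.partSize i) :=
    continuous_pi fun i => hp _ (c.partSize_le i)
  exact hB.comp_aestronglyMeasurable ((hq _ c.length_le).prodMk h2.aestronglyMeasurable)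

end TaylorComp

/-! ### Majorants for the mixed norm -/

section MixedNorm

variable {d : ℕ} {G : Type*} [NormedAddCommGroup G]

/-- A measurable majorant of a function on phase space, depending on the position only. -/
lemma exists_measurable_majorant {g : Sp d × Sp d → G} (hg : AEStronglyMeasurable g volume) :
    ∃ h : Sp d → ℝ≥0∞, Measurable h ∧ ∫⁻ x, h x = normL1Linf g ∧
      ∀ᵐ z, ‖g z‖ₑ ≤ h z.1 := by
  obtain ⟨f, hf, hfg⟩ := hg
  have hfm : Measurable fun z => ‖f z‖ₑ := hf.enorm
  have hsec : ∀ᵐ x : Sp d, ∀ᵐ v : Sp d, g (x, v) = f (x, v) :=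
    Measure.ae_ae_of_ae_prod hfg
  have hmeas : Measurable fun x => eLpNorm (fun v => f (x, v)) ∞ volume := by
    refine measurable_of_Ioi fun a => ?_
    -- The essential supremum of a slice exceeds `a` exactly when the slice of `{‖f‖ > a}` has
    -- positive measure, and measures of slices are measurable in `x`.
    have h1 : (fun x => eLpNorm (fun v => f (x, v)) ∞ volume) ⁻¹' Ioi a
        = {x | volume (Prod.mk x ⁻¹' {z | a < ‖f z‖ₑ}) ≠ 0} := by
      ext x
      rw [mem_preimage, mem_Ioi, mem_ofPred_eq, eLpNorm_exponent_top, ← not_le, not_iff_not]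
      constructor
      · intro h2
        have h3 := ae_le_eLpNormEssSup (f := fun v => f (x, v)) (μ := volume)
        refine measure_mono_null (fun v hv => ?_) (ae_iff.1 h3)
        exact not_le.2 (h2.trans_lt hv)
      · intro h2
        refine eLpNormEssSup_le_of_ae_enorm_bound (ae_iff.2 ?_)
        simp only [not_le]
        exact h2
    rw [h1]
    exact (measurable_measure_prodMk_left (measurableSet_lt measurable_const hfm))
      (measurableSet_singleton 0).compl
  refine ⟨_, hmeas, lintegral_congr_ae ?_, ?_⟩
  · filter_upwards [hsec] with x hx
    exact eLpNorm_congr_ae (hx.mono fun v hv => hv.symm)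
  · have h1 : ∀ᵐ z : Sp d × Sp d, ‖f z‖ₑ ≤ eLpNorm (fun v => f (z.1, v)) ∞ volume := by
      change ∀ᵐ z ∂((volume : Measure (Sp d)).prod volume), _
      refine (Measure.ae_prod_iff_ae_ae (measurableSet_le hfm
        (hmeas.comp measurable_fst))).2 (ae_of_all _ fun x => ?_)
      simp only [Function.comp_apply]
      rw [eLpNorm_exponent_top]
      exact ae_le_eLpNormEssSup (f := fun v => f (x, v)) (μ := volume)
    filter_upwards [h1, hfg] with z h2 h3
    rwa [h3]

end MixedNorm

end VlasovForcing

/-! ### Pullback of jets by the flow to time zero -/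

namespace VlasovForcing
namespace Flow

variable {d N : ℕ} {E : ℝ → Sp d → Sp d} {e t D : ℝ} {X V : ℝ → ℝ → Sp d → Sp d → Sp d}
  (S : Flow N E e t D X V)

/-- The initial time. -/
def start (S : Flow N E e t D X V) : Icc (0 : ℝ) t := ⟨0, le_rfl, S.time_nonneg⟩

lemma phaseMap_frame (c : Sp d × Sp d) :
    (fun ζ => S.phaseMap (c + frame d t ζ)) = S.traj S.start c := by
  ext1 ζ
  simp [phaseMap, traj, start]

lemma contDiff_phaseMap : ContDiff ℝ N S.phaseMap :=
  (contDiff_eval S.contDiff_path _).prodMk (contDiff_snd.sub (contDiff_eval S.contDiff_drag _))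

/-- The phase-space coordinates adapted to the moving frame. -/
def slant (d : ℕ) (t : ℝ) (p : Sp d × Sp d) : Sp d × Sp d :=
  (0, p.2) + frame d t ((jb t)⁻¹ • p.1)

lemma slant_apply (p : Sp d × Sp d) :
    slant d t p = (p.1, p.2 + (t / jb t) • (jb t)⁻¹ • p.1) := by
  rw [slant, frame_apply, smul_smul (jb t), mul_inv_cancel₀ (jb_pos t).ne', one_smul,
    Prod.mk_add_mk, zero_add]

lemma continuous_slant : Continuous (slant d t) := by
  unfold slant
  fun_prop

lemma measurePreserving_slant : MeasurePreserving (slant d t) volume volume := by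
  have h1 : MeasurePreserving (fun p : Sp d × Sp d => (p.1, p.2 + (t / jb t) • (jb t)⁻¹ • p.1))
      volume volume :=
    (MeasurePreserving.id volume).skew_product
      (g := fun x v => v + (t / jb t) • (jb t)⁻¹ • x) (by fun_prop)
      (ae_of_all _ fun x => map_add_right_eq_self _ _)
  rwa [← funext slant_apply] at h1

lemma measurableEmbedding_slant : MeasurableEmbedding (slant d t) := by
  refine continuous_slant.measurableEmbedding fun p q hpq => ?_
  rw [slant_apply, slant_apply, Prod.mk.injEq] at hpq
  obtain ⟨h1, h2⟩ := hpq
  rw [h1, add_left_inj] at h2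
  exact Prod.ext h1 h2

/-- The flow to the initial time in the adapted coordinates. -/
def slantFlow (p : Sp d × Sp d) : Sp d × Sp d := S.phaseMap (slant d t p)

lemma lintegral_slantFlow_le (g : Sp d × Sp d → ℝ≥0∞) :
    ∫⁻ p, g (S.slantFlow p) ≤ 2 * ∫⁻ p, g p := by
  have := (measurePreserving_slant (d := d) (t := t)).lintegral_comp_emb measurableEmbedding_slant
    fun p => g (S.phaseMap p)
  exact this.trans_le (S.lintegral_phaseMap_le g)

lemma quasiMeasurePreserving_slantFlow :
    Measure.QuasiMeasurePreserving S.slantFlow volume volume :=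
  S.quasiMeasurePreserving_phaseMap.comp measurePreserving_slant.quasiMeasurePreserving

/-- The jets of the flow in the moving frame. -/
def jet (p : Sp d × Sp d) : FormalMultilinearSeries ℝ (Sp d) (Sp d × Sp d) :=
  ftaylorSeries ℝ (fun ζ => S.phaseMap ((0, p.2) + frame d t ζ)) ((jb t)⁻¹ • p.1)

lemma continuous_jet {i : ℕ} (hi : i ≤ N) : Continuous fun p => S.jet p i := by
  have hi' : (i : WithTop ℕ∞) ≤ N := by exact_mod_cast hi
  have h1 : ∀ p, S.jet p i = (iteratedFDeriv ℝ i S.phaseMap (slant d t p)).compContinuousLinearMap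
      fun _ => frame d t := by
    intro p
    have h2 : ContDiff ℝ N fun q => S.phaseMap ((0, p.2) + q) :=
      S.contDiff_phaseMap.comp (contDiff_const.add contDiff_id)
    have h3 := (frame d t).iteratedFDeriv_comp_right h2 ((jb t)⁻¹ • p.1) hi'
    rw [iteratedFDeriv_comp_add_left] at h3
    exact h3
  simp only [h1]
  exact (ContinuousMultilinearMap.compContinuousLinearMapL
    fun _ : Fin i => frame d t).continuous.comp
    ((S.contDiff_phaseMap.continuous_iteratedFDeriv hi').comp continuous_slant)

lemma norm_jet_le {i : ℕ} (h1 : 1 ≤ i) (hi : i ≤ N) (p : Sp d × Sp d) : ‖S.jet p i‖ ≤ 2 := by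
  have := S.norm_iteratedFDeriv_traj_le S.start (0, p.2) h1 hi ((jb t)⁻¹ • p.1)
  rwa [← phaseMap_frame] at this

/-- A family of jets on phase space along the flow. -/
def jetSeries (q : (j : ℕ) → Sp d × Sp d →
    ContinuousMultilinearMap ℝ (fun _ : Fin j => Sp d × Sp d) ℝ) (p : Sp d × Sp d) :
    FormalMultilinearSeries ℝ (Sp d × Sp d) ℝ := fun j => q j (S.slantFlow p)

/-- The pullback of jets on phase space by the flow in the moving frame. -/
def pull (q : (j : ℕ) → Sp d × Sp d → ContinuousMultilinearMap ℝ (fun _ : Fin j => Sp d × Sp d) ℝ)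
    (k : ℕ) (p : Sp d × Sp d) : ContinuousMultilinearMap ℝ (fun _ : Fin k => Sp d) ℝ :=
  (jb t)⁻¹ ^ k •
    (S.jetSeries q p).taylorComp (S.jet p) k

variable {q q' : (j : ℕ) → Sp d × Sp d →
  ContinuousMultilinearMap ℝ (fun _ : Fin j => Sp d × Sp d) ℝ}

lemma pull_sub (k : ℕ) (p : Sp d × Sp d) :
    S.pull (fun j z => q j z - q' j z) k p = S.pull q k p - S.pull q' k p := by
  have h1 : S.jetSeries (fun j z => q j z - q' j z) p = S.jetSeries q p - S.jetSeries q' p := rfl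
  have h2 := taylorComp_sub (S.jetSeries q p) (S.jetSeries q' p) (S.jet p) k
  rw [pull, h1, h2]
  exact smul_sub ((jb t)⁻¹ ^ k) _ _

/-- In the frame the flow to time zero has jets of positive order bounded by `2`, so Faà di Bruno
leaves only the outer jets. The factor `⟨t⟩^k` cancels the rescaling from `x` to `ζ`. -/
lemma enorm_pull_le {k : ℕ} (hk : k ≤ N) (p : Sp d × Sp d) :
    ENNReal.ofReal (jb t ^ k) * ‖S.pull q k p‖ₑ ≤ ENNReal.ofReal (faaConst N) *
      ∑ j ∈ Finset.range (N + 1), ‖q j (S.slantFlow p)‖ₑ := by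
  have hj := jb_pos t
  have h1 : jb t ^ k * ‖S.pull q k p‖
      ≤ faaConst N * ∑ j ∈ Finset.range (N + 1), ‖q j (S.slantFlow p)‖ := by
    rw [pull, norm_smul, norm_pow, norm_inv, Real.norm_of_nonneg hj.le, ← mul_assoc, ← mul_pow,
      mul_inv_cancel₀ hj.ne', one_pow, one_mul]
    refine (norm_taylorComp_le _ _ k (Q := ∑ j ∈ Finset.range (N + 1), ‖q j (S.slantFlow p)‖)
      (fun j hj => ?_) fun i hi hik => S.norm_jet_le hi (hik.trans hk) p).trans ?_
    · exact Finset.single_le_sum (f := fun j => ‖q j (S.slantFlow p)‖)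
        (fun i _ => norm_nonneg _) (by simp; omega)
    · exact mul_le_mul_of_nonneg_right (le_faaConst' hk)
        (Finset.sum_nonneg fun i _ => norm_nonneg _)
  have h2 := ENNReal.ofReal_le_ofReal h1
  rw [ENNReal.ofReal_mul (by positivity), ENNReal.ofReal_mul (faaConst_nonneg N),
    ENNReal.ofReal_sum_of_nonneg fun i _ => norm_nonneg _] at h2
  simpa only [ofReal_norm] using h2

lemma lintegral_sum_slantFlow_le (hq : ∀ j, j ≤ N → AEStronglyMeasurable (q j) volume) :
    ∫⁻ p, ∑ j ∈ Finset.range (N + 1), ‖q j (S.slantFlow p)‖ₑ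
      ≤ 2 * ∑ j ∈ Finset.range (N + 1), ∫⁻ z, ‖q j z‖ₑ := by
  rw [lintegral_finsetSum' _ fun j hj => ?_, Finset.mul_sum]
  · exact Finset.sum_le_sum fun j _ => S.lintegral_slantFlow_le fun z => ‖q j z‖ₑ
  · exact ((hq j (by simpa [Nat.lt_succ_iff] using hj)).comp_quasiMeasurePreserving
      S.quasiMeasurePreserving_slantFlow).enorm

lemma lintegral_pull_le (hq : ∀ j, j ≤ N → AEStronglyMeasurable (q j) volume) {k : ℕ}
    (hk : k ≤ N) :
    ENNReal.ofReal (jb t ^ k) * ∫⁻ p, ‖S.pull q k p‖ₑ ≤ ENNReal.ofReal (faaConst N) *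
      (2 * ∑ j ∈ Finset.range (N + 1), ∫⁻ z, ‖q j z‖ₑ) := by
  rw [← lintegral_const_mul' _ _ ENNReal.ofReal_ne_top]
  refine (lintegral_mono fun p => S.enorm_pull_le hk p).trans ?_
  rw [lintegral_const_mul' _ _ ENNReal.ofReal_ne_top]
  exact mul_le_mul_right (S.lintegral_sum_slantFlow_le hq) _

lemma aestronglyMeasurable_pull (hq : ∀ j, j ≤ N → AEStronglyMeasurable (q j) volume) {k : ℕ}
    (hk : k ≤ N) : AEStronglyMeasurable (S.pull q k) volume := by
  have : AEStronglyMeasurable (fun p => (S.jetSeries q p).taylorComp (S.jet p) k) volume := by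
    refine aestronglyMeasurable_taylorComp k (fun j hj => ?_)
      fun i hi => S.continuous_jet (hi.trans hk)
    exact (hq j (hj.trans hk)).comp_quasiMeasurePreserving S.quasiMeasurePreserving_slantFlow
  exact this.const_smul ((jb t)⁻¹ ^ k)

lemma integrable_pull (hq : ∀ j, j ≤ N → Integrable (q j)) {k : ℕ} (hk : k ≤ N) :
    Integrable (S.pull q k) := by
  refine ⟨S.aestronglyMeasurable_pull (fun j hj => (hq j hj).aestronglyMeasurable) hk, ?_⟩
  have h1 := S.lintegral_pull_le (fun j hj => (hq j hj).aestronglyMeasurable) hk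
  have h2 : ENNReal.ofReal (faaConst N) *
      (2 * ∑ j ∈ Finset.range (N + 1), ∫⁻ z, ‖q j z‖ₑ) < ⊤ := by
    refine ENNReal.mul_lt_top ENNReal.ofReal_lt_top (ENNReal.mul_lt_top ENNReal.ofNat_lt_top ?_)
    exact ENNReal.sum_lt_top.2 fun j hj => (hq j (by simpa [Nat.lt_succ_iff] using hj)).2
  refine lt_of_le_of_lt ?_ (h1.trans_lt h2)
  have h3 : 1 ≤ ENNReal.ofReal (jb t ^ k) := by
    rw [ENNReal.one_le_ofReal]
    exact one_le_pow₀ (one_le_jb t)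
  exact le_mul_of_one_le_left' h3

lemma integrable_slantFlow {f : Sp d × Sp d → ℝ} (hf : Integrable f) :
    Integrable fun p => f (S.slantFlow p) := by
  refine ⟨hf.aestronglyMeasurable.comp_quasiMeasurePreserving
    S.quasiMeasurePreserving_slantFlow, ?_⟩
  exact (S.lintegral_slantFlow_le fun z => ‖f z‖ₑ).trans_lt
    (ENNReal.mul_lt_top ENNReal.ofNat_lt_top hf.2)

lemma contDiff_slantFlow (v : Sp d) : ContDiff ℝ N fun x => S.slantFlow (x, v) := by
  have : ContDiff ℝ N fun x : Sp d => slant d t (x, v) := by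
    unfold slant
    fun_prop
  exact S.contDiff_phaseMap.comp this

/-- The chain rule for functions transported by the flow, in the moving frame. -/
lemma iteratedFDeriv_comp_slantFlow {f : Sp d × Sp d → ℝ} (hf : ContDiff ℝ N f) {k : ℕ}
    (hk : k ≤ N) (x v : Sp d) :
    iteratedFDeriv ℝ k (fun x => f (S.slantFlow (x, v))) x
      = S.pull (fun j => iteratedFDeriv ℝ j f) k (x, v) := by
  have hk' : (k : WithTop ℕ∞) ≤ N := by exact_mod_cast hk
  have h1 : ContDiff ℝ N fun ζ => S.phaseMap ((0, v) + frame d t ζ) :=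
    S.contDiff_phaseMap.comp (contDiff_const.add (frame d t).contDiff)
  have h2 := congrFun (iteratedFDeriv_comp_const_smul (jb t)⁻¹
    ((hf.comp h1).of_le hk')) x
  have h3 := iteratedFDeriv_comp (f := fun ζ => S.phaseMap ((0, v) + frame d t ζ))
    (hf.contDiffAt (x := S.phaseMap ((0, v) + frame d t ((jb t)⁻¹ • x))))
    (h1.contDiffAt (x := (jb t)⁻¹ • x)) hk'
  exact h2.trans (congrArg (fun M => (jb t)⁻¹ ^ k • M) h3)

end Flow

end VlasovForcing

/-! ### Integration by parts for transported weakly differentiable data -/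

namespace VlasovForcing

section WeakDerivative

variable {F : Type*} [NormedAddCommGroup F] [NormedSpace ℝ F] [MeasureSpace F]

/-- Fundamental lemma of the calculus of variations. It lets bounds on the zeroth jet control the
function itself. -/
lemma IsWeakDeriv.ae_eq_apply_zero [FiniteDimensional ℝ F] [BorelSpace F] {f : F → ℝ}
    {g : F → ContinuousMultilinearMap ℝ (fun _ : Fin 0 => F) ℝ} (h : IsWeakDeriv 0 f g) :
    ∀ᵐ z, f z = g z 0 := by
  refine ae_eq_of_integral_contDiff_smul_eq h.1 ?_ fun φ hφ hc => ?_
  · intro z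
    obtain ⟨U, hU, hi⟩ := h.2.1 z
    exact ⟨U, hU, (continuousMultilinearCurryFin0 ℝ F ℝ).toContinuousLinearEquiv.integrable_comp_iff.2
      hi⟩
  · have := h.2.2 φ hφ hc 0
    simp only [iteratedFDeriv_zero_apply, pow_zero, one_mul] at this
    simpa only [smul_eq_mul, mul_comm] using this

end WeakDerivative

namespace Flow

variable {d N : ℕ} {E : ℝ → Sp d → Sp d} {e t D : ℝ} {X V : ℝ → ℝ → Sp d → Sp d → Sp d}
  (S : Flow N E e t D X V)
  {q : (j : ℕ) → Sp d × Sp d → ContinuousMultilinearMap ℝ (fun _ : Fin j => Sp d × Sp d) ℝ}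

lemma enorm_integral_mul_le {f : Sp d × Sp d → ℝ} {w : Sp d → ℝ} {C : ℝ}
    (hw : ∀ x, ‖w x‖ ≤ C) :
    ‖∫ p : Sp d × Sp d, f p * w p.1‖ₑ ≤ ENNReal.ofReal C * ∫⁻ p, ‖f p‖ₑ := by
  refine (enorm_integral_le_lintegral_enorm _).trans ?_
  rw [← lintegral_const_mul' _ _ ENNReal.ofReal_ne_top]
  refine lintegral_mono fun p => ?_
  rw [enorm_mul, mul_comm, ← ofReal_norm (w p.1)]
  gcongr
  exact hw _

lemma integrable_mul_test {f : Sp d × Sp d → ℝ} (hf : Integrable f) {w : Sp d → ℝ} {C : ℝ}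
    (hw : ∀ x, ‖w x‖ ≤ C) (hwc : Continuous w) :
    Integrable fun p : Sp d × Sp d => f p * w p.1 :=
  hf.mul_bdd (c := C) (hwc.comp continuous_fst).aestronglyMeasurable (ae_of_all _ fun _ => hw _)

lemma integrable_pull_apply (hq : ∀ j, j ≤ N → Integrable (q j)) {k : ℕ} (hk : k ≤ N)
    (m : Fin k → Sp d) : Integrable fun p => S.pull q k p m :=
  (ContinuousMultilinearMap.apply ℝ (fun _ : Fin k => Sp d) ℝ m).integrable_comp
    (S.integrable_pull hq hk)

/-- Integration by parts in the moving frame, for smooth functions. -/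
lemma integral_slantFlow_of_contDiff {f : Sp d × Sp d → ℝ} (hf : ContDiff ℝ N f)
    (hfi : Integrable f) (hfj : ∀ j, j ≤ N → Integrable (iteratedFDeriv ℝ j f)) {k : ℕ}
    (hk : k ≤ N) {φ : Sp d → ℝ} (hφ : ContDiff ℝ ∞ φ) (hc : HasCompactSupport φ)
    (m : Fin k → Sp d) :
    ∫ p : Sp d × Sp d, f (S.slantFlow p) * iteratedFDeriv ℝ k φ p.1 m
      = (-1) ^ k * ∫ p : Sp d × Sp d, S.pull (fun j => iteratedFDeriv ℝ j f) k p m * φ p.1 := by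
  have hsm : ContDiff ℝ k φ := hφ.of_le (by exact_mod_cast le_top)
  obtain ⟨C₀, hC₀⟩ := hc.exists_bound_of_continuous hφ.continuous
  obtain ⟨C, hC⟩ := exists_bound_iteratedFDeriv hsm hc
  have hder : Continuous fun x => iteratedFDeriv ℝ k φ x m :=
    (ContinuousMultilinearMap.apply ℝ (fun _ : Fin k => Sp d) ℝ m).continuous.comp
      (hsm.continuous_iteratedFDeriv le_rfl)
  have hi₁ := integrable_mul_test (S.integrable_slantFlow hfi) (C := C * ∏ i, ‖m i‖)
    (w := fun x => iteratedFDeriv ℝ k φ x m) (fun x => ContinuousMultilinearMap.le_of_opNorm_le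
      (hC x) m) hder
  have hi₂ := integrable_mul_test (S.integrable_pull_apply hfj hk m) hC₀ hφ.continuous
  rw [Measure.volume_eq_prod] at hi₁ hi₂ ⊢
  rw [integral_prod_symm _ hi₁, integral_prod_symm _ hi₂, ← integral_const_mul]
  refine integral_congr_ae (ae_of_all _ fun v => ?_)
  have := integral_mul_iteratedFDeriv (u := fun x => f (S.slantFlow (x, v)))
    ((hf.comp (S.contDiff_slantFlow v)).of_le (by exact_mod_cast hk)) hφ hc m
  simp only [S.iteratedFDeriv_comp_slantFlow hf hk] at this
  exact this

/-- Integration by parts in the moving frame, for weakly differentiable functions. -/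
theorem integral_slantFlow {f : Sp d × Sp d → ℝ} (hf : Integrable f)
    (hq : ∀ j, j ≤ N → Integrable (q j) ∧ IsWeakDeriv j f (q j)) {k : ℕ}
    (hk : k ≤ N) {φ : Sp d → ℝ} (hφ : ContDiff ℝ ∞ φ) (hc : HasCompactSupport φ)
    (m : Fin k → Sp d) :
    ∫ p : Sp d × Sp d, f (S.slantFlow p) * iteratedFDeriv ℝ k φ p.1 m
      = (-1) ^ k * ∫ p : Sp d × Sp d, S.pull q k p m * φ p.1 := by
  have hsm : ContDiff ℝ k φ := hφ.of_le (by exact_mod_cast le_top)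
  obtain ⟨C₀, hC₀⟩ := hc.exists_bound_of_continuous hφ.continuous
  obtain ⟨C, hC⟩ := exists_bound_iteratedFDeriv hsm hc
  have hCm : ∀ x, ‖iteratedFDeriv ℝ k φ x m‖ ≤ C * ∏ i, ‖m i‖ := fun x =>
    ContinuousMultilinearMap.le_of_opNorm_le (hC x) m
  have hder : Continuous fun x => iteratedFDeriv ℝ k φ x m :=
    (ContinuousMultilinearMap.apply ℝ (fun _ : Fin k => Sp d) ℝ m).continuous.comp
      (hsm.continuous_iteratedFDeriv le_rfl)
  have hqi := fun j hj => (hq j hj).1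
  set M : ℝ≥0∞ := ENNReal.ofReal (C * ∏ i, ‖m i‖) * 2 +
    ENNReal.ofReal C₀ * (ENNReal.ofReal (∏ i, ‖m i‖) *
      (ENNReal.ofReal (faaConst N) * (2 * (N + 1 : ℕ)))) with hM
  have hMtop : M ≠ ⊤ := by
    simp only [hM]
    finiteness
  -- For a smooth `δ`-approximation `h` the identity is exact, so the defect for `f` equals that of
  -- `h - f`. Both integrals are bounded on `L^1`, with a constant `M` independent of `δ`.
  have key : ∀ δ : ℝ≥0∞, δ ≠ 0 → δ ≠ ⊤ →
      ‖(∫ p : Sp d × Sp d, f (S.slantFlow p) * iteratedFDeriv ℝ k φ p.1 m)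
        - (-1) ^ k * ∫ p : Sp d × Sp d, S.pull q k p m * φ p.1‖ₑ ≤ M * δ := by
    intro δ hδ hδt
    obtain ⟨h, hh, hle⟩ := exists_contDiff_approx hf hq hδ
    have hji : ∀ j, j ≤ N → Integrable (fun z => iteratedFDeriv ℝ j h z - q j z) := by
      intro j hj
      have hcj : Continuous (iteratedFDeriv ℝ j h) :=
        hh.continuous_iteratedFDeriv (by exact_mod_cast hj)
      have hmj : AEStronglyMeasurable (iteratedFDeriv ℝ j h) volume := hcj.aestronglyMeasurable
      exact ⟨hmj.sub (hqi j hj).aestronglyMeasurable, (hle j hj).trans_lt hδt.lt_top⟩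
    have hjh : ∀ j, j ≤ N → Integrable (iteratedFDeriv ℝ j h) := by
      intro j hj
      refine ((hji j hj).sub (hqi j hj).neg).congr (ae_of_all _ fun z => ?_)
      simp
    have hqz := (hq 0 (Nat.zero_le _)).2.ae_eq_apply_zero
    have hfh : ∫⁻ z, ‖h z - f z‖ₑ ≤ δ := by
      refine le_trans (lintegral_mono_ae ?_) (hle 0 (Nat.zero_le _))
      filter_upwards [hqz] with z hz
      rw [hz, ← ofReal_norm, ← ofReal_norm]
      refine ENNReal.ofReal_le_ofReal ?_
      have := (iteratedFDeriv ℝ 0 h z - q 0 z).le_opNorm 0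
      simpa using this
    have hfi : Integrable fun z => h z - f z :=
      ⟨hh.continuous.aestronglyMeasurable.sub hf.aestronglyMeasurable, hfh.trans_lt hδt.lt_top⟩
    have hhi : Integrable h :=
      (hfi.add hf).congr (ae_of_all _ fun z => sub_add_cancel (h z) (f z))
    have h1 := S.integral_slantFlow_of_contDiff hh hhi hjh hk hφ hc m
    have e1 : ∫ p : Sp d × Sp d, (h (S.slantFlow p) - f (S.slantFlow p)) *
          iteratedFDeriv ℝ k φ p.1 m
        = (∫ p : Sp d × Sp d, h (S.slantFlow p) * iteratedFDeriv ℝ k φ p.1 m)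
          - ∫ p : Sp d × Sp d, f (S.slantFlow p) * iteratedFDeriv ℝ k φ p.1 m := by
      rw [← integral_sub (integrable_mul_test (S.integrable_slantFlow hhi) hCm hder)
        (integrable_mul_test (S.integrable_slantFlow hf) hCm hder)]
      simp only [sub_mul]
    have e2 : ∫ p : Sp d × Sp d, S.pull (fun j z => iteratedFDeriv ℝ j h z - q j z) k p m * φ p.1
        = (∫ p : Sp d × Sp d, S.pull (fun j => iteratedFDeriv ℝ j h) k p m * φ p.1)
          - ∫ p : Sp d × Sp d, S.pull q k p m * φ p.1 := by
      rw [← integral_sub (integrable_mul_test (S.integrable_pull_apply hjh hk m) hC₀ hφ.continuous)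
        (integrable_mul_test (S.integrable_pull_apply hqi hk m) hC₀ hφ.continuous)]
      simp only [S.pull_sub, sub_apply, sub_mul]
    have b1 := enorm_integral_mul_le (f := fun p => h (S.slantFlow p) - f (S.slantFlow p)) hCm
    have b2 := enorm_integral_mul_le
      (f := fun p => S.pull (fun j z => iteratedFDeriv ℝ j h z - q j z) k p m) hC₀
    have b3 : ∫⁻ p, ‖h (S.slantFlow p) - f (S.slantFlow p)‖ₑ ≤ 2 * δ :=
      (S.lintegral_slantFlow_le fun z => ‖h z - f z‖ₑ).trans (mul_le_mul_right hfh _)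
    have b4 : ∫⁻ p, ‖S.pull (fun j z => iteratedFDeriv ℝ j h z - q j z) k p m‖ₑ
        ≤ ENNReal.ofReal (∏ i, ‖m i‖) *
          (ENNReal.ofReal (faaConst N) * (2 * ((N + 1 : ℕ) * δ))) := by
      calc _ ≤ ∫⁻ p, ENNReal.ofReal (∏ i, ‖m i‖) *
            ‖S.pull (fun j z => iteratedFDeriv ℝ j h z - q j z) k p‖ₑ := by
            refine lintegral_mono fun p => ?_
            rw [← ofReal_norm, ← ofReal_norm, ← ENNReal.ofReal_mul (by positivity), mul_comm]
            exact ENNReal.ofReal_le_ofReal (ContinuousMultilinearMap.le_opNorm _ _)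
        _ ≤ _ := by
            rw [lintegral_const_mul' _ _ ENNReal.ofReal_ne_top]
            refine mul_le_mul_right ?_ _
            have h3 : 1 ≤ ENNReal.ofReal (jb t ^ k) := by
              rw [ENNReal.one_le_ofReal]
              exact one_le_pow₀ (one_le_jb t)
            refine (le_mul_of_one_le_left' h3).trans ((S.lintegral_pull_le (fun j hj =>
              (hji j hj).aestronglyMeasurable) hk).trans ?_)
            gcongr
            refine (Finset.sum_le_card_nsmul _ _ δ fun j hj => hle j
              (by simpa [Nat.lt_succ_iff] using hj)).trans_eq ?_
            simp
    have e3 : (∫ p : Sp d × Sp d, f (S.slantFlow p) * iteratedFDeriv ℝ k φ p.1 m)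
          - (-1) ^ k * ∫ p : Sp d × Sp d, S.pull q k p m * φ p.1
        = (-1) ^ k * (∫ p : Sp d × Sp d,
            S.pull (fun j z => iteratedFDeriv ℝ j h z - q j z) k p m * φ p.1)
          - ∫ p : Sp d × Sp d, (h (S.slantFlow p) - f (S.slantFlow p)) *
            iteratedFDeriv ℝ k φ p.1 m := by
      rw [e1, e2, h1]
      ring
    rw [e3]
    calc _ ≤ ‖∫ p : Sp d × Sp d,
            S.pull (fun j z => iteratedFDeriv ℝ j h z - q j z) k p m * φ p.1‖ₑ
          + ‖∫ p : Sp d × Sp d, (h (S.slantFlow p) - f (S.slantFlow p)) *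
            iteratedFDeriv ℝ k φ p.1 m‖ₑ := by
          refine enorm_sub_le.trans_eq ?_
          congr 1
          rw [enorm_mul, enorm_pow, enorm_neg, enorm_one, one_pow, one_mul]
      _ ≤ ENNReal.ofReal C₀ * (ENNReal.ofReal (∏ i, ‖m i‖) *
          (ENNReal.ofReal (faaConst N) * (2 * ((N + 1 : ℕ) * δ))))
          + ENNReal.ofReal (C * ∏ i, ‖m i‖) * (2 * δ) :=
        add_le_add (b2.trans (mul_le_mul_right b4 _)) (b1.trans (mul_le_mul_right b3 _))
      _ = M * δ := by
          rw [hM]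
          ring
  have hzero : ‖(∫ p : Sp d × Sp d, f (S.slantFlow p) * iteratedFDeriv ℝ k φ p.1 m)
        - (-1) ^ k * ∫ p : Sp d × Sp d, S.pull q k p m * φ p.1‖ₑ ≤ 0 := by
    refine le_of_forall_pos_le_add fun η hη => ?_
    rw [zero_add]
    rcases eq_or_ne η ⊤ with rfl | hη'
    · exact le_top
    -- The denominator `M + 1` is nonzero and finite, also when `M = 0`.
    · refine (key (η / (M + 1)) ?_ ?_).trans ?_
      · exact (ENNReal.div_pos hη.ne' (by finiteness)).ne'
      · exact ENNReal.div_ne_top hη' (by simp)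
      · rw [← mul_div_assoc]
        refine ENNReal.div_le_of_le_mul ?_
        rw [mul_comm]
        gcongr
        exact le_self_add
  exact sub_eq_zero.1 (enorm_eq_zero.1 (le_antisymm hzero zero_le))

end Flow

end VlasovForcing

/-! ### Estimates for the initial data term -/

namespace VlasovForcing
namespace Flow

variable {d N : ℕ} {E : ℝ → Sp d → Sp d} {e t D : ℝ} {X V : ℝ → ℝ → Sp d → Sp d → Sp d}
  (S : Flow N E e t D X V)
  {q : (j : ℕ) → Sp d × Sp d → ContinuousMultilinearMap ℝ (fun _ : Fin j => Sp d × Sp d) ℝ}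
  {f₀ : Sp d × Sp d → ℝ}

lemma phaseMap_eq (x v : Sp d) : (X 0 t x v, V 0 t x v) = S.phaseMap (x, v) := by
  have h1 := S.pos_eq S.start x v
  have h2 := S.vel_eq S.start x v
  exact Prod.ext h1 h2

lemma integrable_phaseMap (hf : Integrable f₀) : Integrable fun p => f₀ (S.phaseMap p) := by
  refine ⟨hf.aestronglyMeasurable.comp_quasiMeasurePreserving
    S.quasiMeasurePreserving_phaseMap, ?_⟩
  exact (S.lintegral_phaseMap_le fun z => ‖f₀ z‖ₑ).trans_lt
    (ENNReal.mul_lt_top ENNReal.ofNat_lt_top hf.2)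

/-- The slanted coordinates shift `v` by an amount depending on `x` only, so the velocity integral
is unchanged. Differentiating under the integral then sees the moving frame. -/
lemma termI_eq (x : Sp d) : termI f₀ X V t x = ∫ v, f₀ (S.slantFlow (x, v)) := by
  have h1 : ∀ v, f₀ (S.slantFlow (x, v))
      = (fun v => f₀ (S.phaseMap (x, v))) (v + (t / jb t) • (jb t)⁻¹ • x) := fun v => by
    rw [slantFlow, slant_apply]
  rw [integral_congr_ae (ae_of_all _ h1),
    integral_add_right_eq_self (fun v => f₀ (S.phaseMap (x, v))), termI]
  simp only [S.phaseMap_eq]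

/-- The weak derivatives of the initial data term. -/
theorem isWeakDeriv_termI (hf : Integrable f₀)
    (hq : ∀ j, j ≤ N → Integrable (q j) ∧ IsWeakDeriv j f₀ (q j)) {k : ℕ} (hk : k ≤ N) :
    IsWeakDeriv k (termI f₀ X V t) fun x => ∫ v, S.pull q k (x, v) := by
  have hfi := S.integrable_slantFlow hf
  have hpi := S.integrable_pull (fun j hj => (hq j hj).1) hk
  rw [Measure.volume_eq_prod] at hfi hpi
  refine ⟨?_, hpi.integral_prod_left.locallyIntegrable, fun φ hφ hc m => ?_⟩
  · rw [funext S.termI_eq]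
    exact hfi.integral_prod_left.locallyIntegrable
  have hsm : ContDiff ℝ k φ := hφ.of_le (by exact_mod_cast le_top)
  obtain ⟨C₀, hC₀⟩ := hc.exists_bound_of_continuous hφ.continuous
  obtain ⟨C, hC⟩ := exists_bound_iteratedFDeriv hsm hc
  have hder : Continuous fun x => iteratedFDeriv ℝ k φ x m :=
    (ContinuousMultilinearMap.apply ℝ (fun _ : Fin k => Sp d) ℝ m).continuous.comp
      (hsm.continuous_iteratedFDeriv le_rfl)
  have hi₁ := integrable_mul_test (S.integrable_slantFlow hf) (C := C * ∏ i, ‖m i‖)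
    (w := fun x => iteratedFDeriv ℝ k φ x m) (fun x => ContinuousMultilinearMap.le_of_opNorm_le
      (hC x) m) hder
  have hi₂ := integrable_mul_test (S.integrable_pull_apply (fun j hj => (hq j hj).1) hk m) hC₀
    hφ.continuous
  have key := S.integral_slantFlow hf hq hk hφ hc m
  rw [Measure.volume_eq_prod] at hi₁ hi₂ key
  rw [integral_prod _ hi₁, integral_prod _ hi₂] at key
  simp only [integral_mul_const] at key
  calc _ = _ := by simp only [S.termI_eq]
    _ = _ := key
    _ = _ := by
      congr 1
      refine integral_congr_ae ?_
      filter_upwards [hpi.prod_right_ae] with x hx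
      rw [ContinuousMultilinearMap.integral_apply hx]

lemma eLpNorm_one_integral_pull_le (hq : ∀ j, j ≤ N → AEStronglyMeasurable (q j) volume)
    {k : ℕ} (hk : k ≤ N) :
    ENNReal.ofReal (jb t ^ k) * eLpNorm (fun x => ∫ v, S.pull q k (x, v)) 1 volume
      ≤ ENNReal.ofReal (faaConst N) *
        (2 * ∑ j ∈ Finset.range (N + 1), eLpNorm (q j) 1 volume) := by
  simp only [eLpNorm_one_eq_lintegral_enorm]
  refine le_trans (mul_le_mul_right ?_ _) (S.lintegral_pull_le hq hk)
  calc ∫⁻ x, ‖∫ v, S.pull q k (x, v)‖ₑ ≤ ∫⁻ x, ∫⁻ v, ‖S.pull q k (x, v)‖ₑ :=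
        lintegral_mono fun x => enorm_integral_le_lintegral_enorm _
    _ = ∫⁻ p : Sp d × Sp d, ‖S.pull q k p‖ₑ := by
        rw [Measure.volume_eq_prod, lintegral_prod]
        exact (S.aestronglyMeasurable_pull hq hk).enorm

/-- Passing to the average velocity at `s = 0` makes the position `x - t u` at cost `2`, and the
substitution `y = x - t u` produces `t^d`. -/
lemma lintegral_majorant_le (ht : 0 < t) (h : Sp d → ℝ≥0∞) (x : Sp d) :
    ENNReal.ofReal (t ^ d) * ∫⁻ v, h (S.slantFlow (x, v)).1 ≤ 2 * ∫⁻ y, h y := by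
  have h1 : ∀ v, h (S.slantFlow (x, v)).1
      = (fun v => h (S.path (x, v) S.start)) (v + (t / jb t) • (jb t)⁻¹ • x) := fun v => by
    rw [slantFlow, slant_apply]
    rfl
  have hs : (S.start : ℝ) < t := ht
  simp only [h1]
  rw [lintegral_add_right_eq_self (fun v => h (S.path (x, v) S.start))]
  simp only [S.path_eq_avgVel hs]
  have h2 := S.lintegral_avgVel_le hs x fun u => h (x - (t - (S.start : ℝ)) • u)
  have h3 := lintegral_comp_sub_smul h x (r := t - (S.start : ℝ)) (by linarith)
  have h4 : t - (S.start : ℝ) = t := sub_zero t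
  calc _ ≤ ENNReal.ofReal (t ^ d) * (2 * ∫⁻ u, h (x - (t - (S.start : ℝ)) • u)) :=
        mul_le_mul_right h2 _
    _ = 2 * (ENNReal.ofReal ((t - (S.start : ℝ)) ^ d) *
          ∫⁻ u, h (x - (t - (S.start : ℝ)) • u)) := by rw [h4, mul_left_comm]
    _ = _ := by rw [h3]

/-- Bounding the jets of the datum by functions of position alone removes the initial velocity from
the estimate, so only the map from `v` to the initial position needs to be inverted. -/
lemma eLpNorm_top_integral_pull_le (ht : 0 < t)
    (hq : ∀ j, j ≤ N → AEStronglyMeasurable (q j) volume) {k : ℕ} (hk : k ≤ N) :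
    ENNReal.ofReal (t ^ (d + k)) * eLpNorm (fun x => ∫ v, S.pull q k (x, v)) ∞ volume
      ≤ ENNReal.ofReal (faaConst N) *
        (2 * ∑ j ∈ Finset.range (N + 1), normL1Linf (q j)) := by
  have h1 : ∀ j, ∃ h : Sp d → ℝ≥0∞, Measurable h ∧ (j ≤ N → ∫⁻ x, h x = normL1Linf (q j) ∧
      ∀ᵐ z, ‖q j z‖ₑ ≤ h z.1) := by
    intro j
    by_cases hj : j ≤ N
    · obtain ⟨h, h2, h3⟩ := exists_measurable_majorant (hq j hj)
      exact ⟨h, h2, fun _ => h3⟩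
    · exact ⟨0, measurable_zero, fun h => absurd h hj⟩
  choose h hmeas hh using h1
  have h2 : ∀ᵐ p : Sp d × Sp d, ∀ j ∈ Finset.range (N + 1),
      ‖q j (S.slantFlow p)‖ₑ ≤ h j (S.slantFlow p).1 := by
    rw [Filter.eventually_all_finset]
    intro j hj
    exact S.quasiMeasurePreserving_slantFlow.ae
      (hh j (by simpa [Nat.lt_succ_iff] using hj)).2
  have hflow : Measurable fun p => (S.slantFlow p).1 :=
    ((S.contDiff_phaseMap.continuous.comp continuous_slant).fst).measurable
  have hjt : ENNReal.ofReal (t ^ k) ≤ ENNReal.ofReal (jb t ^ k) :=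
    ENNReal.ofReal_le_ofReal (pow_le_pow_left₀ ht.le (le_jb t) k)
  refine mul_eLpNorm_top_le (by positivity) ?_
  filter_upwards [Measure.ae_ae_of_ae_prod h2] with x hx
  calc ENNReal.ofReal (t ^ (d + k)) * ‖∫ v, S.pull q k (x, v)‖ₑ
      ≤ ENNReal.ofReal (t ^ d) * (ENNReal.ofReal (jb t ^ k) * ∫⁻ v, ‖S.pull q k (x, v)‖ₑ) := by
        rw [pow_add, ENNReal.ofReal_mul (by positivity), mul_assoc]
        gcongr
        exact enorm_integral_le_lintegral_enorm _
    _ ≤ ENNReal.ofReal (t ^ d) * (ENNReal.ofReal (faaConst N) *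
          ∑ j ∈ Finset.range (N + 1), ∫⁻ v, h j (S.slantFlow (x, v)).1) := by
        refine mul_le_mul_right ?_ _
        have hm : ∀ j ∈ Finset.range (N + 1), Measurable fun v => h j (S.slantFlow (x, v)).1 :=
          fun j _ => ((hmeas j).comp hflow).comp measurable_prodMk_left
        rw [← lintegral_const_mul' _ _ ENNReal.ofReal_ne_top, ← lintegral_finsetSum _ hm,
          ← lintegral_const_mul' _ _ ENNReal.ofReal_ne_top]
        refine lintegral_mono_ae ?_
        filter_upwards [hx] with v hv
        exact (S.enorm_pull_le hk (x, v)).trans (mul_le_mul_right (Finset.sum_le_sum hv) _)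
    _ = ENNReal.ofReal (faaConst N) * ∑ j ∈ Finset.range (N + 1),
          ENNReal.ofReal (t ^ d) * ∫⁻ v, h j (S.slantFlow (x, v)).1 := by
        rw [mul_left_comm, Finset.mul_sum]
    _ ≤ _ := by
        refine mul_le_mul_right ?_ _
        rw [Finset.mul_sum]
        refine Finset.sum_le_sum fun j hj => ?_
        rw [← (hh j (by simpa [Nat.lt_succ_iff] using hj)).1]
        exact S.lintegral_majorant_le ht (h j) x

/-- The estimate of the initial data term. -/
theorem termI_bound (S : Flow N E e t D X V) (hd : 0 < d) {ε₀ : ℝ}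
    (hf : SmallDatum N ε₀ f₀) :
    (∀ᵐ x, Integrable (fun v => f₀ (X 0 t x v, V 0 t x v)) volume) ∧
      ∀ k, k ≤ N → ∃ g, IsWeakDeriv k (termI f₀ X V t) g ∧
        ENNReal.ofReal (jb t ^ k) * eLpNorm g 1 volume
          + ENNReal.ofReal (t ^ (d + k)) * eLpNorm g ∞ volume
          ≤ ENNReal.ofReal (2 * faaConst N * (N + 1) * ε₀) := by
  have h1 : ∀ j, ∃ g : Sp d × Sp d → ContinuousMultilinearMap ℝ (fun _ : Fin j => Sp d × Sp d) ℝ,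
      j ≤ N → IsWeakDeriv j f₀ g ∧ eLpNorm g 1 volume + normL1Linf g ≤ ENNReal.ofReal ε₀ := by
    intro j
    by_cases hj : j ≤ N
    · obtain ⟨g, hg⟩ := hf j hj
      exact ⟨g, fun _ => hg⟩
    · exact ⟨0, fun h => absurd h hj⟩
  choose q hq using h1
  have hqm : ∀ j, j ≤ N → AEStronglyMeasurable (q j) volume :=
    fun j hj => (hq j hj).1.2.1.aestronglyMeasurable
  have hqi : ∀ j, j ≤ N → Integrable (q j) := fun j hj => by
    refine ⟨hqm j hj, ?_⟩
    rw [HasFiniteIntegral, ← eLpNorm_one_eq_lintegral_enorm]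
    exact (le_self_add.trans (hq j hj).2).trans_lt ENNReal.ofReal_lt_top
  have hfi : Integrable f₀ := by
    have hz := Nat.zero_le N
    refine (hqi 0 hz).mono (hq 0 hz).1.1.aestronglyMeasurable ?_
    filter_upwards [(hq 0 hz).1.ae_eq_apply_zero] with z h2
    rw [h2]
    exact ((q 0 z).le_opNorm 0).trans_eq (by simp)
  refine ⟨?_, fun k hk => ⟨fun x => ∫ v, S.pull q k (x, v),
    S.isWeakDeriv_termI hfi (fun j hj => ⟨hqi j hj, (hq j hj).1⟩) hk, ?_⟩⟩
  · have h2 := S.integrable_phaseMap hfi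
    rw [Measure.volume_eq_prod] at h2
    filter_upwards [h2.prod_right_ae] with x hx
    simpa only [S.phaseMap_eq] using hx
  have h3 := S.eLpNorm_one_integral_pull_le hqm hk
  have h4 : ENNReal.ofReal (t ^ (d + k)) * eLpNorm (fun x => ∫ v, S.pull q k (x, v)) ∞ volume
      ≤ ENNReal.ofReal (faaConst N) *
        (2 * ∑ j ∈ Finset.range (N + 1), normL1Linf (q j)) := by
    -- At `t = 0` the average velocity is unavailable, but the weight `t^(d+k)` vanishes because `d
    -- > 0`.
    rcases S.time_nonneg.eq_or_lt with ht | ht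
    · have h5 : t ^ (d + k) = 0 := by rw [← ht, zero_pow (by omega)]
      rw [h5, ENNReal.ofReal_zero, zero_mul]
      exact zero_le
    · exact S.eLpNorm_top_integral_pull_le ht hqm hk
  have hfc := faaConst_nonneg N
  calc _ ≤ ENNReal.ofReal (faaConst N) *
          (2 * ∑ j ∈ Finset.range (N + 1), (eLpNorm (q j) 1 volume + normL1Linf (q j))) := by
        rw [Finset.sum_add_distrib, mul_add, mul_add]
        exact add_le_add h3 h4
    _ ≤ ENNReal.ofReal (faaConst N) *
          (2 * ((N + 1 : ℕ) * ENNReal.ofReal ε₀)) := by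
        gcongr
        refine (Finset.sum_le_card_nsmul _ _ _ fun j hj =>
          (hq j (by simpa [Nat.lt_succ_iff] using hj)).2).trans_eq ?_
        simp
    _ = ENNReal.ofReal (2 * faaConst N * (N + 1) * ε₀) := by
        rw [← ENNReal.ofReal_natCast, ← ENNReal.ofReal_mul (by positivity),
          ← ENNReal.ofReal_ofNat 2, ← ENNReal.ofReal_mul (by positivity),
          ← ENNReal.ofReal_mul (by positivity)]
        congr 1
        push_cast
        ring

end Flow

end VlasovForcing

end

/-! ### Choice of constants and conclusion -/

theorem theorem5p1 (d N : ℕ) (hd : 3 ≤ d) (hN : 1 < N)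
    (μ : VlasovForcing.Sp d → ℝ) (hμ : VlasovForcing.RapidDecay μ) (A : ℝ) (hA : 0 < A) :
    ∃ εbar C : ℝ, 0 < εbar ∧ 0 < C ∧
      ∀ (ε : ℝ), 0 ≤ ε → ε ≤ εbar →
      ∀ (E : ℝ → VlasovForcing.Sp d → VlasovForcing.Sp d)
        (X V : ℝ → ℝ → VlasovForcing.Sp d → VlasovForcing.Sp d → VlasovForcing.Sp d),
      VlasovForcing.FieldRegular N E →
      VlasovForcing.IsCharacteristics E X V →
      VlasovForcing.FieldDecay N (A * ε) E →
      VlasovForcing.DeviationDecay N (A * ε) (d - 2) (VlasovForcing.devY X) →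
      VlasovForcing.DeviationDecay N (A * ε) (d - 1) (VlasovForcing.devW V) →
      -- the initial data term
      (∀ (ε₀ : ℝ), 0 ≤ ε₀ → ∀ (f₀ : VlasovForcing.Sp d × VlasovForcing.Sp d → ℝ),
        VlasovForcing.SmallDatum N ε₀ f₀ → ∀ t : ℝ, 0 ≤ t →
        (∀ᵐ x, Integrable (fun v => f₀ (X 0 t x v, V 0 t x v)) volume) ∧
        ∀ k, k ≤ N → ∃ g, VlasovForcing.IsWeakDeriv k (VlasovForcing.termI f₀ X V t) g ∧
          ENNReal.ofReal (VlasovForcing.jb t ^ k) * eLpNorm g 1 volume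
            + ENNReal.ofReal (t ^ (d + k)) * eLpNorm g ∞ volume
            ≤ ENNReal.ofReal (C * ε₀)) ∧
      -- the reaction term
      (∀ t : ℝ, 0 ≤ t →
        (∀ x,
          Integrable (Function.uncurry (VlasovForcing.integrandRL E μ t x))
            ((volume.restrict (Ioc 0 t)).prod volume) ∧
          Integrable (Function.uncurry (VlasovForcing.integrandRNL E μ X V t x))
            ((volume.restrict (Ioc 0 t)).prod volume)) ∧
        ContDiff ℝ N (VlasovForcing.termR E μ X V t) ∧
        ∀ k, k ≤ N →
          ENNReal.ofReal (VlasovForcing.jb t ^ k)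
              * eLpNorm (iteratedFDeriv ℝ k (VlasovForcing.termR E μ X V t)) 1 volume
            + ENNReal.ofReal (VlasovForcing.jb t ^ (d + k))
              * eLpNorm (iteratedFDeriv ℝ k (VlasovForcing.termR E μ X V t)) ∞ volume
            ≤ ENNReal.ofReal (C * ε ^ 2)) := by

  obtain ⟨e₀, D, he₀, hD, hflow⟩ := VlasovForcing.exists_flow d N hN.le
  -- The comparison of velocities uses `N + 1` derivatives of `∇μ`, hence `N + 2` of `μ`.
  obtain ⟨κ, hκ, hbound⟩ := hμ.exists_bound (N + 2)
  have hg : ContDiff ℝ (N + 1 : ℕ) (fderiv ℝ μ) :=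
    hμ.1.fderiv_right (by exact_mod_cast le_top)
  have hgN : ContDiff ℝ N (fderiv ℝ μ) := hg.of_le (by exact_mod_cast N.le_succ)
  have hgb : ∀ i, i ≤ N + 1 → ∀ v,
      ‖iteratedFDeriv ℝ i (fderiv ℝ μ) v‖ ≤ κ * VlasovForcing.wt d v := fun i hi v => by
    rw [norm_iteratedFDeriv_fderiv]
    exact hbound (i + 1) (by omega) v
  have hfc := VlasovForcing.two_le_flowConst N
  have hfa := VlasovForcing.Flow.faaConst_nonneg N
  have hpc := VlasovForcing.Flow.pairConst_nonneg (d := d) (N := N) hκ.le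
  have hW := VlasovForcing.wtMass_nonneg (d := d)
  set b : ℝ := 8 * 2 ^ (d + N) * A with hb
  have hb0 : 0 < b := by positivity
  set C₁ : ℝ := 2 * VlasovForcing.Flow.faaConst N * (N + 1) with hC₁
  -- The two occurrences of `b` carry the two powers of `ε`: the deviation of the flow has size `b ε
  -- * flowConst N` and the field envelope `(N+1) b ε`.
  set C₂ : ℝ := 4 * (2 * ((D + 2) * VlasovForcing.Flow.pairConst d N κ * 2 ^ ((d : ℝ) + 1)) *
    (b * VlasovForcing.flowConst N) * (2 ^ d * (VlasovForcing.wtMass d + 1)) *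
    ((N + 1) * b)) with hC₂
  have hC₁0 : 0 ≤ C₁ := by positivity
  have hC₂0 : 0 ≤ C₂ := by positivity
  -- The threshold makes the field size `b ε` at most `e₀`; the summand `1` only ensures that the
  -- common constant is positive.
  refine ⟨e₀ / b, C₁ + C₂ + 1, by positivity, by positivity,
    fun ε hε hεle E X V hE hXV hdec _ _ => ?_⟩
  have hAε : 0 ≤ A * ε := by positivity
  have hbε : 8 * 2 ^ (d + N) * (A * ε) = b * ε := by rw [hb]; ring
  have hF : VlasovForcing.FieldBound N (b * ε) E := hbε ▸ hdec.fieldBound hd hE hAε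
  have hsmall : b * ε ≤ e₀ := by
    rw [mul_comm]
    exact (le_div_iff₀ hb0).1 hεle
  refine ⟨fun ε₀ hε₀ f₀ hf t ht => ?_, fun t ht => ?_⟩
  · obtain ⟨S⟩ := hflow _ hsmall E X V hF hXV t ht
    obtain ⟨h1, h2⟩ := S.termI_bound (by omega) hf
    refine ⟨h1, fun k hk => ?_⟩
    obtain ⟨g, h3, h4⟩ := h2 k hk
    refine ⟨g, h3, h4.trans (ENNReal.ofReal_le_ofReal ?_)⟩
    exact mul_le_mul_of_nonneg_right (by linarith) hε₀
  · obtain ⟨S⟩ := hflow _ hsmall E X V hF hXV t ht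
    refine ⟨S.integrable_integrand hgN (fun i hi => hgb i (by omega)) hκ.le,
      S.contDiff_termR hgN (fun i hi => hgb i (by omega)) hκ.le, fun k hk => ?_⟩
    refine (S.eLpNorm_iteratedFDeriv_termR_le hD.le hg hgb hκ.le
      (B := (N + 1) * (8 * 2 ^ (d + N) * (A * ε))) (by positivity)
      (fun s hs => hdec.pow_mul_env_le hAε hs) (fun s hs => hdec.lintegral_env_le hE hAε hs)
      hk).trans (ENNReal.ofReal_le_ofReal ?_)
    calc _ = C₂ * ε ^ 2 := by rw [hC₂, hbε]; ring
      _ ≤ _ := mul_le_mul_of_nonneg_right (by linarith) (sq_nonneg ε)
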